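/- Let $\Omega=(0,1)^2$, let $\kappa$ be a measurable coefficient on $\Omega$ with $1\le\kappa\le\beta$ (for instance a piecewise constant one with minimum $1$ and maximum $\beta$), and put $a(v,w)=\int_\Omega\kappa\nabla v\cdot\nabla w\,dx$, $\|v\|_a=\sqrt{a(v,v)}$. Let $\mathcal T_H$ be the uniform mesh of $\Omega$ with $m=N^2$ closed squares $K_1,\dots,K_m$ of side $H=1/N$, and let $\mathcal T_h$ be obtained by dividing every $K_i$ uniformly into $r\times r$ squares ($N,r\ge1$). Let $V_h\subset H^1_0(\Omega)$ be the $Q_1$ finite element space of $\mathcal T_h$, with stiffness matrix $\mathbf A$ in the nodal basis, let $V_h(K_i)$ be the restriction of $V_h$ to $K_i$, $n_i=\dim V_h(K_i)$, and $$a_i(v,w)=\int_{K_i}\kappa\nabla v\cdot\nabla w\,dx,\qquad s_i(v,w)=H^{-2}\int_{K_i}\kappa vw\,dx .$$ *Auxiliary functions.* Let $\psi^{(i)}_1,\dots,\psi^{(i)}_{n_i}$ be an $s_i$-orthonormal basis of $V_h(K_i)$ with $a_i(\psi_j^{(i)},w)=\lambda_j^{(i)}s_i(\psi_j^{(i)},w)$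 for all $w\in V_h(K_i)$ and $\lambda^{(i)}_1\le\dots\le\lambda^{(i)}_{n_i}$. Let $\mu_i$ be the smallest nonzero eigenvalue of the same problem with $\kappa=1$, and let $0\le L_i\le n_i$ be such that $\lambda^{(i)}_j>\mu_i/2$ for all $j>L_i$. Put $L=\sum_iL_i$. *Dual nodes.* For each $i$ let $\hat p^{(i)}_1,\dots,\hat p^{(i)}_{L_i}$ be vertices of $\mathcal T_h$ interior to $K_i$, with hat functions $\hat\phi^{(i)}_j\in V_h$ normalized by $\|\hat\phi_j^{(i)}\|_a=1$. Assume that $S_i=\big(s_i(\hat\phi_j^{(i)},\psi_k^{(i)})\big)_{j,k\le L_i}$ is nonsingular for every $i$ and that no element of $\mathcal T_h$ has two dual nodes as vertices. Let $\tilde\phi_j^{(i)}=\sum_l(S_i^{-1})_{jl}\hat\phi_l^{(i)}$, let $M_i$ be the matrix $2$-norm of $\big(a(\tilde\phi_j^{(i)},\tilde\phi_l^{(i)})\big)_{j,l\le L_i}$, and $M=\max_iM_i$. *Special basis.* For every interior vertex $p$ of $\mathcal T_h$ that is not a dual node (assume that there is one) let $\phi_p$ be its hat function normalized by $\|\phi_p\|_a=1$,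 and let $\mathbf v_p$ represent $\phi_p-\sum_i\sum_{j\le L_i}s_i(\phi_p,\psi_j^{(i)})\tilde\phi_j^{(i)}$ in the nodal basis. Fix an order of the vertices. (i) For each $K_i$, apply the modified Gram–Schmidt algorithm for the $\mathbf A$-inner product to the $\mathbf v_p$ with $p$ interior to $K_i$. (ii) For each edge $E$ of $\mathcal T_H$ shared by two elements, subtract from each $\mathbf v_p$ with $p$ interior to $E$ its $\mathbf A$-orthogonal projection onto the span of the vectors from (i) for these two elements, and apply the modified Gram–Schmidt algorithm to the results. (iii) For each interior vertex $p$ of $\mathcal T_H$, subtract from $\mathbf v_p$ its $\mathbf A$-orthogonal projection onto the span of the vectors from (i) and (ii) for the four elements and four edges that meet at $p$, and normalize to an $\mathbf A$-unit vector. Let $\mathbf K$ be the matrix whose columns are all the vectors so obtained, let $\mathfrak K=\lambda_{\max}(\mathbf K^T\mathbf A\mathbf K)/\lambda_{\min}(\mathbf K^T\mathbf A\mathbf K)$ and $q=(\sqrt{\mathfrak K}-1)/(\sqrt{\mathfrak K}+1)$. *Method.* For $k\ge0$ let $\mathfrak C_{h,k}\hat\phi_j^{(i)}\in V_h$ be represented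 by $\mathbf K\hat{\mathbf x}$, where $\hat{\mathbf x}$ results from $k$ iterations of the conjugate gradient algorithm with initial guess $\mathbf 0$ for $\mathbf K^T\mathbf A\mathbf K\,\mathbf x=\mathbf K^T\mathbf A\,\mathbf f_j^{(i)}$ and $\mathbf f_j^{(i)}$ represents $\hat\phi_j^{(i)}$. Let $V_{aux,k}^{ms,h}$ be the span of all $\hat\phi_j^{(i)}-\mathfrak C_{h,k}\hat\phi_j^{(i)}$. For $f\in L^2(\Omega)$ let $u_h\in V_h$ and $u_{aux,k}^{ms,h}\in V_{aux,k}^{ms,h}$ satisfy $a(u_h,v)=\int_\Omega fv\,dx$ for all $v\in V_h$ and $a(u_{aux,k}^{ms,h},v)=\int_\Omega fv\,dx$ for all $v\in V_{aux,k}^{ms,h}$. Then, with $C_*=2^{3/2}/\pi$, for every $f\in L^2(\Omega)$ and every $k\ge0$, $$\|u_h-u_{aux,k}^{ms,h}\|_a\le\Big[C_*H+\frac{2q^k}{1+q^{2k}}\sqrt L\sqrt M\,H^{-1}\sqrt\beta\Big]\|f\|_{L^2(\Omega)},$$ and $$\|u_h-u_{aux,k}^{ms,h}\|_a\le(C_*+1)H\,\|f\|_{L^2(\Omega)}\qquad\text{whenever}\qquad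 2q^k\sqrt L\sqrt M\sqrt\beta\le H^2 .$$ The last condition on $k$ holds for all sufficiently large $k$. -/

import Mathlib

open MeasureTheory

open scoped Matrix

noncomputable section

namespace MSFEM

/-! ### Meshes of the unit square

The coarse mesh has `N × N` squares of side `H = 1 / N`; each of them is divided uniformly into
`r × r` squares, which gives a fine mesh with `N r × N r` squares of side `h = 1 / (N r)`. -/

/-- The unit square. -/
def Omega : Set (ℝ × ℝ) := Set.Ioo 0 1 ×ˢ Set.Ioo 0 1

/-- The cell with index `c` (counted from zero in each direction) of the uniform mesh of the unit
square with `n × n` closed squares. -/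
def cell (n : ℕ) (c : Fin n × Fin n) : Set (ℝ × ℝ) :=
  Set.Icc ((c.1 : ℝ) / n) (((c.1 : ℝ) + 1) / n) ×ˢ Set.Icc ((c.2 : ℝ) / n) (((c.2 : ℝ) + 1) / n)

/-- The indices of the elements of the coarse mesh. -/
abbrev Elem (N : ℕ) : Type := Fin N × Fin N

/-- The indices of the interior vertices of the fine mesh. -/
abbrev Node (N r : ℕ) : Type := Fin (N * r - 1) × Fin (N * r - 1)

/-- The mesh size of the coarse mesh. -/
def coarseSize (N : ℕ) : ℝ := 1 / N

/-- The location of an interior vertex of the fine mesh. -/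
def nodePoint {N r : ℕ} (p : Node N r) : ℝ × ℝ :=
  (((p.1 : ℝ) + 1) / ((N * r : ℕ) : ℝ), ((p.2 : ℝ) + 1) / ((N * r : ℕ) : ℝ))

open Classical in
/-- The coarse elements that contain a given interior vertex of the fine mesh. There is one of them
if the vertex is interior to an element, there are two if it is interior to an edge of the coarse
mesh (the two elements that share the edge), and four if it is a vertex of the coarse mesh. -/
def hosts {N r : ℕ} (p : Node N r) : Finset (Elem N) :=
  Finset.univ.filter fun i => nodePoint p ∈ cell N i

/-! ### Finite element spaces and bilinear forms -/

/-- The `Q₁` finite element subspace of `H¹₀` of the unit square associated with the uniform mesh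
with `n × n` squares: continuous functions that are bilinear on every cell and vanish on the
boundary. The functions are extended by zero to the plane. -/
def Q1Space (n : ℕ) : Submodule ℝ (ℝ × ℝ → ℝ) where
  carrier := {v | Continuous v ∧ (∀ x, x ∉ Omega → v x = 0) ∧
    ∀ c : Fin n × Fin n, ∃ a b₁ b₂ d : ℝ, ∀ x ∈ cell n c,
      v x = a + b₁ * x.1 + b₂ * x.2 + d * (x.1 * x.2)}
  add_mem' := by
    rintro v w ⟨hv, hv0, hvc⟩ ⟨hw, hw0, hwc⟩
    refine ⟨hv.add hw, fun x hx => by simp [hv0 x hx, hw0 x hx], fun c => ?_⟩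
    obtain ⟨a, b₁, b₂, d, h⟩ := hvc c
    obtain ⟨a', b₁', b₂', d', h'⟩ := hwc c
    refine ⟨a + a', b₁ + b₁', b₂ + b₂', d + d', fun x hx => ?_⟩
    rw [Pi.add_apply, h x hx, h' x hx]
    ring
  zero_mem' := ⟨continuous_const, fun _ _ => rfl, fun _ => ⟨0, 0, 0, 0, fun _ _ => by simp⟩⟩
  smul_mem' := by
    rintro t v ⟨hv, hv0, hvc⟩
    refine ⟨hv.const_smul t, fun x hx => by simp [hv0 x hx], fun c => ?_⟩
    obtain ⟨a, b₁, b₂, d, h⟩ := hvc c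
    refine ⟨t * a, t * b₁, t * b₂, t * d, fun x hx => ?_⟩
    rw [Pi.smul_apply, h x hx, smul_eq_mul]
    ring

/-- The fine finite element space `V_h`. -/
def Vh (N r : ℕ) : Submodule ℝ (ℝ × ℝ → ℝ) := Q1Space (N * r)

/-- Restriction of functions to a set, where the restricted function is represented by its
extension by zero. -/
def restrictTo (S : Set (ℝ × ℝ)) : (ℝ × ℝ → ℝ) →ₗ[ℝ] (ℝ × ℝ → ℝ) where
  toFun v := S.indicator v
  map_add' v w := Set.indicator_add S v w
  map_smul' t v := Set.indicator_const_smul S t v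

/-- The space `V_h(K_i)` of the restrictions of the functions in `V_h` to a coarse element. -/
def VhLocal (N r : ℕ) (i : Elem N) : Submodule ℝ (ℝ × ℝ → ℝ) :=
  (Vh N r).map (restrictTo (cell N i))

/-- The dimension `n_i` of `V_h(K_i)`. -/
def localDim (N r : ℕ) (i : Elem N) : ℕ := Module.finrank ℝ (VhLocal N r i)

/-- The pointwise product `∇v · ∇w`. For functions that are bilinear on the cells of a mesh the
classical partial derivatives exist almost everywhere and they are the weak derivatives. -/
def gradDot (v w : ℝ × ℝ → ℝ) (x : ℝ × ℝ) : ℝ :=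
  deriv (fun t => v (t, x.2)) x.1 * deriv (fun t => w (t, x.2)) x.1 +
    deriv (fun t => v (x.1, t)) x.2 * deriv (fun t => w (x.1, t)) x.2

/-- The form `∫_S κ ∇v · ∇w`. -/
def energyOn (κ : ℝ × ℝ → ℝ) (S : Set (ℝ × ℝ)) (v w : ℝ × ℝ → ℝ) : ℝ :=
  ∫ x in S, κ x * gradDot v w x

/-- The bilinear form `a(v, w)` on the unit square. -/
def energy (κ : ℝ × ℝ → ℝ) (v w : ℝ × ℝ → ℝ) : ℝ := energyOn κ Omega v w

/-- The energy norm. -/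
def energyNorm (κ : ℝ × ℝ → ℝ) (v : ℝ × ℝ → ℝ) : ℝ := √(energy κ v v)

/-- The local energy form `a_i(v, w) = ∫_{K_i} κ ∇v · ∇w`. -/
def localEnergy {N : ℕ} (κ : ℝ × ℝ → ℝ) (i : Elem N) (v w : ℝ × ℝ → ℝ) : ℝ :=
  energyOn κ (cell N i) v w

/-- The local weighted form `s_i(v, w) = H⁻² ∫_{K_i} κ v w`. -/
def localMass {N : ℕ} (κ : ℝ × ℝ → ℝ) (i : Elem N) (v w : ℝ × ℝ → ℝ) : ℝ :=
  (coarseSize N ^ 2)⁻¹ * ∫ x in cell N i, κ x * (v x * w x)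

/-- The `L²` norm on the unit square. -/
def l2Norm (f : ℝ × ℝ → ℝ) : ℝ := (eLpNorm f 2 (volume.restrict Omega)).toReal

/-- `u` is the Galerkin solution in the space `V` of the Dirichlet problem with diffusion
coefficient `κ` and right-hand side `f`. -/
def IsGalerkinSolution (κ f : ℝ × ℝ → ℝ) (V : Submodule ℝ (ℝ × ℝ → ℝ)) (u : ℝ × ℝ → ℝ) : Prop :=
  u ∈ V ∧ ∀ v ∈ V, energy κ u v = ∫ x in Omega, f x * v x

/-- The first nonzero eigenvalue `μ_i` of the local eigenvalue problem for the Laplace operator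
(that is, for the coefficient `1`). -/
def laplaceEigenvalue (N r : ℕ) (i : Elem N) : ℝ :=
  sInf {μ : ℝ | 0 < μ ∧ ∃ ψ ∈ VhLocal N r i, ψ ≠ 0 ∧
    ∀ w ∈ VhLocal N r i,
      localEnergy (fun _ => 1) i ψ w = μ * localMass (fun _ => 1) i ψ w}

/-! ### Nodal basis -/

/-- The nodal basis function (hat function) of `V_h` with value one at the vertex `p`. -/
def hat {N r : ℕ} (p : Node N r) : ℝ × ℝ → ℝ := fun x =>
  max 0 (1 - |((N * r : ℕ) : ℝ) * x.1 - ((p.1 : ℝ) + 1)|) *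
    max 0 (1 - |((N * r : ℕ) : ℝ) * x.2 - ((p.2 : ℝ) + 1)|)

/-- The hat function normalized with respect to the energy norm. -/
def normalizedHat {N r : ℕ} (κ : ℝ × ℝ → ℝ) (p : Node N r) : ℝ × ℝ → ℝ :=
  (energyNorm κ (hat p))⁻¹ • hat p

/-- The vector that represents a function in `V_h` with respect to the nodal basis. -/
def nodalVector {N r : ℕ} (v : ℝ × ℝ → ℝ) : Node N r → ℝ := fun p => v (nodePoint p)

/-- The function in `V_h` represented by a vector with respect to the nodal basis. -/
def femFunction {N r : ℕ} (x : Node N r → ℝ) : ℝ × ℝ → ℝ := ∑ p, x p • hat p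

/-- The stiffness matrix with respect to the nodal basis. -/
def stiffness (N r : ℕ) (κ : ℝ × ℝ → ℝ) : Matrix (Node N r) (Node N r) ℝ :=
  Matrix.of fun p q => energy κ (hat p) (hat q)

/-! ### Linear algebra -/

section LinearAlgebra

variable {ι : Type*} [Fintype ι]

/-- The modified Gram-Schmidt algorithm for the inner product given by the matrix `A`: the first
vector is normalized, its component is removed from all later vectors, and so on. -/
def modifiedGramSchmidt (A : Matrix ι ι ℝ) : List (ι → ℝ) → List (ι → ℝ)
  | [] => []
  | v :: vs =>
    ((√(v ⬝ᵥ A *ᵥ v))⁻¹ • v) ::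
      modifiedGramSchmidt A (vs.map fun u =>
        u - (((√(v ⬝ᵥ A *ᵥ v))⁻¹ • v) ⬝ᵥ A *ᵥ u) • ((√(v ⬝ᵥ A *ᵥ v))⁻¹ • v))
termination_by l => l.length
decreasing_by simp

/-- The matrix whose columns are the vectors of a list. -/
def columnMatrix (W : List (ι → ℝ)) : Matrix ι (Fin W.length) ℝ :=
  Matrix.of fun x j => W.get j x

/-- Subtract from `v` its `A`-orthogonal projection onto the span of the (linearly independent)
vectors of the list `W`. -/
def orthogonalize (A : Matrix ι ι ℝ) (W : List (ι → ℝ)) (v : ι → ℝ) : ι → ℝ :=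
  v - columnMatrix W *ᵥ
    (((columnMatrix W)ᵀ * A * columnMatrix W)⁻¹ *ᵥ ((columnMatrix W)ᵀ *ᵥ (A *ᵥ v)))

/-- One step of the conjugate gradient algorithm for `G x = b`; a state consists of the current
iterate, the residual and the search direction. If the residual vanishes, then the iterate does not
change any more (as `0 / 0 = 0`). -/
def cgStep (G : Matrix ι ι ℝ) (s : (ι → ℝ) × (ι → ℝ) × (ι → ℝ)) :
    (ι → ℝ) × (ι → ℝ) × (ι → ℝ) :=
  let x := s.1
  let res := s.2.1
  let d := s.2.2
  let α : ℝ := (res ⬝ᵥ res) / (d ⬝ᵥ G *ᵥ d)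
  let res' := res - α • (G *ᵥ d)
  let γ : ℝ := (res' ⬝ᵥ res') / (res ⬝ᵥ res)
  (x + α • d, res', res' + γ • d)

/-- The result of `k` iterations of the conjugate gradient algorithm for `G x = b` with initial
guess zero. -/
def cgIterate (G : Matrix ι ι ℝ) (b : ι → ℝ) (k : ℕ) : ι → ℝ :=
  ((cgStep G)^[k] (0, b, b)).1

/-- The quotient of the largest and the smallest eigenvalue of a symmetric matrix. -/
def conditionNumber [DecidableEq ι] (G : Matrix ι ι ℝ) : ℝ :=
  sSup (spectrum ℝ G) / sInf (spectrum ℝ G)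

end LinearAlgebra

/-! ### The localized multiscale finite element method -/

/-- The choices made in the construction of the method: local eigenvalues and eigenfunctions, the
numbers `L_i`, the dual nodes, and an enumeration of the interior vertices of the fine mesh (the
order in which the vertices enter the Gram-Schmidt algorithm). -/
structure MSData (N r : ℕ) where
  /-- The eigenvalue `λ_j^{(i)}`, where `j` is counted from zero. -/
  eigenvalue : (i : Elem N) → Fin (localDim N r i) → ℝ
  /-- The eigenfunction `ψ_j^{(i)}`, where `j` is counted from zero. -/
  eigenfun : (i : Elem N) → Fin (localDim N r i) → ℝ × ℝ → ℝ
  /-- The dimension `L_i` of the local auxiliary space. -/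
  numAux : Elem N → ℕ
  numAux_le : ∀ i, numAux i ≤ localDim N r i
  /-- The dual nodes. -/
  dualNode : (i : Elem N) → Fin (numAux i) → Node N r
  /-- The vertices in the order in which they are processed. -/
  nodeOrder : List (Node N r)

namespace MSData

variable {N r : ℕ} (D : MSData N r) (κ : ℝ × ℝ → ℝ)

/-- The eigenfunctions that span the local auxiliary space. -/
def auxFun (i : Elem N) (j : Fin (D.numAux i)) : ℝ × ℝ → ℝ :=
  D.eigenfun i (Fin.castLE (D.numAux_le i) j)

/-- The normalized hat functions of the dual nodes. -/
def dualHat (i : Elem N) (j : Fin (D.numAux i)) : ℝ × ℝ → ℝ :=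
  normalizedHat κ (D.dualNode i j)

/-- The matrix `S_i`. -/
def dualMatrix (i : Elem N) : Matrix (Fin (D.numAux i)) (Fin (D.numAux i)) ℝ :=
  Matrix.of fun j k => localMass κ i (D.dualHat κ i j) (D.auxFun i k)

/-- The data satisfy the requirements of the construction for the coefficient `κ`. -/
structure IsAdmissible : Prop where
  eigenvalue_monotone : ∀ i, Monotone (D.eigenvalue i)
  eigenfun_mem : ∀ i j, D.eigenfun i j ∈ VhLocal N r i
  eigen_equation : ∀ i j, ∀ w ∈ VhLocal N r i,
    localEnergy κ i (D.eigenfun i j) w = D.eigenvalue i j * localMass κ i (D.eigenfun i j) w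
  orthonormal : ∀ i j k,
    localMass κ i (D.eigenfun i j) (D.eigenfun i k) = if j = k then 1 else 0
  /-- The eigenvalues that are left out are larger than `μ_i / 2`. -/
  eigenvalue_gt : ∀ i (j : Fin (localDim N r i)), D.numAux i ≤ (j : ℕ) →
    laplaceEigenvalue N r i / 2 < D.eigenvalue i j
  dualNode_interior : ∀ i j, nodePoint (D.dualNode i j) ∈ interior (cell N i)
  dualMatrix_nonsingular : ∀ i, IsUnit (D.dualMatrix κ i).det
  /-- An element of the fine mesh has at most one of the dual nodes as a vertex. -/
  separated : ∀ (c : Fin (N * r) × Fin (N * r)) (z z' : Σ i : Elem N, Fin (D.numAux i)),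
    nodePoint (D.dualNode z.1 z.2) ∈ cell (N * r) c →
    nodePoint (D.dualNode z'.1 z'.2) ∈ cell (N * r) c → z = z'
  nodeOrder_nodup : D.nodeOrder.Nodup
  nodeOrder_complete : ∀ p, p ∈ D.nodeOrder

/-- The vertex `p` is one of the dual nodes. -/
def IsDual (p : Node N r) : Prop := ∃ i j, D.dualNode i j = p

/-- The dimension `L` of the auxiliary space. -/
def totalAux : ℕ := ∑ i, D.numAux i

/-- The dual functions `φ̃_j^{(i)} = ∑_l (S_i⁻¹)_{jl} φ̂_l^{(i)}`. -/
def dualFun (i : Elem N) (j : Fin (D.numAux i)) : ℝ × ℝ → ℝ :=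
  ∑ l, (D.dualMatrix κ i)⁻¹ j l • D.dualHat κ i l

/-- The number `M_i`, the 2-norm of the matrix with the components `a(φ̃_j^{(i)}, φ̃_l^{(i)})`. -/
def localM (i : Elem N) : ℝ :=
  ‖Matrix.toEuclideanCLM (n := Fin (D.numAux i)) (𝕜 := ℝ)
    (Matrix.of fun j l => energy κ (D.dualFun κ i j) (D.dualFun κ i l))‖

/-- The number `M = max_i M_i`. -/
def constM : ℝ := ⨆ i, D.localM κ i

/-- The vector that represents `φ_p - φ̃_p`, where
`φ̃_p = ∑_i ∑_j s_i(φ_p, ψ_j^{(i)}) φ̃_j^{(i)}`. -/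
def kernelVector (p : Node N r) : Node N r → ℝ :=
  nodalVector (normalizedHat κ p -
    ∑ i, ∑ j, localMass κ i (normalizedHat κ p) (D.auxFun i j) • D.dualFun κ i j)

open Classical in
/-- The vertices that are not dual nodes and for which `S` is the set of the coarse elements that
contain them. -/
def nodesOn (S : Finset (Elem N)) : List (Node N r) :=
  D.nodeOrder.filter fun p => ¬ D.IsDual p ∧ hosts p = S

/-- The basis vectors associated with the interior of a coarse element. -/
def elementVectors (i : Elem N) : List (Node N r → ℝ) :=
  modifiedGramSchmidt (stiffness N r κ) ((D.nodesOn {i}).map (D.kernelVector κ))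

/-- The basis vectors associated with the interior of the edge shared by the two elements
in `E`. -/
def edgeVectors (E : Finset (Elem N)) : List (Node N r → ℝ) :=
  modifiedGramSchmidt (stiffness N r κ) ((D.nodesOn E).map fun p =>
    orthogonalize (stiffness N r κ) (E.toList.flatMap (D.elementVectors κ)) (D.kernelVector κ p))

/-- The kernel vector of a coarse vertex `p`, made orthogonal to the basis vectors of the four
elements and the four edges that meet at `p`. (The edges are given by pairs of elements; no vertex
is interior to an edge for the two diagonal pairs, which contribute nothing.) -/
def rawVertexVector (p : Node N r) : Node N r → ℝ :=
  orthogonalize (stiffness N r κ)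
    ((hosts p).toList.flatMap (D.elementVectors κ) ++
      ((hosts p).powersetCard 2).toList.flatMap (D.edgeVectors κ))
    (D.kernelVector κ p)

/-- The basis vector associated with the interior vertex `p` of the coarse mesh. -/
def vertexVector (p : Node N r) : Node N r → ℝ :=
  (√(D.rawVertexVector κ p ⬝ᵥ stiffness N r κ *ᵥ D.rawVertexVector κ p))⁻¹ •
    D.rawVertexVector κ p

/-- The special basis: the vectors associated with elements, edges and vertices. -/
def specialBasis : List (Node N r → ℝ) :=
  (Finset.univ : Finset (Elem N)).toList.flatMap (D.elementVectors κ) ++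
    ((Finset.univ : Finset (Elem N)).powersetCard 2).toList.flatMap (D.edgeVectors κ) ++
    (D.nodeOrder.filter fun p => (hosts p).card = 4).map (D.vertexVector κ)

/-- The matrix `K` whose columns are the special basis vectors. -/
def basisMatrix : Matrix (Node N r) (Fin (D.specialBasis κ).length) ℝ :=
  columnMatrix (D.specialBasis κ)

/-- The matrix `Kᵀ A K`. -/
def correctorMatrix :
    Matrix (Fin (D.specialBasis κ).length) (Fin (D.specialBasis κ).length) ℝ :=
  (D.basisMatrix κ)ᵀ * stiffness N r κ * D.basisMatrix κ

/-- The number `q = (√𝔎 - 1) / (√𝔎 + 1)`, where `𝔎` is the condition number of `Kᵀ A K`. -/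
def rate : ℝ :=
  (√(conditionNumber (D.correctorMatrix κ)) - 1) / (√(conditionNumber (D.correctorMatrix κ)) + 1)

/-- The function obtained from the normalized hat function of a dual node by `k` conjugate gradient
iterations for the corrector equation. -/
def corrector (k : ℕ) (i : Elem N) (j : Fin (D.numAux i)) : ℝ × ℝ → ℝ :=
  femFunction (D.basisMatrix κ *ᵥ cgIterate (D.correctorMatrix κ)
    ((D.basisMatrix κ)ᵀ *ᵥ (stiffness N r κ *ᵥ nodalVector (D.dualHat κ i j))) k)

/-- The localized multiscale finite element space. -/
def multiscaleSpace (k : ℕ) : Submodule ℝ (ℝ × ℝ → ℝ) :=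
  Submodule.span ℝ (Set.range fun z : Σ i : Elem N, Fin (D.numAux i) =>
    D.dualHat κ z.1 z.2 - D.corrector κ k z.1 z.2)

end MSData

/-- The constant `C_* = 2^{3/2} / π`. -/
def Cstar : ℝ := 2 * √2 / Real.pi

end MSFEM

end

noncomputable section

namespace MSFEM

/-! ### Conjugate gradients -/

section QuadraticForms

variable {ι : Type*} [Fintype ι]

/-! Let W (`kernelSpace`) consist of the v in V_h with s_i(v, ψ_j^(i)) = 0 for all i and all j ≤
L_i. The dual functions satisfy s_i(φ̃_j, ψ_k) = δ_jk and vanish outside their own element, so u_h -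
∑ c_j φ̃_j lies in W when c_j = s_i(u_h, ψ_j). Rewrite the sum in terms of the dual hats as ∑ d_z
φ̂_z and let P be the a-orthogonal projection onto W. Then w₀ = u_h - ∑ d_z (φ̂_z - P φ̂_z) lies in
W and u_h - w₀ is orthogonal to W. The Galerkin solution is the best approximation in the energy
norm, so its error is at most that of ∑ d_z (φ̂_z - C φ̂_z), with C the conjugate gradient
corrector. This error is bounded by ‖w₀‖_a + ∑ |d_z| ‖P φ̂_z - C φ̂_z‖_a
(`exists_projection_formNorm_le`).

The first term: ‖w₀‖_a² = ∫ f w₀, and on K_i only eigenfunctions with λ > μ_i / 2 occur in w₀.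
Poincaré inequalities give μ_i ≥ π² / 4 (`pi_sq_div_four_le_laplaceEigenvalue`), hence ‖w₀‖ ≤ C_* H
‖w₀‖_a in L² with C_*² = 8 / π² (`massForm_le_of_auxCoeff_eq_zero`).

The second term: no fine element has two dual nodes as vertices, so the dual hats are a-orthonormal.
Therefore ∑ d_z² is a sum of local energies of ∑ c_j φ̃_j, at most M ∑ c_j² (`sum_sq_dual_le`). The
Bessel inequality and the stability of u_h give ∑ c_j² ≤ H⁻² β ‖f‖² (`sum_auxCoeff_sq_le`,
`sqrt_femMass_le`), and Cauchy-Schwarz contributes √L. The corrector error is the Chebyshev bound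
for conjugate gradients (`cgIterate_error_le`) with initial error ‖P φ̂_z‖_a ≤ 1.

This needs the columns of K to be a basis of W. Every orthogonalization step changes a vector only
by elements of a span that is already present, so the columns span W (`span_specialBasis`). There
are at most as many columns as non-dual vertices, and that number is at most dim W, so the columns
are independent (`posDef_correctorMatrix`). No orthogonality of the special basis is used. -/

lemma posDef_pos {G : Matrix ι ι ℝ} (hG : G.PosDef) {x : ι → ℝ} (hx : x ≠ 0) :
    0 < x ⬝ᵥ G *ᵥ x := by
  simpa using hG.dotProduct_mulVec_pos hx

lemma posDef_nonneg {G : Matrix ι ι ℝ} (hG : G.PosDef) (x : ι → ℝ) :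
    0 ≤ x ⬝ᵥ G *ᵥ x := by
  simpa using hG.posSemidef.dotProduct_mulVec_nonneg x

lemma dotProduct_mulVec_symm {G : Matrix ι ι ℝ} (hG : G.IsHermitian) (x y : ι → ℝ) :
    x ⬝ᵥ G *ᵥ y = y ⬝ᵥ G *ᵥ x := by
  have hT : Gᵀ = G := by simpa [Matrix.IsHermitian] using hG
  rw [Matrix.dotProduct_mulVec, ← Matrix.mulVec_transpose, hT, dotProduct_comm]

end QuadraticForms

section ConjugateGradients

variable {ι : Type*} [Fintype ι] [DecidableEq ι]

/-- The Krylov space spanned by `G ^ i b` for `i < k`. -/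
def krylov (G : Matrix ι ι ℝ) (b : ι → ℝ) (k : ℕ) : Submodule ℝ (ι → ℝ) :=
  Submodule.span ℝ ((fun i : ℕ => (G ^ i) *ᵥ b) '' Set.Iio k)

lemma krylov_mono (G : Matrix ι ι ℝ) (b : ι → ℝ) : Monotone (krylov G b) := fun _ _ h =>
  Submodule.span_mono (Set.image_mono (Set.Iio_subset_Iio h))

lemma pow_mulVec_mem_krylov (G : Matrix ι ι ℝ) (b : ι → ℝ) {i k : ℕ} (h : i < k) :
    (G ^ i) *ᵥ b ∈ krylov G b k :=
  Submodule.subset_span ⟨i, h, rfl⟩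

lemma krylov_succ (G : Matrix ι ι ℝ) (b : ι → ℝ) (k : ℕ) :
    krylov G b (k + 1) = Submodule.span ℝ (insert ((G ^ k) *ᵥ b)
      ((fun i : ℕ => (G ^ i) *ᵥ b) '' Set.Iio k)) := by
  rw [krylov, ← Set.image_insert_eq (f := fun i : ℕ => (G ^ i) *ᵥ b)]
  congr 2
  ext i
  simp only [Set.mem_Iio, Set.mem_insert_iff]
  omega

lemma mulVec_mem_krylov (G : Matrix ι ι ℝ) (b : ι → ℝ) {k : ℕ} {u : ι → ℝ}
    (hu : u ∈ krylov G b k) : G *ᵥ u ∈ krylov G b (k + 1) := by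
  have h : krylov G b k ≤ (krylov G b (k + 1)).comap (Matrix.mulVecLin G) := by
    refine Submodule.span_le.2 ?_
    rintro _ ⟨i, hi, rfl⟩
    have := pow_mulVec_mem_krylov G b (Nat.succ_lt_succ hi)
    simpa [pow_succ', Matrix.mulVec_mulVec] using this
  exact h hu

/-- Steinitz exchange: one step adds at most one dimension, so any vector that is new in the larger
space can replace `G ^ k b`. The current search direction plays this role below. -/
lemma krylov_succ_le (G : Matrix ι ι ℝ) (b : ι → ℝ) {k : ℕ} {r : ι → ℝ}
    (hr : r ∈ krylov G b (k + 1)) (hr' : r ∉ krylov G b k) :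
    krylov G b (k + 1) ≤ krylov G b k ⊔ Submodule.span ℝ {r} := by
  rw [krylov_succ] at hr
  have h := mem_span_insert_exchange hr hr'
  rw [Submodule.span_insert, sup_comm] at h
  rw [krylov_succ, Submodule.span_insert]
  exact sup_le (by simpa [krylov] using h) le_sup_left

/-- The invariants of the conjugate gradient algorithm. -/
structure CGInvariant (G : Matrix ι ι ℝ) (b : ι → ℝ) (k : ℕ)
    (s : (ι → ℝ) × (ι → ℝ) × (ι → ℝ)) : Prop where
  iterate_mem : s.1 ∈ krylov G b k
  residual_eq : s.2.1 = b - G *ᵥ s.1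
  residual_mem : s.2.1 ∈ krylov G b (k + 1)
  residual_orth : ∀ u ∈ krylov G b k, s.2.1 ⬝ᵥ u = 0
  direction_mem : s.2.2 ∈ krylov G b (k + 1)
  direction_sub_mem : s.2.2 - s.2.1 ∈ krylov G b k
  direction_conj : ∀ u ∈ krylov G b k, s.2.2 ⬝ᵥ G *ᵥ u = 0

lemma cgInvariant_step {G : Matrix ι ι ℝ} (hG : G.PosDef) {b : ι → ℝ} {k : ℕ}
    {s : (ι → ℝ) × (ι → ℝ) × (ι → ℝ)} (h : CGInvariant G b k s) :
    CGInvariant G b (k + 1) (cgStep G s) := by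
  obtain ⟨x, r, d⟩ := s
  obtain ⟨hx, hr, hrm, hro, hdm, hds, hdc⟩ := h
  simp only at hx hr hrm hro hdm hds hdc
  have hsymm := dotProduct_mulVec_symm hG.isHermitian
  have hm := krylov_mono G b (Nat.le_succ k)
  -- `d - r` lies in the Krylov space to which `r` is orthogonal.
  have hrd : r ⬝ᵥ d = r ⬝ᵥ r := by
    have := hro _ hds
    rw [dotProduct_sub] at this
    linarith
  -- When the residual vanishes, `d` lies in the very space to which it is conjugate, so `d = 0`,
  -- and with `0 / 0 = 0` the step changes nothing.
  by_cases hr0 : r = 0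
  · have hd0 : d = 0 := by
      by_contra hd
      have h1 := posDef_pos hG hd
      have : d ∈ krylov G b k := by simpa [hr0] using hds
      rw [hdc d this] at h1
      exact lt_irrefl _ h1
    have hstep : cgStep G (x, r, d) = (x, 0, 0) := by simp [cgStep, hr0, hd0]
    rw [hstep]
    exact ⟨hm hx, hr0 ▸ hr, Submodule.zero_mem _, by simp, Submodule.zero_mem _,
      by simp, by simp⟩
  have hrr : 0 < r ⬝ᵥ r := by
    simpa using (Matrix.dotProduct_star_self_pos_iff (v := r)).2 hr0
  have hd0 : d ≠ 0 := by
    rintro rfl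
    simp at hrd
    exact hr0 (by simpa using hrd.symm)
  have hdd := posDef_pos hG hd0
  have hrk : r ∉ krylov G b k := fun hmem => hrr.ne' (hro r hmem)
  have hdk : d ∉ krylov G b k := fun hmem => hrk (by
    simpa using Submodule.sub_mem _ hmem hds)
  have hsup := krylov_succ_le G b hdm hdk
  set α : ℝ := (r ⬝ᵥ r) / (d ⬝ᵥ G *ᵥ d) with hα
  set r' : ι → ℝ := r - α • (G *ᵥ d) with hr'
  set γ : ℝ := (r' ⬝ᵥ r') / (r ⬝ᵥ r) with hγ
  have hstep : cgStep G (x, r, d) = (x + α • d, r', r' + γ • d) := rfl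
  have hαd : α * (d ⬝ᵥ G *ᵥ d) = r ⬝ᵥ r := by rw [hα]; field_simp
  have hαpos : 0 < α := div_pos hrr hdd
  -- The new Krylov space is the old one plus the line of `d`. Conjugacy of `d` takes care of the
  -- old space, the choice of `α` takes care of `d`.
  have horth : ∀ u ∈ krylov G b (k + 1), r' ⬝ᵥ u = 0 := by
    intro u hu
    obtain ⟨v, hv, w, hw, rfl⟩ := Submodule.mem_sup.1 (hsup hu)
    obtain ⟨t, rfl⟩ := Submodule.mem_span_singleton.1 hw
    have h1 : r' ⬝ᵥ v = 0 := by
      rw [hr', sub_dotProduct, smul_dotProduct, hro v hv, dotProduct_comm, hsymm, hdc v hv]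
      simp
    have h2 : r' ⬝ᵥ d = 0 := by
      rw [hr', sub_dotProduct, smul_dotProduct, hrd, dotProduct_comm (G *ᵥ d), smul_eq_mul, hαd,
        sub_self]
    rw [dotProduct_add, dotProduct_smul, h1, h2]
    simp
  have hGd := mulVec_mem_krylov G b hdm
  have hm' := krylov_mono G b (Nat.le_succ (k + 1))
  have hr'm : r' ∈ krylov G b (k + 2) :=
    Submodule.sub_mem _ (hm' hrm) (Submodule.smul_mem _ _ hGd)
  rw [hstep]
  refine ⟨Submodule.add_mem _ (hm hx) (Submodule.smul_mem _ _ hdm), ?_, hr'm, horth,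
    Submodule.add_mem _ hr'm (hm' (Submodule.smul_mem _ _ hdm)), ?_, ?_⟩
  · simp only [hr', hr, Matrix.mulVec_add, Matrix.mulVec_smul]
    abel
  · simpa using Submodule.smul_mem _ _ hdm
  · intro u hu
    obtain ⟨v, hv, w, hw, rfl⟩ := Submodule.mem_sup.1 (hsup hu)
    obtain ⟨t, rfl⟩ := Submodule.mem_span_singleton.1 hw
    have h1 : (r' + γ • d) ⬝ᵥ G *ᵥ v = 0 := by
      rw [add_dotProduct, smul_dotProduct, hdc v hv, horth _ (mulVec_mem_krylov G b hv)]
      simp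
    have h2 : (r' + γ • d) ⬝ᵥ G *ᵥ d = 0 := by
      -- `α • G d` is the difference of consecutive residuals, and `r'` is orthogonal to the older
      -- one. So `γ` is exactly the coefficient that makes the new direction conjugate to `d`; as `α
      -- > 0`, it is enough to check this after multiplication by `α`.
      have h3 : α * (r' ⬝ᵥ G *ᵥ d) = - (r' ⬝ᵥ r') := by
        have : α • (G *ᵥ d) = r - r' := by rw [hr']; abel
        rw [← smul_eq_mul, ← dotProduct_smul, this, dotProduct_sub, horth r hrm]
        simp
      have h4 : α * (γ * (d ⬝ᵥ G *ᵥ d)) = r' ⬝ᵥ r' := by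
        rw [mul_left_comm, hαd, hγ]
        field_simp
      rw [add_dotProduct, smul_dotProduct, smul_eq_mul]
      have : α * (r' ⬝ᵥ G *ᵥ d + γ * (d ⬝ᵥ G *ᵥ d)) = 0 := by rw [mul_add, h3, h4]; ring
      exact (mul_eq_zero.1 this).resolve_left hαpos.ne'
    rw [Matrix.mulVec_add, Matrix.mulVec_smul, dotProduct_add, dotProduct_smul, h1, h2]
    simp

lemma cgInvariant_iterate {G : Matrix ι ι ℝ} (hG : G.PosDef) (b : ι → ℝ) (k : ℕ) :
    CGInvariant G b k ((cgStep G)^[k] (0, b, b)) := by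
  induction k with
  | zero =>
    have hb : b ∈ krylov G b 1 := by simpa using pow_mulVec_mem_krylov G b zero_lt_one
    refine ⟨Submodule.zero_mem _, by simp, hb, ?_, hb, by simp, ?_⟩ <;>
    · intro u hu
      have : u = 0 := by simpa [krylov, Set.Iio, Submodule.mem_bot] using hu
      simp [this]
  | succ k ih =>
    rw [Function.iterate_succ_apply']
    exact cgInvariant_step hG ih

/-- Optimality of the conjugate gradient iterates in the Krylov space. -/
lemma cgIterate_optimal {G : Matrix ι ι ℝ} (hG : G.PosDef) {b x : ι → ℝ} (hx : G *ᵥ x = b)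
    (k : ℕ) {y : ι → ℝ} (hy : y ∈ krylov G b k) :
    (x - cgIterate G b k) ⬝ᵥ G *ᵥ (x - cgIterate G b k) ≤ (x - y) ⬝ᵥ G *ᵥ (x - y) := by
  have h := cgInvariant_iterate hG b k
  set s := (cgStep G)^[k] (0, b, b) with hs
  have hc : cgIterate G b k = s.1 := rfl
  rw [hc]
  have hres : G *ᵥ (x - s.1) = s.2.1 := by rw [Matrix.mulVec_sub, hx, h.residual_eq]
  -- The residual is `G` times the error, so the error is `G`-orthogonal to the Krylov space and the
  -- comparison is Pythagoras.
  have hz := h.residual_orth _ (Submodule.sub_mem _ h.iterate_mem hy)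
  have hxy : x - y = (x - s.1) + (s.1 - y) := by abel
  rw [hxy, Matrix.mulVec_add, hres, dotProduct_add, add_dotProduct, add_dotProduct,
    dotProduct_mulVec_symm hG.isHermitian (x - s.1), hres, dotProduct_comm (s.1 - y) s.2.1, hz]
  have := posDef_nonneg hG (s.1 - y)
  linarith

lemma aeval_mulVec_mem_krylov (G : Matrix ι ι ℝ) (b : ι → ℝ) {k : ℕ} (p : Polynomial ℝ)
    (hp : p.degree < k) : (Polynomial.aeval G p) *ᵥ b ∈ krylov G b k := by
  rw [Polynomial.aeval_def, Polynomial.eval₂_eq_sum, Polynomial.sum_def, Matrix.sum_mulVec]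
  refine Submodule.sum_mem _ fun i hi => ?_
  rw [← Algebra.smul_def, Matrix.smul_mulVec]
  refine Submodule.smul_mem _ _ (pow_mulVec_mem_krylov G b ?_)
  have h1 := Polynomial.le_degree_of_ne_zero (Polynomial.mem_support_iff.1 hi)
  exact_mod_cast h1.trans_lt hp

/-- The error of the conjugate gradient method is bounded by polynomials with value one at zero. -/
lemma cgIterate_le_polynomial {G : Matrix ι ι ℝ} (hG : G.PosDef) {b x : ι → ℝ} (hx : G *ᵥ x = b)
    (k : ℕ) (p : Polynomial ℝ) (hp : p.natDegree ≤ k) (hp0 : p.eval 0 = 1) :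
    (x - cgIterate G b k) ⬝ᵥ G *ᵥ (x - cgIterate G b k) ≤
      (Polynomial.aeval G p *ᵥ x) ⬝ᵥ G *ᵥ (Polynomial.aeval G p *ᵥ x) := by
  -- As `p(0) = 1`, writing `p = 1 + X s` gives `p(G) x = x + s(G) b`, the error of the Krylov
  -- vector `-s(G) b`.
  have hpx : p = Polynomial.X * p.divX + 1 := by
    conv_lhs => rw [← Polynomial.X_mul_divX_add p]
    rw [Polynomial.coeff_zero_eq_eval_zero, hp0, Polynomial.C_1]
  have hy : (Polynomial.aeval G (-p.divX)) *ᵥ b ∈ krylov G b k := by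
    rcases Nat.eq_zero_or_pos k with rfl | hk
    · have : p.divX = 0 := by
        rw [Polynomial.eq_C_of_natDegree_le_zero hp]; simp
      simp [this]
    refine aeval_mulVec_mem_krylov G b _ ?_
    rw [Polynomial.degree_neg]
    refine (Polynomial.degree_le_natDegree).trans_lt ?_
    rw [Polynomial.natDegree_divX_eq_natDegree_tsub_one]
    exact_mod_cast (by omega)
  refine (cgIterate_optimal hG hx k hy).trans_eq ?_
  have : Polynomial.aeval G p *ᵥ x = x - (Polynomial.aeval G (-p.divX)) *ᵥ b := by
    conv_lhs => rw [hpx]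
    rw [← hx, mul_comm Polynomial.X]
    simp [Matrix.add_mulVec, Matrix.neg_mulVec, ← Matrix.mulVec_mulVec, add_comm]
  rw [this]

end ConjugateGradients

/-! ### Spectral estimates and the Chebyshev bound for conjugate gradients -/

section SpectralBounds

variable {ι : Type*} [Fintype ι] [DecidableEq ι]

lemma sum_eigenvector_dotProduct {G : Matrix ι ι ℝ} (hG : G.IsHermitian) (x y : ι → ℝ) :
    ∑ i, ((hG.eigenvectorBasis i).ofLp ⬝ᵥ x) * ((hG.eigenvectorBasis i).ofLp ⬝ᵥ y) = x ⬝ᵥ y := by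
  have h := hG.eigenvectorBasis.sum_inner_mul_inner (WithLp.toLp 2 x) (WithLp.toLp 2 y)
  simp only [EuclideanSpace.inner_eq_star_dotProduct, star_trivial] at h
  rw [dotProduct_comm x y, ← h]
  refine Finset.sum_congr rfl fun i _ => ?_
  rw [dotProduct_comm y]

lemma eigenvector_dotProduct_mulVec {G : Matrix ι ι ℝ} (hG : G.IsHermitian) (i : ι) (x : ι → ℝ) :
    (hG.eigenvectorBasis i).ofLp ⬝ᵥ G *ᵥ x =
      hG.eigenvalues i * ((hG.eigenvectorBasis i).ofLp ⬝ᵥ x) := by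
  rw [dotProduct_mulVec_symm hG, hG.mulVec_eigenvectorBasis, dotProduct_smul, smul_eq_mul,
    dotProduct_comm]

lemma eigenvector_dotProduct_aeval {G : Matrix ι ι ℝ} (hG : G.IsHermitian) (i : ι)
    (p : Polynomial ℝ) (x : ι → ℝ) :
    (hG.eigenvectorBasis i).ofLp ⬝ᵥ (Polynomial.aeval G p) *ᵥ x =
      p.eval (hG.eigenvalues i) * ((hG.eigenvectorBasis i).ofLp ⬝ᵥ x) := by
  induction p using Polynomial.induction_on' with
  | add p q hp hq =>
    rw [map_add, Matrix.add_mulVec, dotProduct_add, hp, hq, Polynomial.eval_add, add_mul]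
  | monomial n a =>
    rw [Polynomial.aeval_monomial, ← Algebra.smul_def, Matrix.smul_mulVec, dotProduct_smul,
      Polynomial.eval_monomial, smul_eq_mul, mul_assoc]
    congr 1
    induction n with
    | zero => simp
    | succ n ih =>
      rw [pow_succ', ← Matrix.mulVec_mulVec, eigenvector_dotProduct_mulVec, ih]
      ring

/-- In the eigenvector basis `p(G)` multiplies each coordinate by a value of `p` at an eigenvalue,
and the `G`-energy is a weighted sum of squares of the coordinates. -/
lemma quadraticForm_aeval_le {G : Matrix ι ι ℝ} (hG : G.PosDef) (p : Polynomial ℝ) {ε : ℝ}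
    (hp : ∀ i, |p.eval (hG.isHermitian.eigenvalues i)| ≤ ε) (x : ι → ℝ) :
    (Polynomial.aeval G p *ᵥ x) ⬝ᵥ G *ᵥ (Polynomial.aeval G p *ᵥ x) ≤
      ε ^ 2 * (x ⬝ᵥ G *ᵥ x) := by
  have hH := hG.isHermitian
  rw [← sum_eigenvector_dotProduct hH, ← sum_eigenvector_dotProduct hH, Finset.mul_sum]
  refine Finset.sum_le_sum fun i _ => ?_
  simp only [eigenvector_dotProduct_mulVec, eigenvector_dotProduct_aeval]
  have h1 : p.eval (hH.eigenvalues i) ^ 2 ≤ ε ^ 2 := sq_le_sq' (by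
    linarith [neg_abs_le (p.eval (hH.eigenvalues i)), hp i]) ((le_abs_self _).trans (hp i))
  have h2 : 0 ≤ hH.eigenvalues i * ((hH.eigenvectorBasis i).ofLp ⬝ᵥ x) ^ 2 :=
    mul_nonneg (hG.eigenvalues_pos i).le (sq_nonneg _)
  nlinarith [mul_le_mul_of_nonneg_right h1 h2]

/-- The three-term recurrence in the variable `(q + q⁻¹) / 2`. It evaluates the Chebyshev polynomial
outside `[-1, 1]`, at the point that corresponds to zero after scaling. -/
lemma eval_T_half_add_inv (k : ℕ) {q : ℝ} (hq : q ≠ 0) :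
    (Polynomial.Chebyshev.T ℝ k).eval ((q + q⁻¹) / 2) = (q ^ k + (q ^ k)⁻¹) / 2 := by
  induction k using Nat.twoStepInduction with
  | zero => simp
  | one => simp
  | more n h1 h2 =>
    push_cast at h1 h2 ⊢
    rw [Polynomial.Chebyshev.T_add_two]
    simp only [Polynomial.eval_sub, Polynomial.eval_mul, Polynomial.eval_ofNat, Polynomial.eval_X,
      h1, h2]
    field_simp
    ring

/-- The Chebyshev polynomial scaled to an interval and normalized at zero. -/
lemma exists_chebyshev_polynomial {a b : ℝ} (ha : 0 < a) (hab : a ≤ b) (k : ℕ) {q : ℝ}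
    (hq : q = (√(b / a) - 1) / (√(b / a) + 1)) :
    ∃ p : Polynomial ℝ, p.natDegree ≤ k ∧ p.eval 0 = 1 ∧
      ∀ t ∈ Set.Icc a b, |p.eval t| ≤ 2 * q ^ k / (1 + q ^ (2 * k)) := by
  -- For `a = b` the scaling to `[-1, 1]` degenerates. Then `q = 0`, and the bound equals `1` for `k
  -- = 0` (as `0 ^ 0 = 1`) and `0` for `k ≥ 1`, which `1 - t / a` attains.
  rcases hab.eq_or_lt with rfl | hlt
  · have hq0 : q = 0 := by rw [hq, div_self ha.ne']; simp
    rcases Nat.eq_zero_or_pos k with rfl | hk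
    · exact ⟨1, by simp, by simp, fun t _ => by norm_num⟩
    · refine ⟨1 - Polynomial.C a⁻¹ * Polynomial.X, ?_, by simp, ?_⟩
      · refine (Polynomial.natDegree_sub_le _ _).trans (max_le (by simp) ?_)
        exact ((Polynomial.natDegree_C_mul_le _ _).trans Polynomial.natDegree_X_le).trans hk
      · intro t ht
        have : t = a := le_antisymm ht.2 ht.1
        simp [this, ha.ne', hq0, hk.ne']
  set s := √(b / a) with hs
  have hs2 : s ^ 2 = b / a := Real.sq_sqrt (div_nonneg (ha.le.trans hab) ha.le)
  have hs1 : 1 < s := by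
    rw [hs, Real.lt_sqrt (by norm_num)]
    simpa using (one_lt_div ha).2 hlt
  have hq0 : 0 < q := by rw [hq]; exact div_pos (by linarith) (by linarith)
  -- The affine map `t ↦ (b + a - 2 t) / (b - a)` takes `[a, b]` to `[-1, 1]` and zero to the
  -- left-hand side.
  have hθ : (b + a) / (b - a) = (q + q⁻¹) / 2 := by
    have hb : b = s ^ 2 * a := by rw [hs2]; field_simp
    have h1 : s - 1 ≠ 0 := by linarith
    have h2 : s + 1 ≠ 0 := by linarith
    have h3 : s ^ 2 - 1 ≠ 0 := by nlinarith
    rw [hq, hb]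
    have : s ^ 2 * a - a = (s ^ 2 - 1) * a := by ring
    rw [this]
    field_simp
    ring
  set T := Polynomial.Chebyshev.T ℝ k with hT
  have hTθ := eval_T_half_add_inv k hq0.ne'
  rw [← hθ, ← hT] at hTθ
  have hpos : 0 < T.eval ((b + a) / (b - a)) := by rw [hTθ]; positivity
  refine ⟨Polynomial.C (T.eval ((b + a) / (b - a)))⁻¹ *
    T.comp (Polynomial.C ((b + a) / (b - a)) - Polynomial.C (2 / (b - a)) * Polynomial.X),
    ?_, ?_, ?_⟩
  · refine (Polynomial.natDegree_C_mul_le _ _).trans ?_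
    refine Polynomial.natDegree_comp_le.trans ?_
    have h1 : T.natDegree = k := by rw [hT, Polynomial.Chebyshev.natDegree_T]; simp
    have h2 : (Polynomial.C ((b + a) / (b - a)) -
        Polynomial.C (2 / (b - a)) * Polynomial.X : Polynomial ℝ).natDegree ≤ 1 :=
      (Polynomial.natDegree_sub_le _ _).trans
        (max_le (by simp) ((Polynomial.natDegree_C_mul_le _ _).trans Polynomial.natDegree_X_le))
    rw [h1]
    nlinarith
  · simp [Polynomial.eval_comp, hpos.ne']
  · intro t ht
    have hba : 0 < b - a := by linarith
    have h1 : |(b + a) / (b - a) - 2 / (b - a) * t| ≤ 1 := by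
      have : (b + a) / (b - a) - 2 / (b - a) * t = (b + a - 2 * t) / (b - a) := by
        field_simp
      rw [this, abs_div, abs_of_pos hba, div_le_one hba, abs_le]
      constructor <;> linarith [ht.1, ht.2]
    have h2 := Polynomial.Chebyshev.abs_eval_T_real_le_one k h1
    simp only [Polynomial.eval_mul, Polynomial.eval_C, Polynomial.eval_comp, Polynomial.eval_sub,
      Polynomial.eval_X, abs_mul, abs_inv, abs_of_pos hpos]
    refine (mul_le_mul_of_nonneg_left h2 (by positivity)).trans_eq ?_
    rw [hTθ, pow_mul' q 2 k]
    field_simp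
    ring

/-- The spectrum is the finite set of eigenvalues, so its infimum is attained at a positive one. For
an empty index type both extrema would be `0` by convention. -/
lemma spectrum_bounds {G : Matrix ι ι ℝ} [Nonempty ι] (hG : G.PosDef) :
    0 < sInf (spectrum ℝ G) ∧ sInf (spectrum ℝ G) ≤ sSup (spectrum ℝ G) ∧
      ∀ i, hG.isHermitian.eigenvalues i ∈ Set.Icc (sInf (spectrum ℝ G)) (sSup (spectrum ℝ G)) := by
  have hs := hG.isHermitian.spectrum_real_eq_range_eigenvalues
  have hfin : (spectrum ℝ G).Finite := by rw [hs]; exact Set.finite_range _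
  have hne : (spectrum ℝ G).Nonempty := by rw [hs]; exact Set.range_nonempty _
  have hmem : ∀ i, hG.isHermitian.eigenvalues i ∈ spectrum ℝ G := fun i => by
    rw [hs]; exact Set.mem_range_self i
  have hIcc : ∀ i, hG.isHermitian.eigenvalues i ∈
      Set.Icc (sInf (spectrum ℝ G)) (sSup (spectrum ℝ G)) := fun i =>
    ⟨csInf_le hfin.bddBelow (hmem i), le_csSup hfin.bddAbove (hmem i)⟩
  refine ⟨?_, ?_, hIcc⟩
  · have := hne.csInf_mem hfin
    rw [hs] at this
    obtain ⟨i, hi⟩ := this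
    rw [hs, ← hi]
    exact hG.eigenvalues_pos i
  · obtain ⟨i⟩ := ‹Nonempty ι›
    exact (hIcc i).1.trans (hIcc i).2

lemma rate_mem_Ico {G : Matrix ι ι ℝ} [Nonempty ι] (hG : G.PosDef) :
    (√(conditionNumber G) - 1) / (√(conditionNumber G) + 1) ∈ Set.Ico (0 : ℝ) 1 := by
  obtain ⟨h1, h2, -⟩ := spectrum_bounds hG
  have h3 : 1 ≤ √(conditionNumber G) := by
    rw [Real.one_le_sqrt, conditionNumber, one_le_div h1]
    exact h2
  exact ⟨div_nonneg (by linarith) (by linarith), (div_lt_one (by linarith)).2 (by linarith)⟩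

/-- The error bound for the conjugate gradient method in the energy norm. -/
theorem cgIterate_error_le {G : Matrix ι ι ℝ} [Nonempty ι] (hG : G.PosDef) {b x : ι → ℝ}
    (hx : G *ᵥ x = b) (k : ℕ) {q : ℝ}
    (hq : q = (√(conditionNumber G) - 1) / (√(conditionNumber G) + 1)) :
    √((x - cgIterate G b k) ⬝ᵥ G *ᵥ (x - cgIterate G b k)) ≤
      2 * q ^ k / (1 + q ^ (2 * k)) * √(x ⬝ᵥ G *ᵥ x) := by
  obtain ⟨h1, h2, h3⟩ := spectrum_bounds hG
  have hq0 : 0 ≤ q := hq ▸ (rate_mem_Ico hG).1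
  obtain ⟨p, hp, hp0, hpb⟩ := exists_chebyshev_polynomial h1 h2 k hq
  refine Real.sqrt_le_iff.2 ⟨by positivity, ?_⟩
  refine (cgIterate_le_polynomial hG hx k p hp hp0).trans ?_
  rw [mul_pow, Real.sq_sqrt (posDef_nonneg hG x)]
  exact quadraticForm_aeval_le hG p (fun i => hpb _ (h3 i)) x

end SpectralBounds

/-- A generalized symmetric eigenvalue problem has a positive eigenvalue unless the form on the
left-hand side is negative semidefinite. -/
lemma exists_pos_generalized_eigenvalue {ι : Type*} [Fintype ι] {A B : Matrix ι ι ℝ}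
    (hA : A.IsHermitian) (hB : B.PosDef) (h : ∃ x : ι → ℝ, 0 < x ⬝ᵥ A *ᵥ x) :
    ∃ μ : ℝ, 0 < μ ∧ ∃ x : ι → ℝ, x ≠ 0 ∧ A *ᵥ x = μ • (B *ᵥ x) := by
  obtain ⟨z, hz⟩ := h
  have hz0 : z ≠ 0 := by rintro rfl; simp at hz
  have hne : (Metric.sphere (0 : ι → ℝ) 1).Nonempty :=
    ⟨‖z‖⁻¹ • z, by simp [norm_smul, norm_ne_zero_iff.2 hz0]⟩
  have hcont : ContinuousOn (fun x : ι → ℝ => (x ⬝ᵥ A *ᵥ x) / (x ⬝ᵥ B *ᵥ x))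
      (Metric.sphere (0 : ι → ℝ) 1) := by
    refine ContinuousOn.div (by fun_prop) (by fun_prop) fun x hx => ?_
    exact (posDef_pos hB (by rintro rfl; simp at hx)).ne'
  -- The eigenvalue is the maximum of the Rayleigh quotient. The sphere is that of the sup norm,
  -- which is harmless because the quotient is homogeneous of degree zero.
  obtain ⟨x, hx, hmax⟩ := (isCompact_sphere (0 : ι → ℝ) 1).exists_isMaxOn hne hcont
  have hx0 : x ≠ 0 := by rintro rfl; simp at hx
  set μ := (x ⬝ᵥ A *ᵥ x) / (x ⬝ᵥ B *ᵥ x) with hμ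
  have hall : ∀ y : ι → ℝ, y ⬝ᵥ A *ᵥ y ≤ μ * (y ⬝ᵥ B *ᵥ y) := by
    intro y
    rcases eq_or_ne y 0 with rfl | hy
    · simp
    have hn : 0 < ‖y‖ := norm_pos_iff.2 hy
    have h1 := hmax (show ‖y‖⁻¹ • y ∈ Metric.sphere (0 : ι → ℝ) 1 by
      simp [norm_smul, hn.ne'])
    simp only [Set.mem_ofPred_eq, Matrix.mulVec_smul, smul_dotProduct, dotProduct_smul,
      smul_eq_mul] at h1
    have hBy := posDef_pos hB hy
    rw [← hμ, div_le_iff₀ (by positivity)] at h1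
    have h2 : 0 < ‖y‖⁻¹ * ‖y‖⁻¹ := by positivity
    refine le_of_mul_le_mul_left ?_ h2
    linarith
  have hμpos : 0 < μ := by
    by_contra hcon
    have := hall z
    have hBz := posDef_pos hB hz0
    nlinarith
  refine ⟨μ, hμpos, x, hx0, ?_⟩
  -- A vector at which a positive semidefinite quadratic form vanishes lies in the kernel of its
  -- matrix; for `μ B - A` this is the eigenvalue equation.
  have hQ : (μ • B - A).PosSemidef := by
    refine Matrix.PosSemidef.of_dotProduct_mulVec_nonneg ?_ fun y => ?_
    · exact (hB.isHermitian.smul (IsSelfAdjoint.all μ)).sub hA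
    · have := hall y
      simp only [star_trivial, Matrix.sub_mulVec, Matrix.smul_mulVec, dotProduct_sub,
        dotProduct_smul, smul_eq_mul]
      linarith
  have h0 : star x ⬝ᵥ (μ • B - A) *ᵥ x = 0 := by
    simp only [star_trivial, Matrix.sub_mulVec, Matrix.smul_mulVec, dotProduct_sub,
        dotProduct_smul, smul_eq_mul]
    rw [hμ, div_mul_cancel₀ _ (posDef_pos hB hx0).ne', sub_self]
  have := (hQ.dotProduct_mulVec_zero_iff x).1 h0
  rw [Matrix.sub_mulVec, Matrix.smul_mulVec, sub_eq_zero] at this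
  exact this.symm

/-! ### Spans of orthogonalized families -/

/-- Generators may be changed by elements of `S` without changing the span modulo `S`. Every
orthogonalization in the special basis is such a change, so spans can be followed without knowing
that intermediate vectors are independent or even nonzero. -/
lemma sup_span_image_eq {M : Type*} [AddCommGroup M] [Module ℝ M] {S : Submodule ℝ M}
    {f : M → M} {s : Set M} (h : ∀ u ∈ s, f u - u ∈ S) :
    S ⊔ Submodule.span ℝ (f '' s) = S ⊔ Submodule.span ℝ s := by
  refine le_antisymm (sup_le le_sup_left (Submodule.span_le.2 ?_))
    (sup_le le_sup_left (Submodule.span_le.2 ?_))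
  · rintro _ ⟨u, hu, rfl⟩
    have h1 := Submodule.mem_sup_left (T := Submodule.span ℝ s) (h u hu)
    have h2 := Submodule.mem_sup_right (S := S) (Submodule.subset_span (R := ℝ) hu)
    simpa using Submodule.add_mem _ h1 h2
  · intro u hu
    have h1 := Submodule.mem_sup_left (T := Submodule.span ℝ (f '' s)) (h u hu)
    have h2 := Submodule.mem_sup_right (S := S)
      (Submodule.subset_span (R := ℝ) (Set.mem_image_of_mem f hu))
    simpa using Submodule.sub_mem _ h2 h1

lemma range_columnMatrix {ι : Type*} (W : List (ι → ℝ)) :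
    LinearMap.range (columnMatrix W).mulVecLin = Submodule.span ℝ {v | v ∈ W} := by
  rw [Matrix.range_mulVecLin]
  congr 1
  ext v
  constructor
  · rintro ⟨j, rfl⟩
    exact List.get_mem W j
  · intro hv
    obtain ⟨j, rfl⟩ := List.mem_iff_get.1 hv
    exact ⟨j, rfl⟩

section

variable {ι : Type*} [Fintype ι]

/-- The vector may be zero: then the default value of the inverse is irrelevant and both spans are
trivial. -/
lemma span_singleton_normalize {A : Matrix ι ι ℝ} (hA : A.PosDef) (v : ι → ℝ) :
    Submodule.span ℝ {(√(v ⬝ᵥ A *ᵥ v))⁻¹ • v} = Submodule.span ℝ {v} := by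
  rcases eq_or_ne v 0 with rfl | hv
  · simp
  · refine Submodule.span_singleton_smul_eq (IsUnit.mk0 _ ?_) v
    exact inv_ne_zero (Real.sqrt_pos.2 (posDef_pos hA hv)).ne'

lemma length_modifiedGramSchmidt (A : Matrix ι ι ℝ) (l : List (ι → ℝ)) :
    (modifiedGramSchmidt A l).length = l.length := by
  induction l using modifiedGramSchmidt.induct A with
  | case1 => simp [modifiedGramSchmidt]
  | case2 v vs ih =>
    simp only [List.map_subtype, List.unattach_attach] at ih
    rw [modifiedGramSchmidt, List.length_cons, ih]
    simp

lemma span_modifiedGramSchmidt {A : Matrix ι ι ℝ} (hA : A.PosDef) (l : List (ι → ℝ)) :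
    Submodule.span ℝ {v | v ∈ modifiedGramSchmidt A l} = Submodule.span ℝ {v | v ∈ l} := by
  induction l using modifiedGramSchmidt.induct A with
  | case1 => simp [modifiedGramSchmidt]
  | case2 v vs ih =>
    simp only [List.map_subtype, List.unattach_attach] at ih
    have hc : ∀ (a : ι → ℝ) (m : List (ι → ℝ)), {u | u ∈ a :: m} = insert a {u | u ∈ m} := by
      intro a m; ext; simp
    rw [modifiedGramSchmidt, hc, hc, Submodule.span_insert, Submodule.span_insert, ih]
    have hm : ∀ f : (ι → ℝ) → (ι → ℝ), {u | u ∈ vs.map f} = f '' {u | u ∈ vs} := by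
      intro f; ext; simp
    rw [hm, sup_span_image_eq, span_singleton_normalize hA]
    intro u _
    rw [sub_sub_cancel_left]
    exact Submodule.neg_mem _ (Submodule.smul_mem _ _ (Submodule.mem_span_singleton_self _))

/-- The subtracted vector is a combination of the columns whatever the coefficients are, so the Gram
matrix need not be invertible. -/
lemma orthogonalize_sub_mem (A : Matrix ι ι ℝ) (W : List (ι → ℝ)) (v : ι → ℝ) :
    orthogonalize A W v - v ∈ Submodule.span ℝ {u | u ∈ W} := by
  rw [orthogonalize, sub_sub_cancel_left, ← range_columnMatrix]
  exact Submodule.neg_mem _ ⟨_, rfl⟩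

/-- A family that is no longer than the dimension of its span is linearly independent. Independence
of the special basis is thus reduced to a count. -/
lemma posDef_conj_columnMatrix {A : Matrix ι ι ℝ} (hA : A.PosDef) {W : List (ι → ℝ)}
    (h : W.length ≤ Module.finrank ℝ (Submodule.span ℝ {v | v ∈ W})) :
    ((columnMatrix W)ᵀ * A * columnMatrix W).PosDef := by
  have hli : LinearIndependent ℝ (columnMatrix W).col := by
    rw [linearIndependent_iff_card_le_finrank_span, Set.finrank, ← Matrix.range_mulVecLin,
      range_columnMatrix]
    simpa using h
  have := hA.conjTranspose_mul_mul_same (Matrix.mulVec_injective_iff.2 hli)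
  simpa using this

end

/-! ### Positive semidefinite forms -/

section Forms

variable {E : Type*} [AddCommGroup E] [Module ℝ E]

/-- The seminorm of a positive semidefinite form. -/
def formNorm (B : LinearMap.BilinForm ℝ E) (x : E) : ℝ := √(B x x)

variable {B : LinearMap.BilinForm ℝ E}

lemma apply_le_formNorm_mul (hs : ∀ x y, B x y = B y x) (hB : ∀ x, 0 ≤ B x x) (x y : E) :
    B x y ≤ formNorm B x * formNorm B y := by
  rw [formNorm, formNorm, ← Real.sqrt_mul (hB x)]
  exact Real.le_sqrt_of_sq_le (LinearMap.BilinForm.apply_sq_le_of_symm B hB ⟨fun x y => by simpa using hs x y⟩ x y)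

lemma formNorm_nonneg (B : LinearMap.BilinForm ℝ E) (x : E) : 0 ≤ formNorm B x :=
  Real.sqrt_nonneg _

lemma formNorm_sq (hB : ∀ x, 0 ≤ B x x) (x : E) : formNorm B x ^ 2 = B x x :=
  Real.sq_sqrt (hB x)

lemma formNorm_add_le (hs : ∀ x y, B x y = B y x) (hB : ∀ x, 0 ≤ B x x) (x y : E) :
    formNorm B (x + y) ≤ formNorm B x + formNorm B y := by
  refine Real.sqrt_le_iff.2 ⟨add_nonneg (formNorm_nonneg _ _) (formNorm_nonneg _ _), ?_⟩
  have h1 := apply_le_formNorm_mul hs hB x y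
  have h2 : B y x = B x y := hs y x
  have hx := formNorm_sq hB x
  have hy := formNorm_sq hB y
  simp only [map_add, LinearMap.add_apply]
  nlinarith

lemma formNorm_smul (B : LinearMap.BilinForm ℝ E) (c : ℝ) (x : E) :
    formNorm B (c • x) = |c| * formNorm B x := by
  rw [formNorm, formNorm, ← Real.sqrt_sq_eq_abs, ← Real.sqrt_mul (sq_nonneg c)]
  congr 1
  simp only [map_smul, LinearMap.smul_apply, smul_eq_mul]
  ring

lemma formNorm_sum_le {Z : Type*} (hs : ∀ x y, B x y = B y x) (hB : ∀ x, 0 ≤ B x x) (s : Finset Z)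
    (g : Z → E) : formNorm B (∑ z ∈ s, g z) ≤ ∑ z ∈ s, formNorm B (g z) := by
  classical
  induction s using Finset.induction_on with
  | empty => simp [formNorm]
  | insert a s ha ih =>
    rw [Finset.sum_insert ha, Finset.sum_insert ha]
    exact (formNorm_add_le hs hB _ _).trans (by linarith)

/-- The error of a Galerkin solution is the smallest one in its space. -/
lemma formNorm_le_of_orthogonal (hs : ∀ x y, B x y = B y x) (hB : ∀ x, 0 ≤ B x x) {V : Submodule ℝ E}
    {u w v : E} (hw : w ∈ V) (hv : v ∈ V) (h : ∀ y ∈ V, B (u - w) y = 0) :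
    formNorm B (u - w) ≤ formNorm B (u - v) := by
  refine Real.sqrt_le_sqrt ?_
  have h1 := h _ (Submodule.sub_mem _ hw hv)
  have h2 : B (w - v) (u - w) = 0 := by rw [← h1]; exact hs _ _
  have h3 : u - v = (u - w) + (w - v) := by abel
  have h4 := hB (w - v)
  rw [h3]
  simp only [map_add, LinearMap.add_apply]
  linarith

/-- Comparison of inexact and exact orthogonal corrections of a family of orthonormal vectors. -/
lemma exists_projection_formNorm_le {Z : Type*} [Fintype Z] (hs : ∀ x y, B x y = B y x)
    (hB : ∀ x, 0 ≤ B x x) {W : Submodule ℝ E} {u : E} {g P C : Z → E} {d : Z → ℝ} {ε : ℝ}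
    (hP : ∀ z, P z ∈ W) (hPo : ∀ z, ∀ w ∈ W, B (g z - P z) w = 0)
    (hε : ∀ z, formNorm B (P z - C z) ≤ ε) (hd : u - ∑ z, d z • g z ∈ W) :
    ∃ w ∈ W, (∀ y ∈ W, B (u - w) y = 0) ∧
      formNorm B (u - ∑ z, d z • (g z - C z)) ≤
        formNorm B w + ε * √(Fintype.card Z) * √(∑ z, d z ^ 2) := by
  -- The witness is `u - ∑ d z • (g z - P z)`, regrouped so that membership in `W` is visible; what
  -- is subtracted from `u` is orthogonal to `W`.
  refine ⟨(u - ∑ z, d z • g z) + ∑ z, d z • P z, Submodule.add_mem _ hd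
    (Submodule.sum_mem _ fun z _ => Submodule.smul_mem _ _ (hP z)), ?_, ?_⟩
  · intro y hy
    have : u - ((u - ∑ z, d z • g z) + ∑ z, d z • P z) = ∑ z, d z • (g z - P z) := by
      simp only [smul_sub, Finset.sum_sub_distrib]
      abel
    rw [this]
    rw [map_sum, LinearMap.sum_apply]
    refine Finset.sum_eq_zero fun z _ => ?_
    rw [map_smul, LinearMap.smul_apply, hPo z y hy, smul_zero]
  · have : u - ∑ z, d z • (g z - C z) = ((u - ∑ z, d z • g z) + ∑ z, d z • P z) +
        ∑ z, (-d z) • (P z - C z) := by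
      simp only [smul_sub, neg_smul, Finset.sum_sub_distrib, Finset.sum_neg_distrib]
      abel
    rw [this]
    refine (formNorm_add_le hs hB _ _).trans (add_le_add le_rfl ?_)
    have hsum : ∑ z, |d z| ≤ √(Fintype.card Z) * √(∑ z, d z ^ 2) := by
      rw [← Real.sqrt_mul (by positivity)]
      refine Real.le_sqrt_of_sq_le ?_
      have := sq_sum_le_card_mul_sum_sq (s := Finset.univ) (f := fun z => |d z|)
      simpa using this
    -- An index is needed to know that `ε ≥ 0`; without one, all sums are empty.
    rcases isEmpty_or_nonempty Z with hZ | ⟨⟨z₀⟩⟩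
    · simp [formNorm]
    have hε0 : 0 ≤ ε := (formNorm_nonneg _ _).trans (hε z₀)
    calc formNorm B (∑ z, (-d z) • (P z - C z)) ≤ ∑ z, formNorm B ((-d z) • (P z - C z)) :=
          formNorm_sum_le hs hB _ _
      _ ≤ ∑ z, |d z| * ε := by
          refine Finset.sum_le_sum fun z _ => ?_
          rw [formNorm_smul, abs_neg]
          exact mul_le_mul_of_nonneg_left (hε z) (abs_nonneg _)
      _ = ε * ∑ z, |d z| := by rw [← Finset.sum_mul, mul_comm]
      _ ≤ ε * √(Fintype.card Z) * √(∑ z, d z ^ 2) := by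
          rw [mul_assoc]; exact mul_le_mul_of_nonneg_left hsum hε0

lemma apply_sum_smul_of_orthonormal {Z : Type*} [Fintype Z] [DecidableEq Z] {g : Z → E}
    (hg : ∀ z z', B (g z) (g z') = if z = z' then 1 else 0) (d : Z → ℝ) :
    B (∑ z, d z • g z) (∑ z, d z • g z) = ∑ z, d z ^ 2 := by
  simp [map_sum, LinearMap.sum_apply, hg, sq]

end Forms

lemma dotProduct_mulVec_le_opNorm {n : Type*} [Fintype n] [DecidableEq n] (A : Matrix n n ℝ)
    (c : n → ℝ) :
    c ⬝ᵥ A *ᵥ c ≤ ‖Matrix.toEuclideanCLM (n := n) (𝕜 := ℝ) A‖ * ∑ j, c j ^ 2 := by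
  set T := Matrix.toEuclideanCLM (n := n) (𝕜 := ℝ) A
  have h1 : c ⬝ᵥ A *ᵥ c = inner ℝ (T (WithLp.toLp 2 c)) (WithLp.toLp 2 c) := by
    rw [EuclideanSpace.inner_eq_star_dotProduct]
    simp [T]
  have h2 := real_inner_le_norm (T (WithLp.toLp 2 c)) (WithLp.toLp 2 c)
  have h3 := T.le_opNorm (WithLp.toLp 2 c)
  have h4 : ‖(WithLp.toLp 2 c : EuclideanSpace ℝ n)‖ ^ 2 = ∑ j, c j ^ 2 := by
    rw [EuclideanSpace.norm_sq_eq]; simp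
  rw [h1, ← h4, sq, ← mul_assoc]
  exact h2.trans (mul_le_mul_of_nonneg_right h3 (norm_nonneg _))

/-! ### Poincaré inequalities on intervals -/

section Interval

open scoped NNReal Topology

variable {u : ℝ → ℝ} {C : ℝ≥0} {a b : ℝ}

lemma _root_.LipschitzWith.intervalIntegrable_deriv_sq (hu : LipschitzWith C u) (a b : ℝ) :
    IntervalIntegrable (fun x => deriv u x ^ 2) volume a b := by
  rw [intervalIntegrable_iff]
  have : IsFiniteMeasure (volume.restrict (Set.uIoc a b)) := by
    rw [Set.uIoc]; infer_instance
  refine Integrable.of_bound (measurable_deriv u |>.pow_const 2).aestronglyMeasurable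
    ((C : ℝ) ^ 2) (Filter.Eventually.of_forall fun x => ?_)
  rw [norm_pow]
  exact pow_le_pow_left₀ (norm_nonneg _) (norm_deriv_le_of_lipschitz hu) 2

lemma _root_.LipschitzWith.absolutelyContinuous (hu : LipschitzWith C u) (a b : ℝ) :
    AbsolutelyContinuousOnInterval u a b :=
  (hu.lipschitzOnWith (s := Set.uIcc a b)).absolutelyContinuousOnInterval

/-- The function `w = c cot (c (x - a + δ))` solves the Riccati equation `w' = -(c² + w²)`, and `c`
is chosen so that `w` vanishes at `b`. As `w u²` vanishes at both ends, `0 = ∫ (w u²)' = ∫ (-(c² +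
w²) u² + 2 w u u') ≤ ∫ (u'² - c² u²)`, because `(u' - w u)² ≥ 0`. The shift `δ` keeps the pole of
the cotangent outside the interval. Lipschitz functions are absolutely continuous, which justifies
the integration. -/
lemma poincare_shifted (hab : a < b) (hu : LipschitzWith C u) (ha : u a = 0) {δ : ℝ}
    (hδ : 0 < δ) :
    Real.pi ^ 2 * ∫ x in a..b, u x ^ 2 ≤ 4 * (b - a + δ) ^ 2 * ∫ x in a..b, deriv u x ^ 2 := by
  have hl : 0 < b - a + δ := by linarith
  set c := Real.pi / (2 * (b - a + δ)) with hc
  have hcpos : 0 < c := by positivity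
  have hsin : ∀ x ∈ Set.Icc a b, 0 < Real.sin (c * (x - a + δ)) := by
    intro x hx
    refine Real.sin_pos_of_pos_of_lt_pi (mul_pos hcpos (by linarith [hx.1])) ?_
    have h1 : c * (x - a + δ) ≤ c * (b - a + δ) := by
      refine mul_le_mul_of_nonneg_left (by linarith [hx.2]) hcpos.le
    have h2 : c * (b - a + δ) = Real.pi / 2 := by rw [hc]; field_simp
    linarith [Real.pi_pos]
  set w : ℝ → ℝ := fun x => c * (Real.cos (c * (x - a + δ)) / Real.sin (c * (x - a + δ))) with hw
  have hwd : ∀ x ∈ Set.Icc a b, HasDerivAt w (-(c ^ 2 + w x ^ 2)) x := by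
    intro x hx
    have h0 : HasDerivAt (fun x => c * (x - a + δ)) c x := by
      simpa using (((hasDerivAt_id x).sub_const a).add_const δ).const_mul c
    have h1 := ((h0.cos.div h0.sin (hsin x hx).ne')).const_mul c
    refine h1.congr_deriv ?_
    have hs := (hsin x hx).ne'
    simp only [hw]
    field_simp
    ring
  have hwb : w b = 0 := by
    have h2 : c * (b - a + δ) = Real.pi / 2 := by rw [hc]; field_simp
    simp [hw, h2]
  have hwac : AbsolutelyContinuousOnInterval w a b := by
    refine ContDiffOn.absolutelyContinuousOnInterval ?_
    rw [Set.uIcc_of_le hab.le]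
    refine contDiffOn_const.mul (ContDiffOn.div (by fun_prop) (by fun_prop) fun x hx => ?_)
    exact (hsin x hx).ne'
  have huac := hu.absolutelyContinuous a b
  have hint := hwac.integral_deriv_mul_eq_sub (huac.fun_mul huac)
  simp only [hwb, ha, mul_zero, zero_mul, sub_self] at hint
  have hui : IntervalIntegrable (fun x => c ^ 2 * u x ^ 2) volume a b := by
    apply Continuous.intervalIntegrable
    have := hu.continuous
    fun_prop
  have hle : (0 : ℝ) ≤ ∫ x in a..b, (deriv u x ^ 2 - c ^ 2 * u x ^ 2) := by
    rw [← hint]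
    refine intervalIntegral.integral_mono_ae_restrict hab.le ?_ ?_ ?_
    · exact (hwac.intervalIntegrable_deriv.mul_continuousOn
        (huac.fun_mul huac).continuousOn).add
        ((huac.fun_mul huac).intervalIntegrable_deriv.continuousOn_mul hwac.continuousOn)
    · exact (hu.intervalIntegrable_deriv_sq a b).sub
        hui
    · filter_upwards [ae_restrict_mem measurableSet_Icc,
        ae_restrict_of_ae hu.ae_differentiableAt_real] with x hx hd
      have h1 : deriv (fun x => u x * u x) x = 2 * u x * deriv u x := by
        rw [(hd.hasDerivAt.fun_mul hd.hasDerivAt).deriv]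
        ring
      rw [(hwd x hx).deriv, h1]
      nlinarith [sq_nonneg (deriv u x - w x * u x)]
  rw [intervalIntegral.integral_sub (hu.intervalIntegrable_deriv_sq a b)
    hui,
    intervalIntegral.integral_const_mul] at hle
  have h3 : 4 * (b - a + δ) ^ 2 * c ^ 2 = Real.pi ^ 2 := by rw [hc]; field_simp; ring
  have h4 : 0 ≤ 4 * (b - a + δ) ^ 2 := by positivity
  rw [← h3, mul_assoc]
  exact mul_le_mul_of_nonneg_left (by linarith) h4

/-- The Poincaré inequality for functions that vanish at the left end point. -/
lemma poincare_left (hab : a < b) (hu : LipschitzWith C u) (ha : u a = 0) :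
    ∫ x in a..b, u x ^ 2 ≤ 4 * (b - a) ^ 2 / Real.pi ^ 2 * ∫ x in a..b, deriv u x ^ 2 := by
  have hlim : Filter.Tendsto
      (fun δ : ℝ => 4 * (b - a + δ) ^ 2 * ∫ x in a..b, deriv u x ^ 2) (𝓝[>] 0)
      (𝓝 (4 * (b - a + 0) ^ 2 * ∫ x in a..b, deriv u x ^ 2)) := by
    refine Filter.Tendsto.mono_left ?_ nhdsWithin_le_nhds
    exact (Continuous.tendsto (by fun_prop) 0)
  have h := ge_of_tendsto hlim (Filter.eventually_of_mem self_mem_nhdsWithin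
    fun δ hδ => poincare_shifted hab hu ha hδ)
  rw [add_zero] at h
  have hpi := Real.pi_pos
  rw [div_mul_eq_mul_div, le_div_iff₀ (by positivity)]
  linarith

/-- The Poincaré inequality for functions that vanish at the right end point. -/
lemma poincare_right (hab : a < b) (hu : LipschitzWith C u) (hb : u b = 0) :
    ∫ x in a..b, u x ^ 2 ≤ 4 * (b - a) ^ 2 / Real.pi ^ 2 * ∫ x in a..b, deriv u x ^ 2 := by
  have hv : LipschitzWith C (fun x => u (a + b - x)) := by
    refine LipschitzWith.of_dist_le_mul fun x y => (hu.dist_le_mul _ _).trans_eq ?_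
    rw [dist_sub_left]
  have h := poincare_left hab hv (by simpa using hb)
  have h1 : ∀ x, deriv (fun x => u (a + b - x)) x ^ 2 = deriv u (a + b - x) ^ 2 := by
    intro x
    rw [deriv_comp_const_sub, neg_sq]
  simp only [h1] at h
  rw [intervalIntegral.integral_comp_sub_left (fun x => u x ^ 2),
    intervalIntegral.integral_comp_sub_left (fun x => deriv u x ^ 2)] at h
  simpa using h

/-- The Poincaré inequality without boundary conditions. -/
lemma poincare_mean (hab : a < b) (hu : LipschitzWith C u) :
    ∫ x in a..b, u x ^ 2 ≤ (b - a)⁻¹ * (∫ x in a..b, u x) ^ 2 +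
      4 * (b - a) ^ 2 / Real.pi ^ 2 * ∫ x in a..b, deriv u x ^ 2 := by
  -- The value at the end point is subtracted instead of the mean; by completing the square, `∫ (u -
  -- u a)²` is at least `∫ u² - (∫ u)² / (b - a)`. The resulting constant is not the best one for
  -- mean value zero, but it equals the one for functions vanishing at one end, which boundary
  -- elements require anyway.
  have hv : LipschitzWith C (fun x => u x - u a) := by
    refine LipschitzWith.of_dist_le_mul fun x y => (le_of_eq ?_).trans (hu.dist_le_mul x y)
    rw [dist_sub_right]
  have h := poincare_left hab hv (sub_self _)
  simp only [deriv_sub_const_fun] at h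
  have h1 : ∫ x in a..b, (u x - u a) ^ 2 =
      (∫ x in a..b, u x ^ 2) - 2 * u a * (∫ x in a..b, u x) + (b - a) * u a ^ 2 := by
    have : ∀ x, (u x - u a) ^ 2 = u x ^ 2 - 2 * u a * u x + u a ^ 2 := fun x => by ring
    simp only [this]
    rw [intervalIntegral.integral_add, intervalIntegral.integral_sub,
      intervalIntegral.integral_const_mul, intervalIntegral.integral_const, smul_eq_mul]
    all_goals
      apply Continuous.intervalIntegrable
      have := hu.continuous
      fun_prop
  rw [h1] at h
  set I := ∫ x in a..b, u x
  have h2 : -(b - a)⁻¹ * I ^ 2 ≤ - 2 * u a * I + (b - a) * u a ^ 2 := by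
    have h3 : 0 < b - a := by linarith
    have h4 : 0 ≤ (b - a)⁻¹ * ((b - a) * u a - I) ^ 2 := by positivity
    have h5 : (b - a)⁻¹ * ((b - a) * u a - I) ^ 2 =
        (b - a) * u a ^ 2 - 2 * u a * I + (b - a)⁻¹ * I ^ 2 := by
      field_simp
      ring
    linarith
  linarith

end Interval

/-! ### Lipschitz functions on the plane -/

section Plane

open scoped NNReal Topology

/-- The partial derivative in the first direction. -/
def deriv₁ (v : ℝ × ℝ → ℝ) (x : ℝ × ℝ) : ℝ := deriv (fun t => v (t, x.2)) x.1

/-- The partial derivative in the second direction. -/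
def deriv₂ (v : ℝ × ℝ → ℝ) (x : ℝ × ℝ) : ℝ := deriv (fun t => v (x.1, t)) x.2

lemma gradDot_eq (v w : ℝ × ℝ → ℝ) (x : ℝ × ℝ) :
    gradDot v w x = deriv₁ v x * deriv₁ w x + deriv₂ v x * deriv₂ w x := rfl

lemma gradDot_self (v : ℝ × ℝ → ℝ) (x : ℝ × ℝ) :
    gradDot v v x = deriv₁ v x ^ 2 + deriv₂ v x ^ 2 := by
  rw [gradDot_eq]; ring

/-- The space of Lipschitz functions. -/
def lipSpace : Submodule ℝ (ℝ × ℝ → ℝ) where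
  carrier := {v | ∃ C : ℝ≥0, LipschitzWith C v}
  add_mem' := by
    rintro v w ⟨C, hv⟩ ⟨D, hw⟩
    exact ⟨C + D, hv.add hw⟩
  zero_mem' := ⟨0, LipschitzWith.const 0⟩
  smul_mem' := by
    rintro t v ⟨C, hv⟩
    refine ⟨‖t‖₊ * C, LipschitzWith.of_dist_le_mul fun x y => ?_⟩
    simp only [Pi.smul_apply, dist_smul₀, NNReal.coe_mul, coe_nnnorm, mul_assoc]
    exact mul_le_mul_of_nonneg_left (hv.dist_le_mul x y) (norm_nonneg t)

lemma lipschitzWith_fst_slice {C : ℝ≥0} {v : ℝ × ℝ → ℝ} (hv : LipschitzWith C v) (y : ℝ) :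
    LipschitzWith C (fun t => v (t, y)) := by
  simpa [Function.comp_def] using hv.comp (LipschitzWith.prodMk_right y)

lemma lipschitzWith_snd_slice {C : ℝ≥0} {v : ℝ × ℝ → ℝ} (hv : LipschitzWith C v) (x : ℝ) :
    LipschitzWith C (fun t => v (x, t)) := by
  simpa [Function.comp_def] using hv.comp (LipschitzWith.prodMk_left x)

lemma norm_deriv₁_le {C : ℝ≥0} {v : ℝ × ℝ → ℝ} (hv : LipschitzWith C v) (x : ℝ × ℝ) :
    ‖deriv₁ v x‖ ≤ C :=
  norm_deriv_le_of_lipschitz (lipschitzWith_fst_slice hv x.2)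

lemma norm_deriv₂_le {C : ℝ≥0} {v : ℝ × ℝ → ℝ} (hv : LipschitzWith C v) (x : ℝ × ℝ) :
    ‖deriv₂ v x‖ ≤ C :=
  norm_deriv_le_of_lipschitz (lipschitzWith_snd_slice hv x.1)

lemma measurable_deriv₂ {v : ℝ × ℝ → ℝ} (hv : Continuous v) : Measurable (deriv₂ v) :=
  measurable_deriv_with_param (f := fun x t => v (x, t)) hv

lemma measurable_deriv₁ {v : ℝ × ℝ → ℝ} (hv : Continuous v) : Measurable (deriv₁ v) :=
  (measurable_deriv_with_param (f := fun y t => v (t, y)) (by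
    exact hv.comp continuous_swap)).comp measurable_swap

lemma measurable_gradDot {v w : ℝ × ℝ → ℝ} (hv : Continuous v) (hw : Continuous w) :
    Measurable (gradDot v w) :=
  ((measurable_deriv₁ hv).mul (measurable_deriv₁ hw)).add
    ((measurable_deriv₂ hv).mul (measurable_deriv₂ hw))

lemma norm_gradDot_le {C D : ℝ≥0} {v w : ℝ × ℝ → ℝ} (hv : LipschitzWith C v)
    (hw : LipschitzWith D w) (x : ℝ × ℝ) : ‖gradDot v w x‖ ≤ 2 * (C * D) := by
  rw [gradDot_eq]
  refine (norm_add_le _ _).trans ?_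
  rw [norm_mul, norm_mul]
  have h1 := mul_le_mul (norm_deriv₁_le hv x) (norm_deriv₁_le hw x) (norm_nonneg _) C.2
  have h2 := mul_le_mul (norm_deriv₂_le hv x) (norm_deriv₂_le hw x) (norm_nonneg _) C.2
  linarith

/-- Rademacher's theorem. The derivative is additive only where both functions are differentiable,
so bilinearity of the energy form rests on this. -/
lemma ae_differentiableAt_slices {C : ℝ≥0} {v : ℝ × ℝ → ℝ} (hv : LipschitzWith C v) :
    ∀ᵐ x : ℝ × ℝ, DifferentiableAt ℝ (fun t => v (t, x.2)) x.1 ∧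
      DifferentiableAt ℝ (fun t => v (x.1, t)) x.2 := by
  filter_upwards [hv.ae_differentiableAt (μ := volume)] with x hx
  exact ⟨hx.comp x.1 (g := v) (f := fun t => (t, x.2)) (by fun_prop),
    hx.comp x.2 (g := v) (f := fun t => (x.1, t)) (by fun_prop)⟩

lemma gradDot_comm (v w : ℝ × ℝ → ℝ) (x : ℝ × ℝ) : gradDot v w x = gradDot w v x := by
  simp only [gradDot_eq]; ring

lemma ae_gradDot_add {C D : ℝ≥0} {v v' : ℝ × ℝ → ℝ} (hv : LipschitzWith C v)
    (hv' : LipschitzWith D v') (w : ℝ × ℝ → ℝ) :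
    ∀ᵐ x : ℝ × ℝ, gradDot (v + v') w x = gradDot v w x + gradDot v' w x := by
  filter_upwards [ae_differentiableAt_slices hv, ae_differentiableAt_slices hv'] with x h h'
  have h1 : deriv₁ (v + v') x = deriv₁ v x + deriv₁ v' x := deriv_fun_add h.1 h'.1
  have h2 : deriv₂ (v + v') x = deriv₂ v x + deriv₂ v' x := deriv_fun_add h.2 h'.2
  simp only [gradDot_eq, h1, h2]
  ring

lemma gradDot_smul (c : ℝ) (v w : ℝ × ℝ → ℝ) (x : ℝ × ℝ) :
    gradDot (c • v) w x = c * gradDot v w x := by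
  have h1 : deriv₁ (c • v) x = c * deriv₁ v x := deriv_const_mul_field c
  have h2 : deriv₂ (c • v) x = c * deriv₂ v x := deriv_const_mul_field c
  simp only [gradDot_eq, h1, h2]
  ring

/-- A weight on a measurable subset of the closed unit square with values in `[1, β]`. -/
structure IsWeight (κ : ℝ × ℝ → ℝ) (β : ℝ) (S : Set (ℝ × ℝ)) : Prop where
  measurable : Measurable κ
  measurableSet : MeasurableSet S
  subset : S ⊆ Set.Icc 0 1
  bounds : ∀ᵐ x ∂(volume.restrict S), 1 ≤ κ x ∧ κ x ≤ β

namespace IsWeight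

variable {κ : ℝ × ℝ → ℝ} {β : ℝ} {S : Set (ℝ × ℝ)}

lemma isFiniteMeasure (h : IsWeight κ β S) : IsFiniteMeasure (volume.restrict S) :=
  ⟨by
    rw [Measure.restrict_apply_univ]
    exact (measure_mono h.subset).trans_lt isCompact_Icc.measure_lt_top⟩

lemma integrable_mul (h : IsWeight κ β S) {g : ℝ × ℝ → ℝ}
    (hg : AEStronglyMeasurable g (volume.restrict S)) {C : ℝ} (hC : ∀ x ∈ S, ‖g x‖ ≤ C) :
    Integrable (fun x => κ x * g x) (volume.restrict S) := by
  have := h.isFiniteMeasure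
  refine Integrable.of_bound (h.measurable.aestronglyMeasurable.mul hg) (β * C) ?_
  filter_upwards [h.bounds, ae_restrict_mem h.measurableSet] with x hx hxS
  rw [norm_mul, Real.norm_eq_abs, abs_of_nonneg (by linarith)]
  exact mul_le_mul hx.2 (hC x hxS) (norm_nonneg _) (by linarith)

lemma integrable_gradDot (h : IsWeight κ β S) {v w : ℝ × ℝ → ℝ} (hv : v ∈ lipSpace)
    (hw : w ∈ lipSpace) : Integrable (fun x => κ x * gradDot v w x) (volume.restrict S) := by
  obtain ⟨C, hv⟩ := hv
  obtain ⟨D, hw⟩ := hw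
  exact h.integrable_mul (measurable_gradDot hv.continuous hw.continuous).aestronglyMeasurable
    fun x _ => norm_gradDot_le hv hw x

lemma integrable_of_continuous (h : IsWeight κ β S) {g : ℝ × ℝ → ℝ} (hg : Continuous g) :
    Integrable (fun x => κ x * g x) (volume.restrict S) := by
  obtain ⟨C, hC⟩ := isCompact_Icc.exists_bound_of_continuousOn
    (s := Set.Icc (0 : ℝ × ℝ) 1) hg.continuousOn
  exact h.integrable_mul hg.aestronglyMeasurable fun x hx => hC x (h.subset hx)

/-- The form `∫_S κ ∇v · ∇w` on Lipschitz functions. -/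
def energyForm (h : IsWeight κ β S) : LinearMap.BilinForm ℝ lipSpace :=
  LinearMap.mk₂ ℝ (fun v w => energyOn κ S v w)
    (fun v v' w => by
      rw [energyOn, energyOn, energyOn, ← integral_add (h.integrable_gradDot v.2 w.2)
        (h.integrable_gradDot v'.2 w.2)]
      obtain ⟨C, hv⟩ := v.2
      obtain ⟨D, hv'⟩ := v'.2
      refine integral_congr_ae (ae_restrict_of_ae ?_)
      filter_upwards [ae_gradDot_add hv hv' w] with x hx
      rw [Submodule.coe_add, hx, mul_add])
    (fun c v w => by
      rw [energyOn, energyOn, smul_eq_mul, ← integral_const_mul]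
      refine integral_congr_ae (Filter.Eventually.of_forall fun x => ?_)
      simp only [Submodule.coe_smul, gradDot_smul]
      ring)
    (fun v w w' => by
      rw [energyOn, energyOn, energyOn, ← integral_add (h.integrable_gradDot v.2 w.2)
        (h.integrable_gradDot v.2 w'.2)]
      obtain ⟨C, hw⟩ := w.2
      obtain ⟨D, hw'⟩ := w'.2
      refine integral_congr_ae (ae_restrict_of_ae ?_)
      filter_upwards [ae_gradDot_add hw hw' v] with x hx
      rw [Submodule.coe_add, gradDot_comm, hx, gradDot_comm v, gradDot_comm v, mul_add])
    (fun c v w => by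
      rw [energyOn, energyOn, smul_eq_mul, ← integral_const_mul]
      refine integral_congr_ae (Filter.Eventually.of_forall fun x => ?_)
      simp only [Submodule.coe_smul]
      rw [gradDot_comm, gradDot_smul, gradDot_comm]
      ring)

@[simp] lemma energyForm_apply (h : IsWeight κ β S) (v w : lipSpace) :
    h.energyForm v w = energyOn κ S v w := rfl

lemma _root_.MSFEM.energyOn_comm (κ : ℝ × ℝ → ℝ) (S : Set (ℝ × ℝ)) (v w : ℝ × ℝ → ℝ) :
    energyOn κ S v w = energyOn κ S w v := by
  simp only [energyOn, gradDot_comm v w]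

lemma continuous_coe (v : lipSpace) : Continuous (v : ℝ × ℝ → ℝ) := by
  obtain ⟨C, hv⟩ := v.2
  exact hv.continuous

lemma integrable_coe_mul (h : IsWeight κ β S) (v w : lipSpace) :
    Integrable (fun x => κ x * ((v : ℝ × ℝ → ℝ) x * (w : ℝ × ℝ → ℝ) x)) (volume.restrict S) :=
  h.integrable_of_continuous ((continuous_coe v).mul (continuous_coe w))

/-- The form `∫_S κ v w` on Lipschitz functions. -/
def massForm (h : IsWeight κ β S) : LinearMap.BilinForm ℝ lipSpace :=
  LinearMap.mk₂ ℝ (fun v w => ∫ x in S, κ x * ((v : ℝ × ℝ → ℝ) x * (w : ℝ × ℝ → ℝ) x))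
    (fun v v' w => by
      rw [← integral_add (h.integrable_coe_mul v w) (h.integrable_coe_mul v' w)]
      refine integral_congr_ae (Filter.Eventually.of_forall fun x => ?_)
      simp only [Submodule.coe_add, Pi.add_apply]
      ring)
    (fun c v w => by
      rw [smul_eq_mul, ← integral_const_mul]
      refine integral_congr_ae (Filter.Eventually.of_forall fun x => ?_)
      simp only [Submodule.coe_smul, Pi.smul_apply, smul_eq_mul]
      ring)
    (fun v w w' => by
      rw [← integral_add (h.integrable_coe_mul v w) (h.integrable_coe_mul v w')]
      refine integral_congr_ae (Filter.Eventually.of_forall fun x => ?_)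
      simp only [Submodule.coe_add, Pi.add_apply]
      ring)
    (fun c v w => by
      rw [smul_eq_mul, ← integral_const_mul]
      refine integral_congr_ae (Filter.Eventually.of_forall fun x => ?_)
      simp only [Submodule.coe_smul, Pi.smul_apply, smul_eq_mul]
      ring)

@[simp] lemma massForm_apply (h : IsWeight κ β S) (v w : lipSpace) :
    h.massForm v w = ∫ x in S, κ x * ((v : ℝ × ℝ → ℝ) x * (w : ℝ × ℝ → ℝ) x) := rfl

lemma one (h : IsWeight κ β S) : IsWeight (fun _ => 1) 1 S :=
  ⟨measurable_const, h.measurableSet, h.subset, by simp⟩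

/-- The form with the coefficient one is bounded by the one with the coefficient `κ`. -/
lemma energyForm_one_le (h : IsWeight κ β S) (v : lipSpace) :
    h.one.energyForm v v ≤ h.energyForm v v := by
  simp only [energyForm_apply, energyOn]
  refine integral_mono_ae (h.one.integrable_gradDot v.2 v.2) (h.integrable_gradDot v.2 v.2) ?_
  filter_upwards [h.bounds] with x hx
  refine mul_le_mul_of_nonneg_right hx.1 ?_
  rw [gradDot_self]
  positivity

lemma massForm_one_le (h : IsWeight κ β S) (v : lipSpace) :
    h.one.massForm v v ≤ h.massForm v v := by
  simp only [massForm_apply]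
  refine integral_mono_ae (h.one.integrable_coe_mul v v) (h.integrable_coe_mul v v) ?_
  filter_upwards [h.bounds] with x hx
  exact mul_le_mul_of_nonneg_right hx.1 (mul_self_nonneg _)

lemma massForm_le_mul (h : IsWeight κ β S) (v : lipSpace) :
    h.massForm v v ≤ β * h.one.massForm v v := by
  simp only [massForm_apply]
  rw [← integral_const_mul]
  refine integral_mono_ae (h.integrable_coe_mul v v) ((h.one.integrable_coe_mul v v).const_mul β) ?_
  filter_upwards [h.bounds] with x hx
  simp only [one_mul]
  exact mul_le_mul_of_nonneg_right hx.2 (mul_self_nonneg _)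

lemma energyForm_nonneg (h : IsWeight κ β S) (v : lipSpace) : 0 ≤ h.energyForm v v := by
  refine le_trans ?_ (h.energyForm_one_le v)
  simp only [energyForm_apply, energyOn, one_mul, gradDot_self]
  exact integral_nonneg fun x => by positivity

lemma massForm_nonneg (h : IsWeight κ β S) (v : lipSpace) : 0 ≤ h.massForm v v := by
  refine le_trans ?_ (h.massForm_one_le v)
  simp only [massForm_apply, one_mul]
  exact integral_nonneg fun x => mul_self_nonneg _

lemma energyForm_comm (h : IsWeight κ β S) (v w : lipSpace) :
    h.energyForm v w = h.energyForm w v := energyOn_comm κ S v w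

lemma massForm_comm (h : IsWeight κ β S) (v w : lipSpace) :
    h.massForm v w = h.massForm w v := by
  simp only [massForm_apply, mul_comm ((v : ℝ × ℝ → ℝ) _)]

end IsWeight

end Plane

/-! ### Poincaré inequalities on rectangles -/

section Rectangle

open scoped NNReal Topology

variable {v : ℝ × ℝ → ℝ} {C : ℝ≥0} {a b c d : ℝ}

lemma integral_Icc_eq_intervalIntegral (hcd : c ≤ d) (f : ℝ → ℝ) :
    ∫ y in Set.Icc c d, f y = ∫ y in c..d, f y := by
  rw [integral_Icc_eq_integral_Ioc, intervalIntegral.integral_of_le hcd]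

lemma restrict_rect (a b c d : ℝ) :
    (volume : Measure (ℝ × ℝ)).restrict (Set.Icc a b ×ˢ Set.Icc c d) =
      (volume.restrict (Set.Icc a b)).prod (volume.restrict (Set.Icc c d)) :=
  (Measure.prod_restrict _ _).symm

lemma integrable_rect_of_continuous {g : ℝ × ℝ → ℝ} (hg : Continuous g) :
    IntegrableOn g (Set.Icc a b ×ˢ Set.Icc c d) :=
  hg.continuousOn.integrableOn_compact (isCompact_Icc.prod isCompact_Icc)

lemma isFiniteMeasure_rect (a b c d : ℝ) :
    IsFiniteMeasure ((volume : Measure (ℝ × ℝ)).restrict (Set.Icc a b ×ˢ Set.Icc c d)) := by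
  rw [restrict_rect]
  infer_instance

lemma integrable_deriv₁_sq (hv : LipschitzWith C v) :
    IntegrableOn (fun x => deriv₁ v x ^ 2) (Set.Icc a b ×ˢ Set.Icc c d) := by
  have := isFiniteMeasure_rect a b c d
  refine Integrable.of_bound ((measurable_deriv₁ hv.continuous).pow_const 2).aestronglyMeasurable
    ((C : ℝ) ^ 2) (Filter.Eventually.of_forall fun x => ?_)
  rw [norm_pow]
  exact pow_le_pow_left₀ (norm_nonneg _) (norm_deriv₁_le hv x) 2

lemma integrable_deriv₂_sq (hv : LipschitzWith C v) :
    IntegrableOn (fun x => deriv₂ v x ^ 2) (Set.Icc a b ×ˢ Set.Icc c d) := by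
  have := isFiniteMeasure_rect a b c d
  refine Integrable.of_bound ((measurable_deriv₂ hv.continuous).pow_const 2).aestronglyMeasurable
    ((C : ℝ) ^ 2) (Filter.Eventually.of_forall fun x => ?_)
  rw [norm_pow]
  exact pow_le_pow_left₀ (norm_nonneg _) (norm_deriv₂_le hv x) 2

lemma setIntegral_rect {g : ℝ × ℝ → ℝ} (hg : IntegrableOn g (Set.Icc a b ×ˢ Set.Icc c d)) :
    ∫ x in Set.Icc a b ×ˢ Set.Icc c d, g x =
      ∫ x in Set.Icc a b, ∫ y in Set.Icc c d, g (x, y) :=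
  setIntegral_prod g hg

lemma integrable_slice_integral {g : ℝ × ℝ → ℝ}
    (hg : IntegrableOn g (Set.Icc a b ×ˢ Set.Icc c d)) :
    IntegrableOn (fun x => ∫ y in Set.Icc c d, g (x, y)) (Set.Icc a b) := by
  rw [IntegrableOn, restrict_rect] at hg
  exact hg.integral_prod_left

/-- The Poincaré inequality for functions that vanish on one of the horizontal sides. -/
lemma poincare_rect₂ (hcd : c < d) (hv : LipschitzWith C v)
    (h0 : (∀ x, v (x, c) = 0) ∨ ∀ x, v (x, d) = 0) :
    ∫ x in Set.Icc a b ×ˢ Set.Icc c d, v x ^ 2 ≤ 4 * (d - c) ^ 2 / Real.pi ^ 2 *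
      ∫ x in Set.Icc a b ×ˢ Set.Icc c d, deriv₂ v x ^ 2 := by
  have hi1 : IntegrableOn (fun x => v x ^ 2) (Set.Icc a b ×ˢ Set.Icc c d) :=
    integrable_rect_of_continuous (hv.continuous.pow 2)
  have hi2 := integrable_deriv₂_sq (a := a) (b := b) (c := c) (d := d) hv
  rw [setIntegral_rect hi1, setIntegral_rect hi2, ← integral_const_mul]
  refine integral_mono (integrable_slice_integral hi1)
    ((integrable_slice_integral hi2).const_mul _) fun x => ?_
  simp only [integral_Icc_eq_intervalIntegral hcd.le]
  rcases h0 with h0 | h0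
  · exact poincare_left hcd (lipschitzWith_snd_slice hv x) (h0 x)
  · exact poincare_right hcd (lipschitzWith_snd_slice hv x) (h0 x)

lemma lipschitzWith_swap (hv : LipschitzWith C v) : LipschitzWith C (fun x : ℝ × ℝ => v x.swap) := by
  refine LipschitzWith.of_dist_le_mul fun x y => (hv.dist_le_mul _ _).trans_eq ?_
  simp only [Prod.dist_eq, Prod.fst_swap, Prod.snd_swap, max_comm]

/-- The Poincaré inequality for functions that vanish on one of the vertical sides. -/
lemma poincare_rect₁ (hab : a < b) (hv : LipschitzWith C v)
    (h0 : (∀ y, v (a, y) = 0) ∨ ∀ y, v (b, y) = 0) :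
    ∫ x in Set.Icc a b ×ˢ Set.Icc c d, v x ^ 2 ≤ 4 * (b - a) ^ 2 / Real.pi ^ 2 *
      ∫ x in Set.Icc a b ×ˢ Set.Icc c d, deriv₁ v x ^ 2 := by
  have h := poincare_rect₂ (a := c) (b := d) hab (lipschitzWith_swap hv) h0
  have h1 := setIntegral_prod_swap (μ := (volume : Measure ℝ)) (ν := (volume : Measure ℝ))
    (Set.Icc a b) (Set.Icc c d) (fun x => v x ^ 2)
  have h2 := setIntegral_prod_swap (μ := (volume : Measure ℝ)) (ν := (volume : Measure ℝ))
    (Set.Icc a b) (Set.Icc c d) (fun x => deriv₁ v x ^ 2)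
  rw [← Measure.volume_eq_prod] at h1 h2
  rw [← h1, ← h2]
  exact h

/-- The Poincaré inequality for functions with mean value zero. -/
lemma poincare_rect_mean {H : ℝ} (hH : 0 < H) (hab : b - a = H) (hcd : d - c = H)
    (hv : LipschitzWith C v) (h0 : ∫ x in Set.Icc a b ×ˢ Set.Icc c d, v x = 0) :
    ∫ x in Set.Icc a b ×ˢ Set.Icc c d, v x ^ 2 ≤ 4 * H ^ 2 / Real.pi ^ 2 *
      ∫ x in Set.Icc a b ×ˢ Set.Icc c d, (deriv₁ v x ^ 2 + deriv₂ v x ^ 2) := by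
  have hab' : a < b := by linarith
  have hcd' : c < d := by linarith
  set g : ℝ → ℝ := fun x => ∫ y in Set.Icc c d, v (x, y) with hg
  have hi0 : IntegrableOn v (Set.Icc a b ×ˢ Set.Icc c d) :=
    integrable_rect_of_continuous hv.continuous
  have hi1 : IntegrableOn (fun x => v x ^ 2) (Set.Icc a b ×ˢ Set.Icc c d) :=
    integrable_rect_of_continuous (hv.continuous.pow 2)
  have hi2 := integrable_deriv₂_sq (a := a) (b := b) (c := c) (d := d) hv
  have hi3 := integrable_deriv₁_sq (a := a) (b := b) (c := c) (d := d) hv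
  have hslice : ∀ x, Integrable (fun y => v (x, y)) (volume.restrict (Set.Icc c d)) := fun x =>
    (lipschitzWith_snd_slice hv x).continuous.continuousOn.integrableOn_compact isCompact_Icc
  have hgl : LipschitzWith (C * H.toNNReal) g := by
    refine LipschitzWith.of_dist_le_mul fun x x' => ?_
    rw [hg, dist_eq_norm, ← integral_sub (hslice x) (hslice x')]
    refine (norm_setIntegral_le_of_norm_le_const (C := C * dist x x')
      isCompact_Icc.measure_lt_top fun y _ => ?_).trans_eq ?_
    · rw [← dist_eq_norm]
      exact (lipschitzWith_fst_slice hv y).dist_le_mul x x'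
    · rw [Real.volume_real_Icc_of_le hcd'.le, hcd, NNReal.coe_mul, Real.coe_toNNReal _ hH.le]
      ring
  have hg0 : ∫ x in a..b, g x = 0 := by
    rw [← integral_Icc_eq_intervalIntegral hab'.le, ← setIntegral_rect hi0, h0]
  have hgi : Integrable (fun x => g x ^ 2) (volume.restrict (Set.Icc a b)) :=
    (hgl.continuous.pow 2).continuousOn.integrableOn_compact isCompact_Icc
  -- Differentiation under the integral sign, dominated by the Lipschitz constant. By Fubini the
  -- required differentiability holds for almost every `y`, for almost every `x`.
  have hg' : ∀ᵐ x : ℝ, deriv g x = ∫ y in Set.Icc c d, deriv₁ v (x, y) := by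
    have hae := ae_differentiableAt_slices hv
    rw [Measure.volume_eq_prod] at hae
    filter_upwards [Measure.ae_ae_of_ae_prod hae] with x hx
    refine HasDerivAt.deriv (hasDerivAt_integral_of_dominated_loc_of_lip (F := fun x y => v (x, y))
      (bound := fun _ => (C : ℝ)) Filter.univ_mem
      (Filter.Eventually.of_forall fun x => (hslice x).aestronglyMeasurable) (hslice x)
      ?_ ?_ (integrable_const _) ?_).2
    · exact ((measurable_deriv₁ hv.continuous).comp measurable_prodMk_left).aestronglyMeasurable
    · refine Filter.Eventually.of_forall fun y => ?_
      simpa using (lipschitzWith_fst_slice hv y)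
    · filter_upwards [ae_restrict_of_ae hx] with y hy
      exact hy.1.hasDerivAt
  -- On vertical slices the inequality leaves the squared slice integrals `g² / H`. The function `g`
  -- has mean value zero, so a second one-dimensional inequality bounds it by `g'`, and
  -- Cauchy-Schwarz in `g'² ≤ H ∫ (∂₁ v)²` cancels the factor `H⁻¹`. Both directions end up with the
  -- same constant.
  have hstep1 : ∫ x in Set.Icc a b ×ˢ Set.Icc c d, v x ^ 2 ≤
      H⁻¹ * (∫ x in Set.Icc a b, g x ^ 2) + 4 * H ^ 2 / Real.pi ^ 2 *
        ∫ x in Set.Icc a b ×ˢ Set.Icc c d, deriv₂ v x ^ 2 := by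
    rw [setIntegral_rect hi1, setIntegral_rect hi2, ← integral_const_mul, ← integral_const_mul,
      ← integral_add (hgi.const_mul _) ((integrable_slice_integral hi2).const_mul _)]
    refine integral_mono (integrable_slice_integral hi1)
      ((hgi.const_mul _).add ((integrable_slice_integral hi2).const_mul _)) fun x => ?_
    simp only [hg, integral_Icc_eq_intervalIntegral hcd'.le]
    have := poincare_mean hcd' (lipschitzWith_snd_slice hv x)
    rw [hcd] at this
    exact this
  have hstep2 : ∫ x in Set.Icc a b, g x ^ 2 ≤
      4 * H ^ 2 / Real.pi ^ 2 * ∫ x in Set.Icc a b, deriv g x ^ 2 := by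
    rw [integral_Icc_eq_intervalIntegral hab'.le, integral_Icc_eq_intervalIntegral hab'.le]
    have := poincare_mean hab' hgl
    rw [hab, hg0] at this
    simpa using this
  have hstep3 : ∫ x in Set.Icc a b, deriv g x ^ 2 ≤
      H * ∫ x in Set.Icc a b ×ˢ Set.Icc c d, deriv₁ v x ^ 2 := by
    rw [setIntegral_rect hi3, ← integral_const_mul]
    have hgd : Integrable (fun x => deriv g x ^ 2) (volume.restrict (Set.Icc a b)) := by
      have := hgl.intervalIntegrable_deriv_sq a b
      rwa [intervalIntegrable_iff_integrableOn_Icc_of_le hab'.le] at this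
    refine integral_mono_ae hgd ((integrable_slice_integral hi3).const_mul _) ?_
    filter_upwards [ae_restrict_of_ae hg'] with x hx
    rw [hx]
    have hm : Measurable (fun y => deriv₁ v (x, y)) :=
      (measurable_deriv₁ hv.continuous).comp measurable_prodMk_left
    have hL : ∀ y, ‖deriv₁ v (x, y)‖ ≤ C := fun y => norm_deriv₁_le hv _
    have hint : Integrable (fun y => deriv₁ v (x, y)) (volume.restrict (Set.Icc c d)) :=
      Integrable.of_bound hm.aestronglyMeasurable C (Filter.Eventually.of_forall hL)
    have hint2 : Integrable (fun y => deriv₁ v (x, y) ^ 2) (volume.restrict (Set.Icc c d)) :=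
      Integrable.of_bound (hm.pow_const 2).aestronglyMeasurable ((C : ℝ) ^ 2)
        (Filter.Eventually.of_forall fun y => by
          rw [norm_pow]; exact pow_le_pow_left₀ (norm_nonneg _) (hL y) 2)
    set m := ∫ y in Set.Icc c d, deriv₁ v (x, y) with hm'
    -- Nonnegativity of the variance is the Cauchy-Schwarz inequality `m² ≤ H ∫ (∂₁ v)²` on the
    -- slice.
    have hsq : 0 ≤ ∫ y in Set.Icc c d, (deriv₁ v (x, y) - m / H) ^ 2 :=
      integral_nonneg fun y => sq_nonneg _
    have hex : ∫ y in Set.Icc c d, (deriv₁ v (x, y) - m / H) ^ 2 =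
        (∫ y in Set.Icc c d, deriv₁ v (x, y) ^ 2) - 2 * (m / H) * m + H * (m / H) ^ 2 := by
      have : ∀ y, (deriv₁ v (x, y) - m / H) ^ 2 =
          deriv₁ v (x, y) ^ 2 - 2 * (m / H) * deriv₁ v (x, y) + (m / H) ^ 2 := fun y => by ring
      simp only [this]
      rw [integral_add (f := fun y => deriv₁ v (x, y) ^ 2 - 2 * (m / H) * deriv₁ v (x, y))
        (hint2.sub (hint.const_mul _)) (integrable_const _),
        integral_sub hint2 (hint.const_mul _), integral_const_mul, ← hm']
      simp [Real.volume_real_Icc_of_le hcd'.le, hcd]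
    rw [hex] at hsq
    have h5 : (∫ y in Set.Icc c d, deriv₁ v (x, y) ^ 2) - 2 * (m / H) * m + H * (m / H) ^ 2 =
        (∫ y in Set.Icc c d, deriv₁ v (x, y) ^ 2) - m ^ 2 / H := by field_simp; ring
    rw [h5, sub_nonneg, div_le_iff₀ hH] at hsq
    linarith
  have hpi := Real.pi_pos
  rw [integral_add hi3 hi2, mul_add]
  have h6 : H⁻¹ * (∫ x in Set.Icc a b, g x ^ 2) ≤ 4 * H ^ 2 / Real.pi ^ 2 *
      ∫ x in Set.Icc a b ×ˢ Set.Icc c d, deriv₁ v x ^ 2 := by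
    rw [inv_mul_le_iff₀ hH]
    refine hstep2.trans ?_
    have : 0 ≤ 4 * H ^ 2 / Real.pi ^ 2 := by positivity
    nlinarith [mul_le_mul_of_nonneg_left hstep3 this]
  linarith

end Rectangle

/-! ### The nodal basis -/

/-- The one-dimensional hat function with the peak `m / n`. -/
def hatFactor (n : ℕ) (m t : ℝ) : ℝ := max 0 (1 - |(n : ℝ) * t - m|)

lemma hat_apply {N r : ℕ} (p : Node N r) (x : ℝ × ℝ) :
    hat p x = hatFactor (N * r) (p.1 + 1) x.1 * hatFactor (N * r) (p.2 + 1) x.2 := rfl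

lemma hatFactor_nonneg (n : ℕ) (m t : ℝ) : 0 ≤ hatFactor n m t := le_max_left _ _

lemma hatFactor_le_one (n : ℕ) (m t : ℝ) : hatFactor n m t ≤ 1 :=
  max_le zero_le_one (by linarith [abs_nonneg ((n : ℝ) * t - m)])

lemma hatFactor_eq_zero {n : ℕ} {m t : ℝ} (h : 1 ≤ |(n : ℝ) * t - m|) : hatFactor n m t = 0 :=
  max_eq_left (by linarith)

lemma abs_lt_one_of_hatFactor_ne_zero {n : ℕ} {m t : ℝ} (h : hatFactor n m t ≠ 0) :
    |(n : ℝ) * t - m| < 1 := by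
  by_contra hcon
  exact h (hatFactor_eq_zero (not_lt.1 hcon))

lemma abs_hatFactor_sub_le (n : ℕ) (m s t : ℝ) :
    |hatFactor n m s - hatFactor n m t| ≤ n * |s - t| := by
  refine (abs_max_sub_max_le_max _ _ _ _).trans ?_
  rw [sub_self, abs_zero]
  refine max_le (by positivity) ?_
  have h1 : (1 - |(n : ℝ) * s - m|) - (1 - |(n : ℝ) * t - m|) =
      |(n : ℝ) * t - m| - |(n : ℝ) * s - m| := by ring
  rw [h1]
  refine (abs_abs_sub_abs_le_abs_sub _ _).trans ?_
  have h2 : (n : ℝ) * t - m - (n * s - m) = n * (t - s) := by ring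
  rw [h2, abs_mul, abs_of_nonneg (Nat.cast_nonneg n), abs_sub_comm]

/-- Hat functions with integer nodes are affine on the intervals of the mesh. -/
lemma exists_affine_hatFactor {n : ℕ} (hn : 0 < n) (m c : ℕ) :
    ∃ α γ : ℝ, ∀ t ∈ Set.Icc ((c : ℝ) / n) (((c : ℝ) + 1) / n),
      hatFactor n m t = α + γ * t := by
  have hn' : (0 : ℝ) < n := by exact_mod_cast hn
  have key : ∀ t ∈ Set.Icc ((c : ℝ) / n) (((c : ℝ) + 1) / n),
      (c : ℝ) ≤ n * t ∧ n * t ≤ c + 1 := by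
    intro t ht
    have h1 := (div_le_iff₀ hn').1 ht.1
    have h2 := (le_div_iff₀ hn').1 ht.2
    constructor <;> linarith
  rcases lt_trichotomy m c with h | h | h
  · refine ⟨0, 0, fun t ht => ?_⟩
    have h1 : (m : ℝ) + 1 ≤ c := by exact_mod_cast h
    have := key t ht
    rw [hatFactor_eq_zero (le_abs.2 (Or.inl (by linarith)))]
    ring
  · refine ⟨1 + c, -n, fun t ht => ?_⟩
    have := key t ht
    rw [hatFactor, h, abs_of_nonneg (by linarith), max_eq_right (by linarith)]
    ring
  rcases (Nat.succ_le_of_lt h).eq_or_lt with h | h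
  · refine ⟨-c, n, fun t ht => ?_⟩
    have := key t ht
    have hm : (m : ℝ) = c + 1 := by rw [← h]; push_cast; ring
    rw [hatFactor, hm, abs_of_nonpos (by linarith), max_eq_right (by linarith)]
    ring
  · refine ⟨0, 0, fun t ht => ?_⟩
    have h1 : (c : ℝ) + 1 + 1 ≤ m := by exact_mod_cast h
    have := key t ht
    rw [hatFactor_eq_zero (le_abs.2 (Or.inr (by linarith)))]
    ring

lemma hatFactor_eq_zero_of_notMem {n m : ℕ} (hm : m + 1 < n) {t : ℝ} (ht : t ∉ Set.Ioo (0 : ℝ) 1) :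
    hatFactor n (m + 1) t = 0 := by
  apply hatFactor_eq_zero
  have hm' : (m : ℝ) + 2 ≤ n := by exact_mod_cast hm
  have hm0 : (0 : ℝ) ≤ m := Nat.cast_nonneg m
  rw [Set.mem_Ioo, not_and_or, not_lt, not_lt] at ht
  rcases ht with ht | ht
  · exact le_abs.2 (Or.inr (by nlinarith))
  · exact le_abs.2 (Or.inl (by nlinarith))

lemma lipschitz_prod_mem_lipSpace {f g : ℝ → ℝ} {n : ℕ}
    (hf : ∀ s t, |f s - f t| ≤ n * |s - t|) (hg : ∀ s t, |g s - g t| ≤ n * |s - t|)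
    (hf1 : ∀ t, |f t| ≤ 1) (hg1 : ∀ t, |g t| ≤ 1) :
    (fun x : ℝ × ℝ => f x.1 * g x.2) ∈ lipSpace := by
  refine ⟨2 * n, LipschitzWith.of_dist_le_mul fun x y => ?_⟩
  rw [Real.dist_eq, Prod.dist_eq, Real.dist_eq, Real.dist_eq]
  have h1 : f x.1 * g x.2 - f y.1 * g y.2 =
      (f x.1 - f y.1) * g x.2 + f y.1 * (g x.2 - g y.2) := by ring
  rw [h1]
  refine (abs_add_le _ _).trans ?_
  rw [abs_mul, abs_mul]
  have h2 : |f x.1 - f y.1| * |g x.2| ≤ n * max |x.1 - y.1| |x.2 - y.2| := by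
    refine (mul_le_of_le_one_right (abs_nonneg _) (hg1 _)).trans ((hf _ _).trans ?_)
    exact mul_le_mul_of_nonneg_left (le_max_left _ _) (Nat.cast_nonneg n)
  have h3 : |f y.1| * |g x.2 - g y.2| ≤ n * max |x.1 - y.1| |x.2 - y.2| := by
    refine (mul_le_of_le_one_left (abs_nonneg _) (hf1 _)).trans ((hg _ _).trans ?_)
    exact mul_le_mul_of_nonneg_left (le_max_right _ _) (Nat.cast_nonneg n)
  push_cast
  linarith

lemma hat_mem_lipSpace {N r : ℕ} (p : Node N r) : hat p ∈ lipSpace := by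
  have h1 : ∀ (m t : ℝ), |hatFactor (N * r) m t| ≤ 1 := fun m t => by
    rw [abs_of_nonneg (hatFactor_nonneg _ _ _)]
    exact hatFactor_le_one _ _ _
  exact lipschitz_prod_mem_lipSpace (abs_hatFactor_sub_le _ _) (abs_hatFactor_sub_le _ _)
    (h1 _) (h1 _)

lemma continuous_of_mem_lipSpace {v : ℝ × ℝ → ℝ} (hv : v ∈ lipSpace) : Continuous v :=
  hv.choose_spec.continuous

lemma hat_mem_Vh {N r : ℕ} (p : Node N r) : hat p ∈ Vh N r := by
  have hp1 := p.1.2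
  have hp2 := p.2.2
  refine ⟨continuous_of_mem_lipSpace (hat_mem_lipSpace p), fun x hx => ?_, fun c => ?_⟩
  · rw [hat_apply]
    have hx' : ¬ (x.1 ∈ Set.Ioo (0 : ℝ) 1 ∧ x.2 ∈ Set.Ioo (0 : ℝ) 1) := hx
    rcases not_and_or.1 hx' with h | h
    · rw [hatFactor_eq_zero_of_notMem (by omega) h, zero_mul]
    · rw [hatFactor_eq_zero_of_notMem (by omega) h, mul_zero]
  · obtain ⟨α, γ, h⟩ := exists_affine_hatFactor (n := N * r) (by omega) (p.1 + 1) c.1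
    obtain ⟨α', γ', h'⟩ := exists_affine_hatFactor (n := N * r) (by omega) (p.2 + 1) c.2
    refine ⟨α * α', γ * α', α * γ', γ * γ', fun x hx => ?_⟩
    have h1 := h x.1 hx.1
    have h2 := h' x.2 hx.2
    push_cast at h1 h2
    rw [hat_apply, h1, h2]
    ring

lemma hatFactor_node {n : ℕ} (hn : 0 < n) (i j : ℕ) :
    hatFactor n (i + 1) (((j : ℝ) + 1) / n) = if i = j then 1 else 0 := by
  have hn' : (n : ℝ) ≠ 0 := by exact_mod_cast hn.ne'
  rw [hatFactor, mul_div_cancel₀ _ hn']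
  split_ifs with h
  · simp [h]
  · rw [max_eq_left]
    have : (1 : ℝ) ≤ |(j : ℝ) + 1 - (i + 1)| := by
      have h1 : (1 : ℤ) ≤ |(j : ℤ) - i| := Int.one_le_abs (by omega)
      have h2 : ((1 : ℤ) : ℝ) ≤ ((|(j : ℤ) - i| : ℤ) : ℝ) := by exact_mod_cast h1
      push_cast at h2
      rwa [add_sub_add_right_eq_sub]
    linarith

lemma hat_nodePoint {N r : ℕ} (p q : Node N r) :
    hat p (nodePoint q) = if p = q then 1 else 0 := by
  have hp1 := p.1.2
  rw [hat_apply, nodePoint, hatFactor_node (by omega), hatFactor_node (by omega)]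
  simp only [Fin.val_inj, Prod.ext_iff]
  split_ifs <;> simp_all

lemma exists_mesh_interval {n : ℕ} (hn : 0 < n) {t : ℝ} (ht : t ∈ Set.Icc (0 : ℝ) 1) :
    ∃ c : Fin n, t ∈ Set.Icc ((c : ℝ) / n) (((c : ℝ) + 1) / n) := by
  have hn' : (0 : ℝ) < n := by exact_mod_cast hn
  -- At the right end point the floor would give the index `n`, which does not exist, so the last
  -- interval is taken.
  rcases ht.2.eq_or_lt with h | h
  · refine ⟨⟨n - 1, by omega⟩, ?_⟩
    simp only [Nat.cast_sub (Nat.one_le_of_lt hn), Nat.cast_one, h]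
    exact ⟨(div_le_one hn').2 (by linarith), (one_le_div hn').2 (by linarith)⟩
  · have h0 : 0 ≤ t * n := mul_nonneg ht.1 hn'.le
    refine ⟨⟨⌊t * n⌋₊, (Nat.floor_lt h0).2 (by nlinarith)⟩, ?_, ?_⟩
    · rw [div_le_iff₀ hn']; exact Nat.floor_le h0
    · rw [le_div_iff₀ hn']; exact (Nat.lt_floor_add_one _).le

lemma eq_zero_of_bilinear_corners {a b₁ b₂ d s₀ s₁ t₀ t₁ : ℝ} (hs : s₀ ≠ s₁) (ht : t₀ ≠ t₁)
    (h : ∀ s ∈ ({s₀, s₁} : Set ℝ), ∀ t ∈ ({t₀, t₁} : Set ℝ),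
      a + b₁ * s + b₂ * t + d * (s * t) = 0) :
    a = 0 ∧ b₁ = 0 ∧ b₂ = 0 ∧ d = 0 := by
  have h00 := h s₀ (by simp) t₀ (by simp)
  have h01 := h s₀ (by simp) t₁ (by simp)
  have h10 := h s₁ (by simp) t₀ (by simp)
  have h11 := h s₁ (by simp) t₁ (by simp)
  have hs' := sub_ne_zero.2 hs
  have ht' := sub_ne_zero.2 ht
  have hd : d = 0 := by
    have : d * ((s₀ - s₁) * (t₀ - t₁)) = 0 := by linear_combination h00 - h01 - h10 + h11
    exact (mul_eq_zero.1 this).resolve_right (mul_ne_zero hs' ht')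
  subst hd
  have hb₁ : b₁ = 0 := by
    have : b₁ * (s₀ - s₁) = 0 := by linear_combination h00 - h10
    exact (mul_eq_zero.1 this).resolve_right hs'
  have hb₂ : b₂ = 0 := by
    have : b₂ * (t₀ - t₁) = 0 := by linear_combination h00 - h01
    exact (mul_eq_zero.1 this).resolve_right ht'
  subst hb₁ hb₂
  exact ⟨by linarith, rfl, rfl, rfl⟩

/-- A finite element function that vanishes at the interior vertices is zero. -/
lemma eq_zero_of_nodal_eq_zero {N r : ℕ} (hn : 0 < N * r) {w : ℝ × ℝ → ℝ} (hw : w ∈ Vh N r)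
    (h0 : ∀ p : Node N r, w (nodePoint p) = 0) : w = 0 := by
  obtain ⟨-, hout, hcell⟩ := hw
  have hn' : (0 : ℝ) < (N * r : ℕ) := by exact_mod_cast hn
  -- All mesh points are covered: interior ones by hypothesis (node indices are shifted by one),
  -- those on the boundary because `w` vanishes outside `Omega`. On a cell the four corner values
  -- determine a bilinear function.
  have hcorner : ∀ i j : ℕ, i ≤ N * r → j ≤ N * r →
      w ((i : ℝ) / (N * r : ℕ), (j : ℝ) / (N * r : ℕ)) = 0 := by
    intro i j hi hj
    by_cases hij : (0 < i ∧ i < N * r) ∧ (0 < j ∧ j < N * r)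
    · have := h0 (⟨i - 1, by omega⟩, ⟨j - 1, by omega⟩)
      simpa only [nodePoint, Nat.cast_sub (show 1 ≤ i by omega),
        Nat.cast_sub (show 1 ≤ j by omega), Nat.cast_one, sub_add_cancel] using this
    · refine hout _ fun hmem => hij ?_
      obtain ⟨⟨h1, h2⟩, ⟨h3, h4⟩⟩ := hmem
      simp only at h1 h2 h3 h4
      rw [div_lt_one hn'] at h2 h4
      have h1' := (div_pos_iff_of_pos_right hn').1 h1
      have h3' := (div_pos_iff_of_pos_right hn').1 h3
      exact ⟨⟨by exact_mod_cast h1', by exact_mod_cast h2⟩,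
        ⟨by exact_mod_cast h3', by exact_mod_cast h4⟩⟩
  funext x
  by_cases hx : x ∈ Omega
  swap
  · exact hout x hx
  obtain ⟨c₁, hc₁⟩ := exists_mesh_interval hn (Set.Ioo_subset_Icc_self hx.1)
  obtain ⟨c₂, hc₂⟩ := exists_mesh_interval hn (Set.Ioo_subset_Icc_self hx.2)
  obtain ⟨a, b₁, b₂, d, h⟩ := hcell (c₁, c₂)
  have hlt : ∀ c : ℕ, (c : ℝ) / (N * r : ℕ) < ((c : ℝ) + 1) / (N * r : ℕ) := fun c =>
    div_lt_div_of_pos_right (by linarith) hn'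
  obtain ⟨rfl, rfl, rfl, rfl⟩ := eq_zero_of_bilinear_corners (a := a) (b₁ := b₁) (b₂ := b₂)
    (d := d) (hlt c₁).ne (hlt c₂).ne (by
      intro s hs t ht
      have hs' : s ∈ Set.Icc ((c₁ : ℝ) / (N * r : ℕ)) (((c₁ : ℝ) + 1) / (N * r : ℕ)) := by
        rcases hs with rfl | rfl
        exacts [⟨le_rfl, (hlt _).le⟩, ⟨(hlt _).le, le_rfl⟩]
      have ht' : t ∈ Set.Icc ((c₂ : ℝ) / (N * r : ℕ)) (((c₂ : ℝ) + 1) / (N * r : ℕ)) := by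
        rcases ht with rfl | rfl
        exacts [⟨le_rfl, (hlt _).le⟩, ⟨(hlt _).le, le_rfl⟩]
      rw [← h (s, t) ⟨hs', ht'⟩]
      have hs'' : ∃ i : ℕ, i ≤ N * r ∧ s = (i : ℝ) / (N * r : ℕ) := by
        rcases hs with rfl | rfl
        exacts [⟨c₁, by omega, rfl⟩, ⟨c₁ + 1, by omega, by push_cast; rfl⟩]
      have ht'' : ∃ i : ℕ, i ≤ N * r ∧ t = (i : ℝ) / (N * r : ℕ) := by
        rcases ht with rfl | rfl
        exacts [⟨c₂, by omega, rfl⟩, ⟨c₂ + 1, by omega, by push_cast; rfl⟩]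
      obtain ⟨i, hi, rfl⟩ := hs''
      obtain ⟨j, hj, rfl⟩ := ht''
      exact hcorner i j hi hj)
  rw [h x ⟨hc₁, hc₂⟩]
  simp

lemma femFunction_mem_Vh {N r : ℕ} (x : Node N r → ℝ) : femFunction x ∈ Vh N r :=
  Submodule.sum_mem _ fun p _ => Submodule.smul_mem _ _ (hat_mem_Vh p)

lemma femFunction_nodePoint {N r : ℕ} (x : Node N r → ℝ) (p : Node N r) :
    femFunction x (nodePoint p) = x p := by
  simp [femFunction, hat_nodePoint]

lemma nodalVector_femFunction {N r : ℕ} (x : Node N r → ℝ) : nodalVector (femFunction x) = x :=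
  funext (femFunction_nodePoint x)

/-- Finite element functions are represented by their nodal values. -/
lemma femFunction_nodalVector {N r : ℕ} (hn : 0 < N * r) {v : ℝ × ℝ → ℝ} (hv : v ∈ Vh N r) :
    femFunction (nodalVector (N := N) (r := r) v) = v := by
  have := eq_zero_of_nodal_eq_zero hn (Submodule.sub_mem _ (femFunction_mem_Vh (nodalVector v)) hv)
    (fun p => by simp [femFunction_nodePoint, nodalVector])
  exact sub_eq_zero.1 this

lemma femFunction_mem_lipSpace {N r : ℕ} (x : Node N r → ℝ) : femFunction x ∈ lipSpace :=
  Submodule.sum_mem _ fun p _ => Submodule.smul_mem _ _ (hat_mem_lipSpace p)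

/-- The Lipschitz function represented by a vector with respect to the nodal basis. -/
def femLip (N r : ℕ) : (Node N r → ℝ) →ₗ[ℝ] lipSpace where
  toFun x := ⟨femFunction x, femFunction_mem_lipSpace x⟩
  map_add' x y := Subtype.ext (by
    simp [femFunction, add_smul, Finset.sum_add_distrib])
  map_smul' c x := Subtype.ext (by
    simp [femFunction, Finset.smul_sum, mul_smul])

/-- The hat functions as Lipschitz functions. -/
def hatLip {N r : ℕ} (p : Node N r) : lipSpace := ⟨hat p, hat_mem_lipSpace p⟩

@[simp] lemma coe_hatLip {N r : ℕ} (p : Node N r) : (hatLip p : ℝ × ℝ → ℝ) = hat p := rfl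

lemma femLip_eq_sum {N r : ℕ} (x : Node N r → ℝ) : femLip N r x = ∑ p, x p • hatLip p :=
  Subtype.ext (by simp [femLip, femFunction])

@[simp] lemma coe_femLip {N r : ℕ} (x : Node N r → ℝ) :
    (femLip N r x : ℝ × ℝ → ℝ) = femFunction x := rfl

/-! ### The forms on the elements of the coarse mesh -/

lemma Icc_zero_one_eq : Set.Icc (0 : ℝ × ℝ) 1 = Set.Icc (0 : ℝ) 1 ×ˢ Set.Icc (0 : ℝ) 1 :=
  (Set.Icc_prod_Icc (0 : ℝ) 1 0 1).symm

lemma Omega_ae_eq : Omega =ᵐ[volume] Set.Icc (0 : ℝ × ℝ) 1 := by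
  rw [Icc_zero_one_eq]
  exact Measure.set_prod_ae_eq Ioo_ae_eq_Icc Ioo_ae_eq_Icc

lemma Omega_subset : Omega ⊆ Set.Icc (0 : ℝ × ℝ) 1 := by
  rw [Icc_zero_one_eq]
  exact Set.prod_mono Set.Ioo_subset_Icc_self Set.Ioo_subset_Icc_self

lemma measurableSet_Omega : MeasurableSet Omega := measurableSet_Ioo.prod measurableSet_Ioo

lemma measurableSet_cell (n : ℕ) (c : Fin n × Fin n) : MeasurableSet (cell n c) :=
  measurableSet_Icc.prod measurableSet_Icc

lemma mesh_interval_subset {n : ℕ} (c : Fin n) :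
    Set.Icc ((c : ℝ) / n) (((c : ℝ) + 1) / n) ⊆ Set.Icc 0 1 := by
  have hn : (0 : ℝ) < n := by exact_mod_cast c.pos
  have hc : (c : ℝ) + 1 ≤ n := by exact_mod_cast c.2
  exact Set.Icc_subset_Icc (by positivity) ((div_le_one hn).2 hc)

lemma cell_subset {n : ℕ} (c : Fin n × Fin n) : cell n c ⊆ Set.Icc 0 1 := by
  rw [Icc_zero_one_eq]
  exact Set.prod_mono (mesh_interval_subset c.1) (mesh_interval_subset c.2)

lemma iUnion_cell {n : ℕ} (hn : 0 < n) : ⋃ c, cell n c = Set.Icc 0 1 := by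
  refine Set.Subset.antisymm (Set.iUnion_subset cell_subset) fun x hx => ?_
  rw [Icc_zero_one_eq] at hx
  obtain ⟨c₁, h₁⟩ := exists_mesh_interval hn hx.1
  obtain ⟨c₂, h₂⟩ := exists_mesh_interval hn hx.2
  exact Set.mem_iUnion.2 ⟨(c₁, c₂), h₁, h₂⟩

lemma interior_cell (n : ℕ) (c : Fin n × Fin n) : interior (cell n c) =
    Set.Ioo ((c.1 : ℝ) / n) (((c.1 : ℝ) + 1) / n) ×ˢ
      Set.Ioo ((c.2 : ℝ) / n) (((c.2 : ℝ) + 1) / n) := by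
  rw [cell, interior_prod_eq, interior_Icc, interior_Icc]

lemma interior_cell_ae_eq (n : ℕ) (c : Fin n × Fin n) :
    interior (cell n c) =ᵐ[volume] cell n c := by
  rw [interior_cell]
  exact Measure.set_prod_ae_eq Ioo_ae_eq_Icc Ioo_ae_eq_Icc

lemma eq_of_mem_mesh_interval {n : ℕ} {c c' : Fin n} {t : ℝ}
    (h : t ∈ Set.Ioo ((c : ℝ) / n) (((c : ℝ) + 1) / n))
    (h' : t ∈ Set.Icc ((c' : ℝ) / n) (((c' : ℝ) + 1) / n)) : c = c' := by
  have hn : (0 : ℝ) < n := by exact_mod_cast c.pos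
  have h1 := (div_lt_div_iff_of_pos_right hn).1 (h.1.trans_le h'.2)
  have h2 := (div_lt_div_iff_of_pos_right hn).1 (h'.1.trans_lt h.2)
  have h3 : (c : ℕ) < c' + 1 := by exact_mod_cast h1
  have h4 : (c' : ℕ) < c + 1 := by exact_mod_cast h2
  exact Fin.ext (by omega)

lemma eq_of_mem_interior_cell {n : ℕ} {c c' : Fin n × Fin n} {x : ℝ × ℝ}
    (h : x ∈ interior (cell n c)) (h' : x ∈ cell n c') : c = c' := by
  rw [interior_cell] at h
  exact Prod.ext (eq_of_mem_mesh_interval h.1 h'.1) (eq_of_mem_mesh_interval h.2 h'.2)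

/-- Closed cells meet along edges, but each agrees almost everywhere with its interior, which no
other cell meets. -/
lemma aedisjoint_cell (n : ℕ) : Pairwise (Function.onFun (AEDisjoint volume) (cell n)) := by
  intro c c' hcc
  have : Disjoint (interior (cell n c)) (cell n c') :=
    Set.disjoint_left.2 fun x h h' => hcc (eq_of_mem_interior_cell h h')
  exact this.aedisjoint.congr (interior_cell_ae_eq n c).symm (Filter.EventuallyEq.refl _ _)

lemma setIntegral_Omega_eq_sum {n : ℕ} (hn : 0 < n) {g : ℝ × ℝ → ℝ}
    (hg : IntegrableOn g (Set.Icc 0 1)) :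
    ∫ x in Omega, g x = ∑ c, ∫ x in cell n c, g x := by
  rw [setIntegral_congr_set Omega_ae_eq, ← iUnion_cell hn, integral_iUnion_ae
    (fun c => (measurableSet_cell n c).nullMeasurableSet) (aedisjoint_cell n)
    (by rwa [iUnion_cell hn]), tsum_fintype]

section Weight

variable {κ : ℝ × ℝ → ℝ} {β : ℝ}

lemma isWeight_square (hκ : Measurable κ) (hb : ∀ x ∈ Omega, 1 ≤ κ x ∧ κ x ≤ β) :
    IsWeight κ β (Set.Icc 0 1) := by
  refine ⟨hκ, measurableSet_Icc, le_rfl, ?_⟩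
  rw [← Measure.restrict_congr_set Omega_ae_eq]
  filter_upwards [ae_restrict_mem measurableSet_Omega] with x hx using hb x hx

lemma IsWeight.mono {S T : Set (ℝ × ℝ)} (h : IsWeight κ β T) (hS : MeasurableSet S)
    (hST : S ⊆ T) : IsWeight κ β S :=
  ⟨h.measurable, hS, hST.trans h.subset, ae_restrict_of_ae_restrict_of_subset hST h.bounds⟩

lemma IsWeight.omega (h : IsWeight κ β (Set.Icc 0 1)) : IsWeight κ β Omega :=
  h.mono measurableSet_Omega Omega_subset

lemma IsWeight.cell (h : IsWeight κ β (Set.Icc 0 1)) {n : ℕ} (c : Fin n × Fin n) :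
    IsWeight κ β (cell n c) :=
  h.mono (measurableSet_cell n c) (cell_subset c)

lemma energyForm_omega_eq_sum (h : IsWeight κ β (Set.Icc 0 1)) {n : ℕ} (hn : 0 < n)
    (v w : lipSpace) : h.omega.energyForm v w = ∑ c : Fin n × Fin n, (h.cell c).energyForm v w :=
  setIntegral_Omega_eq_sum hn (h.integrable_gradDot v.2 w.2)

lemma massForm_omega_eq_sum (h : IsWeight κ β (Set.Icc 0 1)) {n : ℕ} (hn : 0 < n)
    (v w : lipSpace) : h.omega.massForm v w = ∑ c : Fin n × Fin n, (h.cell c).massForm v w :=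
  setIntegral_Omega_eq_sum hn (h.integrable_coe_mul v w)

/-- A continuous function with vanishing mass vanishes on the closure of the interior. -/
lemma IsWeight.eqOn_zero_of_massForm_eq_zero {n : ℕ} {c : Fin n × Fin n}
    (h : IsWeight κ β (MSFEM.cell n c)) {v : lipSpace} (h0 : h.massForm v v = 0) :
    Set.EqOn (v : ℝ × ℝ → ℝ) 0 (MSFEM.cell n c) := by
  have hv := continuous_of_mem_lipSpace v.2
  have h1 : h.one.massForm v v = 0 :=
    le_antisymm ((h.massForm_one_le v).trans h0.le) (h.one.massForm_nonneg v)
  simp only [IsWeight.massForm_apply, one_mul] at h1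
  have hint : IntegrableOn (fun x => (v : ℝ × ℝ → ℝ) x * (v : ℝ × ℝ → ℝ) x) (MSFEM.cell n c) := by
    simpa [IntegrableOn] using h.one.integrable_coe_mul v v
  rw [integral_eq_zero_iff_of_nonneg (fun x => mul_self_nonneg _) hint] at h1
  have h2 : (v : ℝ × ℝ → ℝ) =ᵐ[volume.restrict (interior (MSFEM.cell n c))] 0 := by
    rw [Measure.restrict_congr_set (interior_cell_ae_eq n c)]
    filter_upwards [h1] with x hx
    simpa using hx
  have h3 : Set.EqOn (v : ℝ × ℝ → ℝ) 0 (interior (MSFEM.cell n c)) :=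
    Measure.eqOn_open_of_ae_eq h2 isOpen_interior hv.continuousOn continuousOn_const
  have hn : (0 : ℝ) < n := by exact_mod_cast c.1.pos
  have hcl : MSFEM.cell n c ⊆ closure (interior (MSFEM.cell n c)) := by
    have hlt : ∀ a : ℕ, (a : ℝ) / n ≠ ((a : ℝ) + 1) / n := fun a =>
      (div_lt_div_of_pos_right (by linarith) hn).ne
    rw [interior_cell, closure_prod_eq, closure_Ioo (hlt _), closure_Ioo (hlt _)]
    rfl
  exact (h3.closure hv continuous_const).mono hcl

end Weight

/-- The elements of the coarse mesh that touch the boundary of the unit square. -/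
def IsBoundaryElem {N : ℕ} (i : Elem N) : Prop :=
  (i.1 : ℕ) = 0 ∨ (i.1 : ℕ) + 1 = N ∨ (i.2 : ℕ) = 0 ∨ (i.2 : ℕ) + 1 = N

lemma cell_side (N : ℕ) (m : ℝ) : (m + 1) / (N : ℝ) - m / N = coarseSize N := by
  rw [coarseSize]; ring

lemma coarseSize_pos {N : ℕ} (hN : 0 < N) : 0 < coarseSize N := by
  have : (0 : ℝ) < N := by exact_mod_cast hN
  exact one_div_pos.2 this

section Poincare

variable {N : ℕ} {i : Elem N} {κ : ℝ × ℝ → ℝ} {β : ℝ}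

/-- Such an element has a whole side on the boundary of the square, where `v` vanishes. The
inequality in the direction normal to this side suffices, and the other derivative only adds a
nonnegative term. -/
lemma poincare_boundary (h : IsWeight (fun _ => 1) 1 (cell N i)) (hi : IsBoundaryElem i)
    {v : lipSpace} (hv : ∀ x ∉ Omega, (v : ℝ × ℝ → ℝ) x = 0) :
    h.massForm v v ≤ 4 * coarseSize N ^ 2 / Real.pi ^ 2 * h.energyForm v v := by
  obtain ⟨C, hC⟩ := v.2
  have hN : (0 : ℝ) < N := by exact_mod_cast i.1.pos
  have hlt : ∀ a : ℕ, (a : ℝ) / N < ((a : ℝ) + 1) / N := fun a =>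
    (div_lt_div_of_pos_right (by linarith) hN)
  have h1 : h.massForm v v = ∫ x in cell N i, (v : ℝ × ℝ → ℝ) x ^ 2 := by
    simp only [IsWeight.massForm_apply, one_mul, sq]
  have h2 : h.energyForm v v =
      (∫ x in cell N i, deriv₁ v x ^ 2) + ∫ x in cell N i, deriv₂ v x ^ 2 := by
    simp only [IsWeight.energyForm_apply, energyOn, one_mul, gradDot_self]
    exact integral_add (integrable_deriv₁_sq hC) (integrable_deriv₂_sq hC)
  have h3 : 0 ≤ ∫ x in cell N i, deriv₁ v x ^ 2 := integral_nonneg fun x => sq_nonneg _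
  have h4 : 0 ≤ ∫ x in cell N i, deriv₂ v x ^ 2 := integral_nonneg fun x => sq_nonneg _
  have h5 : 0 ≤ 4 * coarseSize N ^ 2 / Real.pi ^ 2 := by positivity
  rw [h1, h2, mul_add]
  have hz : ∀ {x : ℝ × ℝ}, ¬ (x.1 ∈ Set.Ioo (0 : ℝ) 1 ∧ x.2 ∈ Set.Ioo (0 : ℝ) 1) →
    (v : ℝ × ℝ → ℝ) x = 0 := fun {x} hx => hv x hx
  have hone : ∀ a : ℕ, a + 1 = N → ((a : ℝ) + 1) / N = 1 := fun a ha => by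
    rw [← ha]; push_cast; exact div_self (by positivity)
  have hdir₁ : ((∀ y, (v : ℝ × ℝ → ℝ) ((i.1 : ℝ) / N, y) = 0) ∨
      ∀ y, (v : ℝ × ℝ → ℝ) (((i.1 : ℝ) + 1) / N, y) = 0) →
      ∫ x in cell N i, (v : ℝ × ℝ → ℝ) x ^ 2 ≤ 4 * coarseSize N ^ 2 / Real.pi ^ 2 *
        (∫ x in cell N i, deriv₁ v x ^ 2) := fun h0 => by
    have := poincare_rect₁ (c := (i.2 : ℝ) / N) (d := ((i.2 : ℝ) + 1) / N) (hlt i.1) hC h0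
    rwa [cell_side] at this
  have hdir₂ : ((∀ y, (v : ℝ × ℝ → ℝ) (y, (i.2 : ℝ) / N) = 0) ∨
      ∀ y, (v : ℝ × ℝ → ℝ) (y, ((i.2 : ℝ) + 1) / N) = 0) →
      ∫ x in cell N i, (v : ℝ × ℝ → ℝ) x ^ 2 ≤ 4 * coarseSize N ^ 2 / Real.pi ^ 2 *
        (∫ x in cell N i, deriv₂ v x ^ 2) := fun h0 => by
    have := poincare_rect₂ (a := (i.1 : ℝ) / N) (b := ((i.1 : ℝ) + 1) / N) (hlt i.2) hC h0
    rwa [cell_side] at this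
  have h6 := mul_nonneg h5 h3
  have h7 := mul_nonneg h5 h4
  rcases hi with hi | hi | hi | hi
  · have := hdir₁ (Or.inl fun y => hz (by simp [hi]))
    linarith
  · have := hdir₁ (Or.inr fun y => hz (by simp [hone _ hi]))
    linarith
  · have := hdir₂ (Or.inl fun y => hz (by simp [hi]))
    linarith
  · have := hdir₂ (Or.inr fun y => hz (by simp [hone _ hi]))
    linarith

lemma poincare_interior (h : IsWeight (fun _ => 1) 1 (cell N i)) {v : lipSpace}
    (hv : ∫ x in cell N i, (v : ℝ × ℝ → ℝ) x = 0) :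
    h.massForm v v ≤ 4 * coarseSize N ^ 2 / Real.pi ^ 2 * h.energyForm v v := by
  obtain ⟨C, hC⟩ := v.2
  have := poincare_rect_mean (coarseSize_pos i.1.pos) (cell_side N i.1) (cell_side N i.2) hC hv
  simp only [IsWeight.massForm_apply, IsWeight.energyForm_apply, energyOn, one_mul, gradDot_self,
    ← sq]
  exact this

end Poincare

/-! ### The Friedrichs inequality and definiteness of the stiffness matrix -/

section Global

variable {N r : ℕ} {κ : ℝ × ℝ → ℝ} {β : ℝ}

/-- The Friedrichs inequality on the unit square. -/
lemma massForm_one_le_energyForm (h : IsWeight κ β (Set.Icc 0 1)) {v : lipSpace}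
    (hv : ∀ x ∉ Omega, (v : ℝ × ℝ → ℝ) x = 0) :
    h.omega.one.massForm v v ≤ h.omega.energyForm v v := by
  refine le_trans ?_ (h.omega.energyForm_one_le v)
  -- The square is the only cell of the `1 × 1` mesh and touches the boundary, so the constant is `4
  -- / π² < 1`.
  have h1 := poincare_boundary (N := 1) (i := (0, 0)) (h.one.cell (0, 0)) (Or.inl rfl) hv
  have h2 : h.omega.one.massForm v v = (h.one.cell ((0, 0) : Elem 1)).massForm v v := by
    have := massForm_omega_eq_sum h.one zero_lt_one v v
    rwa [Fintype.sum_subsingleton _ ((0, 0) : Elem 1)] at this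
  have h3 : h.omega.one.energyForm v v = (h.one.cell ((0, 0) : Elem 1)).energyForm v v := by
    have := energyForm_omega_eq_sum h.one zero_lt_one v v
    rwa [Fintype.sum_subsingleton _ ((0, 0) : Elem 1)] at this
  rw [h2, h3]
  refine h1.trans (mul_le_of_le_one_left ((h.one.cell _).energyForm_nonneg v) ?_)
  have := Real.pi_gt_three
  simp only [coarseSize]
  rw [div_le_one (by positivity)]
  norm_num
  nlinarith

lemma energy_femFunction (h : IsWeight κ β (Set.Icc 0 1)) (x y : Node N r → ℝ) :
    energy κ (femFunction x) (femFunction y) = x ⬝ᵥ stiffness N r κ *ᵥ y := by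
  have h1 : energy κ (femFunction x) (femFunction y) =
      h.omega.energyForm (femLip N r x) (femLip N r y) := rfl
  rw [h1, femLip_eq_sum, femLip_eq_sum]
  simp only [map_sum, LinearMap.sum_apply, map_smul, LinearMap.smul_apply, smul_eq_mul,
    dotProduct, Matrix.mulVec, Finset.mul_sum]
  rw [Finset.sum_comm]
  refine Finset.sum_congr rfl fun p _ => Finset.sum_congr rfl fun q _ => ?_
  rw [IsWeight.energyForm_apply, stiffness, Matrix.of_apply, coe_hatLip, coe_hatLip, energy]
  ring

lemma femFunction_eq_zero_of_notMem (x : Node N r → ℝ) {y : ℝ × ℝ} (hy : y ∉ Omega) :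
    femFunction x y = 0 :=
  (femFunction_mem_Vh x).2.1 y hy

/-- By the Friedrichs inequality vanishing energy forces vanishing mass, hence a vanishing function
by continuity, and its nodal values are the coefficients. -/
lemma posDef_stiffness (h : IsWeight κ β (Set.Icc 0 1)) : (stiffness N r κ).PosDef := by
  refine Matrix.PosDef.of_dotProduct_mulVec_pos ?_ fun x hx => ?_
  · ext p q
    simp only [stiffness, Matrix.conjTranspose_apply, Matrix.of_apply, star_trivial, energy]
    exact energyOn_comm _ _ _ _
  · rw [star_trivial, ← energy_femFunction h]
    have h1 : energy κ (femFunction x) (femFunction x) =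
      h.omega.energyForm (femLip N r x) (femLip N r x) := rfl
    have h2 := h.omega.energyForm_nonneg (femLip N r x)
    rw [h1]
    refine lt_of_le_of_ne h2 fun h0 => hx ?_
    have h3 := massForm_one_le_energyForm h (v := femLip N r x)
      fun y hy => femFunction_eq_zero_of_notMem x hy
    have h4 : (h.one.cell ((0, 0) : Elem 1)).massForm (femLip N r x) (femLip N r x) = 0 := by
      have h5 := massForm_omega_eq_sum h.one zero_lt_one (femLip N r x) (femLip N r x)
      have h6 := h.omega.one.massForm_nonneg (femLip N r x)
      have h7 : h.one.omega.massForm (femLip N r x) (femLip N r x) = 0 :=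
        le_antisymm (h3.trans h0.symm.le) h6
      rw [h7, Fintype.sum_subsingleton _ ((0, 0) : Elem 1)] at h5
      exact h5.symm
    have h8 := IsWeight.eqOn_zero_of_massForm_eq_zero _ h4
    funext p
    rw [← femFunction_nodePoint x p]
    by_cases hp : nodePoint p ∈ Omega
    · refine h8 ?_
      have := Omega_subset hp
      rw [Icc_zero_one_eq] at this
      simpa [cell] using this
    · exact femFunction_eq_zero_of_notMem x hp

end Global

/-! ### The local eigenvalue problems -/

section Restriction

variable {N : ℕ} {i : Elem N} {κ : ℝ × ℝ → ℝ} {β : ℝ}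

lemma gradDot_congr_of_eventuallyEq {v v' w w' : ℝ × ℝ → ℝ} {x : ℝ × ℝ}
    (hv : v =ᶠ[nhds x] v') (hw : w =ᶠ[nhds x] w') : gradDot v w x = gradDot v' w' x := by
  have h1 : Filter.Tendsto (fun t => (t, x.2)) (nhds x.1) (nhds x) :=
    Continuous.tendsto' (by fun_prop) _ _ rfl
  have h2 : Filter.Tendsto (fun t => (x.1, t)) (nhds x.2) (nhds x) :=
    Continuous.tendsto' (by fun_prop) _ _ rfl
  have hd₁ : ∀ {f g : ℝ × ℝ → ℝ}, f =ᶠ[nhds x] g → deriv₁ f x = deriv₁ g x := fun h =>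
    Filter.EventuallyEq.deriv_eq (h1.eventually h)
  have hd₂ : ∀ {f g : ℝ × ℝ → ℝ}, f =ᶠ[nhds x] g → deriv₂ f x = deriv₂ g x := fun h =>
    Filter.EventuallyEq.deriv_eq (h2.eventually h)
  rw [gradDot_eq, gradDot_eq, hd₁ hv, hd₁ hw, hd₂ hv, hd₂ hw]

/-- The interior of the cell has full measure, and there derivatives depend only on values in the
cell. Thus the jump of an extension by zero across the boundary of the cell is invisible to the
form, and restrictions can be exchanged with global Lipschitz functions. -/
lemma localEnergy_congr {v v' w w' : ℝ × ℝ → ℝ} (hv : Set.EqOn v v' (cell N i))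
    (hw : Set.EqOn w w' (cell N i)) : localEnergy κ i v w = localEnergy κ i v' w' := by
  rw [localEnergy, localEnergy, energyOn, energyOn,
    ← setIntegral_congr_set (interior_cell_ae_eq N i),
    ← setIntegral_congr_set (interior_cell_ae_eq N i)]
  refine setIntegral_congr_fun isOpen_interior.measurableSet fun x hx => ?_
  have hev : cell N i ∈ nhds x := mem_interior_iff_mem_nhds.1 hx
  rw [gradDot_congr_of_eventuallyEq (Filter.eventuallyEq_of_mem hev hv)
    (Filter.eventuallyEq_of_mem hev hw)]

lemma localMass_congr {v v' w w' : ℝ × ℝ → ℝ} (hv : Set.EqOn v v' (cell N i))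
    (hw : Set.EqOn w w' (cell N i)) : localMass κ i v w = localMass κ i v' w' := by
  rw [localMass, localMass]
  congr 1
  refine setIntegral_congr_fun (measurableSet_cell N i) fun x hx => ?_
  rw [hv hx, hw hx]

lemma restrictTo_eqOn (S : Set (ℝ × ℝ)) (v : ℝ × ℝ → ℝ) : Set.EqOn (restrictTo S v) v S :=
  fun _ hx => Set.indicator_of_mem hx v

lemma restrictTo_eq_of_eqOn {S : Set (ℝ × ℝ)} {v w : ℝ × ℝ → ℝ} (h : Set.EqOn v w S) :
    restrictTo S v = restrictTo S w :=
  Set.indicator_congr h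

lemma localMass_coe (h : IsWeight κ β (cell N i)) (v w : lipSpace) :
    localMass κ i v w = (coarseSize N ^ 2)⁻¹ * h.massForm v w := rfl

lemma energyForm_congr (h : IsWeight κ β (cell N i)) {v v' w w' : lipSpace}
    (hv : Set.EqOn (v : ℝ × ℝ → ℝ) v' (cell N i)) (hw : Set.EqOn (w : ℝ × ℝ → ℝ) w' (cell N i)) :
    h.energyForm v w = h.energyForm v' w' := localEnergy_congr hv hw

lemma massForm_congr (h : IsWeight κ β (cell N i)) {v v' w w' : lipSpace}
    (hv : Set.EqOn (v : ℝ × ℝ → ℝ) v' (cell N i)) (hw : Set.EqOn (w : ℝ × ℝ → ℝ) w' (cell N i)) :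
    h.massForm v w = h.massForm v' w' := by
  have h1 := localMass_congr (κ := κ) hv hw
  rw [localMass_coe h, localMass_coe h] at h1
  have hpos := coarseSize_pos i.1.pos
  exact mul_left_cancel₀ (by positivity) h1

end Restriction

/-! ### A finite element function equal to one on an interior element -/

section Cutoff

/-- A piecewise affine function on the line that is one away from the end points of `(0, 1)`. -/
def plateau (n : ℕ) (t : ℝ) : ℝ := max 0 (min 1 (min ((n : ℝ) * t) (n - n * t)))

lemma exists_affine_plateau {n : ℕ} (hn : 3 ≤ n) (c : Fin n) :
    ∃ α γ : ℝ, ∀ t ∈ Set.Icc ((c : ℝ) / n) (((c : ℝ) + 1) / n), plateau n t = α + γ * t := by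
  have hn3 : (3 : ℝ) ≤ n := by exact_mod_cast hn
  have hn' : (0 : ℝ) < n := by linarith
  have key : ∀ t ∈ Set.Icc ((c : ℝ) / n) (((c : ℝ) + 1) / n),
      (c : ℝ) ≤ n * t ∧ n * t ≤ c + 1 := by
    intro t ht
    have h1 := (div_le_iff₀ hn').1 ht.1
    have h2 := (le_div_iff₀ hn').1 ht.2
    constructor <;> linarith
  rcases Nat.eq_zero_or_pos (c : ℕ) with h | h
  · refine ⟨0, n, fun t ht => ?_⟩
    have := key t ht
    rw [h] at this
    norm_num at this
    rw [plateau, min_eq_left (a := (n : ℝ) * t) (by linarith), min_eq_right (by linarith),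
      max_eq_right (by linarith)]
    ring
  have h1 : (1 : ℝ) ≤ (c : ℕ) := by exact_mod_cast h
  rcases (Nat.succ_le_of_lt c.2).eq_or_lt with h2 | h2
  · refine ⟨n, -n, fun t ht => ?_⟩
    have := key t ht
    have h3 : ((c : ℕ) : ℝ) + 1 = n := by exact_mod_cast h2
    rw [plateau, min_eq_right (a := (n : ℝ) * t) (by linarith), min_eq_right (by linarith),
      max_eq_right (by linarith)]
    ring
  · refine ⟨1, 0, fun t ht => ?_⟩
    have := key t ht
    have h3 : ((c : ℕ) : ℝ) + 1 + 1 ≤ n := by exact_mod_cast h2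
    rw [plateau, min_eq_left (a := (1 : ℝ)) (le_min (by linarith) (by linarith)),
      max_eq_right zero_le_one]
    ring

lemma plateau_eq_zero {n : ℕ} {t : ℝ} (ht : t ∉ Set.Ioo (0 : ℝ) 1) : plateau n t = 0 := by
  rw [Set.mem_Ioo, not_and_or, not_lt, not_lt] at ht
  have hn : (0 : ℝ) ≤ n := Nat.cast_nonneg n
  refine max_eq_left ((min_le_right _ _).trans ?_)
  rcases ht with ht | ht
  · exact (min_le_left _ _).trans (mul_nonpos_of_nonneg_of_nonpos hn ht)
  · exact (min_le_right _ _).trans (by nlinarith)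

lemma continuous_plateau (n : ℕ) : Continuous (plateau n) := by
  unfold plateau
  fun_prop

lemma plateau_prod_mem_Vh {N r : ℕ} (hn : 3 ≤ N * r) :
    (fun x : ℝ × ℝ => plateau (N * r) x.1 * plateau (N * r) x.2) ∈ Vh N r := by
  refine ⟨?_, fun x hx => ?_, fun c => ?_⟩
  · exact ((continuous_plateau _).comp continuous_fst).mul
      ((continuous_plateau _).comp continuous_snd)
  · have hx' : ¬ (x.1 ∈ Set.Ioo (0 : ℝ) 1 ∧ x.2 ∈ Set.Ioo (0 : ℝ) 1) := hx
    rcases not_and_or.1 hx' with h | h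
    · simp [plateau_eq_zero h]
    · simp [plateau_eq_zero h]
  · obtain ⟨α, γ, h⟩ := exists_affine_plateau hn c.1
    obtain ⟨α', γ', h'⟩ := exists_affine_plateau hn c.2
    refine ⟨α * α', γ * α', α * γ', γ * γ', fun x hx => ?_⟩
    simp only
    rw [h x.1 hx.1, h' x.2 hx.2]
    ring

lemma plateau_eq_one {N r : ℕ} (hr : 0 < r) {c : Fin N} (h0 : 0 < (c : ℕ))
    (h1 : (c : ℕ) + 1 < N) {t : ℝ} (ht : t ∈ Set.Icc ((c : ℝ) / N) (((c : ℝ) + 1) / N)) :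
    plateau (N * r) t = 1 := by
  have hN : (0 : ℝ) < N := by exact_mod_cast c.pos
  have hr' : (1 : ℝ) ≤ r := by exact_mod_cast hr
  have h0' : (1 : ℝ) ≤ (c : ℕ) := by exact_mod_cast h0
  have h1' : ((c : ℕ) : ℝ) + 1 + 1 ≤ N := by exact_mod_cast h1
  have h2 := (div_le_iff₀ hN).1 ht.1
  have h3 := (le_div_iff₀ hN).1 ht.2
  have h4 : 1 ≤ (N : ℝ) * r * t := by nlinarith
  have h5 : 1 ≤ (N : ℝ) * r - N * r * t := by nlinarith
  rw [plateau, Nat.cast_mul, min_eq_left (le_min h4 h5), max_eq_right zero_le_one]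

/-- For an element that does not touch the boundary some finite element function is equal to one
on the element. -/
lemma exists_mem_Vh_eq_one {N r : ℕ} (hr : 0 < r) {i : Elem N} (hi : ¬ IsBoundaryElem i) :
    ∃ w ∈ Vh N r, ∀ x ∈ cell N i, w x = 1 := by
  simp only [IsBoundaryElem, not_or] at hi
  have h1 := i.1.2
  have h2 := i.2.2
  -- An element away from the boundary has neighbours on both sides, so `N ≥ 3`.
  have hn : 3 ≤ N * r := le_trans (by omega) (Nat.le_mul_of_pos_right N hr)
  refine ⟨_, plateau_prod_mem_Vh hn, fun x hx => ?_⟩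
  rw [plateau_eq_one hr (by omega) (by omega) hx.1, plateau_eq_one hr (by omega) (by omega) hx.2,
    one_mul]

end Cutoff

/-! ### Lower bound for positive eigenvalues of the local Laplace problem -/

section Laplace

variable {N r : ℕ} {i : Elem N}

/-- The constant function one. -/
def oneLip : lipSpace := ⟨fun _ => 1, 0, LipschitzWith.const 1⟩

lemma energyForm_oneLip {κ : ℝ × ℝ → ℝ} {β : ℝ} {S : Set (ℝ × ℝ)} (h : IsWeight κ β S)
    (v : lipSpace) : h.energyForm v oneLip = 0 := by
  simp [IsWeight.energyForm_apply, energyOn, oneLip, gradDot]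

lemma exists_femLip_of_mem_VhLocal (hn : 0 < N * r) {ψ : ℝ × ℝ → ℝ} (hψ : ψ ∈ VhLocal N r i) :
    ∃ x : Node N r → ℝ, restrictTo (cell N i) (femFunction x) = ψ := by
  obtain ⟨v, hv, rfl⟩ := hψ
  exact ⟨nodalVector v, by rw [femFunction_nodalVector hn hv]⟩

lemma restrictTo_femFunction_mem (x : Node N r → ℝ) :
    restrictTo (cell N i) (femFunction x) ∈ VhLocal N r i :=
  Submodule.mem_map_of_mem (femFunction_mem_Vh x)

lemma massForm_pos (h : IsWeight (fun _ => 1) 1 (cell N i)) {x : Node N r → ℝ}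
    (hx : restrictTo (cell N i) (femFunction x) ≠ 0) :
    0 < h.massForm (femLip N r x) (femLip N r x) := by
  refine lt_of_le_of_ne (h.massForm_nonneg _) fun h0 => hx ?_
  have := h.eqOn_zero_of_massForm_eq_zero h0.symm
  rw [coe_femLip] at this
  rw [restrictTo_eq_of_eqOn this, map_zero]

/-- Nonzero eigenvalues of the local Laplace problem are at least `π² / 4`. -/
lemma pi_sq_div_four_le (hr : 0 < r) {μ : ℝ} (hμ : 0 < μ) {ψ : ℝ × ℝ → ℝ}
    (hψ : ψ ∈ VhLocal N r i) (hψ0 : ψ ≠ 0)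
    (heq : ∀ w ∈ VhLocal N r i,
      localEnergy (fun _ => 1) i ψ w = μ * localMass (fun _ => 1) i ψ w) :
    Real.pi ^ 2 / 4 ≤ μ := by
  have hN : 0 < N := i.1.pos
  have hn : 0 < N * r := Nat.mul_pos hN hr
  have hH := coarseSize_pos hN
  obtain ⟨x, rfl⟩ := exists_femLip_of_mem_VhLocal hn hψ
  have h : IsWeight (fun _ => 1) 1 (cell N i) :=
    (isWeight_square measurable_const (by simp)).cell i
  set v := femLip N r x with hv
  have heq' : ∀ y : Node N r → ℝ, h.energyForm v (femLip N r y) =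
      μ * ((coarseSize N ^ 2)⁻¹ * h.massForm v (femLip N r y)) := by
    intro y
    have := heq _ (restrictTo_femFunction_mem y)
    rwa [localEnergy_congr (restrictTo_eqOn _ _) (restrictTo_eqOn _ _),
      localMass_congr (restrictTo_eqOn _ _) (restrictTo_eqOn _ _)] at this
  have hpos := massForm_pos h hψ0
  -- On a boundary element `v` vanishes on a side. On any other element the constant one is an
  -- admissible test function, and since its energy with `v` is zero and `μ ≠ 0`, the eigenfunction
  -- has mean value zero. The same constant holds in both cases.
  have hP : h.massForm v v ≤ 4 * coarseSize N ^ 2 / Real.pi ^ 2 * h.energyForm v v := by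
    by_cases hi : IsBoundaryElem i
    · exact poincare_boundary h hi fun y hy => femFunction_eq_zero_of_notMem x hy
    · refine poincare_interior h ?_
      obtain ⟨w, hw, hw1⟩ := exists_mem_Vh_eq_one hr hi
      have h1 := heq' (nodalVector w)
      have h2 : Set.EqOn (femLip N r (nodalVector w) : ℝ × ℝ → ℝ) oneLip (cell N i) := by
        intro y hy
        rw [coe_femLip, femFunction_nodalVector hn hw, hw1 y hy]
        rfl
      rw [energyForm_congr h (Set.eqOn_refl _ _) h2, massForm_congr h (Set.eqOn_refl _ _) h2,
        energyForm_oneLip] at h1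
      have h3 : h.massForm v oneLip = 0 := by
        have h4 : μ * (coarseSize N ^ 2)⁻¹ ≠ 0 := by positivity
        rw [← mul_assoc] at h1
        exact (mul_eq_zero.1 h1.symm).resolve_left h4
      simpa [IsWeight.massForm_apply, oneLip] using h3
  rw [heq' x] at hP
  have hpi := Real.pi_pos
  have h5 : 4 * coarseSize N ^ 2 / Real.pi ^ 2 * (μ * ((coarseSize N ^ 2)⁻¹ * h.massForm v v)) =
      (4 / Real.pi ^ 2 * μ) * h.massForm v v := by
    field_simp
  rw [← hv, h5] at hP
  have h6 : 1 ≤ 4 / Real.pi ^ 2 * μ := by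
    by_contra hcon
    nlinarith
  rw [div_mul_eq_mul_div, one_le_div (by positivity)] at h6
  linarith

end Laplace

/-! ### Expansion in a local orthonormal basis -/

section LocalExpansion

variable {N r : ℕ} {i : Elem N} {κ : ℝ × ℝ → ℝ} {β : ℝ}

lemma VhLocal_eq_range (hn : 0 < N * r) (i : Elem N) : VhLocal N r i =
    LinearMap.range (restrictTo (cell N i) ∘ₗ lipSpace.subtype ∘ₗ femLip N r) := by
  ext ψ
  constructor
  · intro hψ
    obtain ⟨x, rfl⟩ := exists_femLip_of_mem_VhLocal hn hψ
    exact ⟨x, rfl⟩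
  · rintro ⟨x, rfl⟩
    exact restrictTo_femFunction_mem x

lemma finite_VhLocal (hn : 0 < N * r) (i : Elem N) : Module.Finite ℝ (VhLocal N r i) := by
  rw [VhLocal_eq_range hn i]
  infer_instance

/-- Vectors that represent an orthonormal basis of the local space. -/
def IsLocalBasis (h : IsWeight κ β (cell N i)) (e : Fin (localDim N r i) → Node N r → ℝ) : Prop :=
  ∀ j k, (coarseSize N ^ 2)⁻¹ * h.massForm (femLip N r (e j)) (femLip N r (e k)) =
    if j = k then 1 else 0

/-- The coefficients with respect to a local orthonormal basis. -/
def localCoeff (h : IsWeight κ β (cell N i)) (e : Fin (localDim N r i) → Node N r → ℝ)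
    (y : Node N r → ℝ) (j : Fin (localDim N r i)) : ℝ :=
  (coarseSize N ^ 2)⁻¹ * h.massForm (femLip N r y) (femLip N r (e j))

variable {h : IsWeight κ β (cell N i)} {e : Fin (localDim N r i) → Node N r → ℝ}

lemma localCoeff_sum (he : IsLocalBasis h e) (c : Fin (localDim N r i) → ℝ)
    (k : Fin (localDim N r i)) : localCoeff h e (∑ j, c j • e j) k = c k := by
  have h1 : localCoeff h e (∑ j, c j • e j) k = ∑ j, c j *
      ((coarseSize N ^ 2)⁻¹ * h.massForm (femLip N r (e j)) (femLip N r (e k))) := by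
    rw [localCoeff, map_sum, map_sum, LinearMap.sum_apply, Finset.mul_sum]
    refine Finset.sum_congr rfl fun j _ => ?_
    rw [map_smul, map_smul, LinearMap.smul_apply, smul_eq_mul]
    ring
  rw [h1]
  simp only [he _ k, mul_ite, mul_one, mul_zero, Finset.sum_ite_eq', Finset.mem_univ, if_true]

lemma localCoeff_congr {y y' : Node N r → ℝ}
    (hy : Set.EqOn (femFunction y) (femFunction y') (cell N i)) (k : Fin (localDim N r i)) :
    localCoeff h e y k = localCoeff h e y' k := by
  rw [localCoeff, localCoeff, massForm_congr h (v := femLip N r y) (v' := femLip N r y') hy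
    (Set.eqOn_refl _ _)]

/-- Expansion of a finite element function on an element. -/
lemma eqOn_local_expansion (hn : 0 < N * r) (he : IsLocalBasis h e) (y : Node N r → ℝ) :
    Set.EqOn (femFunction y) (femFunction (∑ j, localCoeff h e y j • e j)) (cell N i) := by
  have := finite_VhLocal hn i
  have hlin : ∀ c : Fin (localDim N r i) → ℝ,
      ∑ j, c j • restrictTo (cell N i) (femFunction (e j)) =
        restrictTo (cell N i) (femFunction (∑ j, c j • e j)) := by
    intro c
    simp only [← coe_femLip, map_sum, map_smul, Submodule.coe_sum, Submodule.coe_smul]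
  have heqOn : ∀ {z z' : Node N r → ℝ}, restrictTo (cell N i) (femFunction z) =
      restrictTo (cell N i) (femFunction z') →
      Set.EqOn (femFunction z) (femFunction z') (cell N i) := by
    intro z z' hz x hx
    rw [← restrictTo_eqOn _ (femFunction z) hx, hz, restrictTo_eqOn _ (femFunction z') hx]
  set ψ : Fin (localDim N r i) → VhLocal N r i := fun j =>
    ⟨restrictTo (cell N i) (femFunction (e j)), restrictTo_femFunction_mem (e j)⟩ with hψ
  -- Pairing with the orthonormal family recovers the coefficients, so it is independent; it has as
  -- many members as the dimension of the local space and is therefore a basis.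
  have hli : LinearIndependent ℝ ψ := by
    rw [Fintype.linearIndependent_iff]
    intro c hc k
    have h1 : ∑ j, c j • restrictTo (cell N i) (femFunction (e j)) = 0 := by
      have := congrArg Subtype.val hc
      simpa [hψ] using this
    rw [hlin] at h1
    have h2 : Set.EqOn (femFunction (∑ j, c j • e j)) (femFunction (0 : Node N r → ℝ))
        (cell N i) := heqOn (by
      rw [h1, ← coe_femLip, map_zero]; simp)
    rw [← localCoeff_sum he c k, localCoeff_congr h2, localCoeff, map_zero]
    simp
  let b := basisOfLinearIndependentOfCardEqFinrank' ψ hli (Fintype.card_fin _)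
  have h3 : restrictTo (cell N i) (femFunction y) = ∑ j,
      b.repr ⟨_, restrictTo_femFunction_mem y⟩ j • restrictTo (cell N i) (femFunction (e j)) := by
    have := congrArg Subtype.val (b.sum_repr ⟨_, restrictTo_femFunction_mem y⟩)
    have hb : ∀ j, (b j : ℝ × ℝ → ℝ) = restrictTo (cell N i) (femFunction (e j)) := fun j => by
      rw [show b j = ψ j from congrFun (coe_basisOfLinearIndependentOfCardEqFinrank' ψ hli _) j]
    simp only [Submodule.coe_sum, Submodule.coe_smul, hb] at this
    exact this.symm
  rw [hlin] at h3
  have h4 := heqOn h3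
  have h5 : (fun j => localCoeff h e y j) = b.repr ⟨_, restrictTo_femFunction_mem y⟩ := by
    funext k
    rw [localCoeff_congr h4, localCoeff_sum he]
  have h6 : ∀ j, localCoeff h e y j = b.repr ⟨_, restrictTo_femFunction_mem y⟩ j := fun j =>
    congrFun h5 j
  simp only [h6]
  exact h4

lemma massForm_local_expansion (hn : 0 < N * r) (he : IsLocalBasis h e) (y : Node N r → ℝ) :
    (coarseSize N ^ 2)⁻¹ * h.massForm (femLip N r y) (femLip N r y) =
      ∑ j, localCoeff h e y j ^ 2 := by
  have h1 := eqOn_local_expansion hn he y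
  have h2 : h.massForm (femLip N r y) (femLip N r y) =
      h.massForm (femLip N r y) (femLip N r (∑ j, localCoeff h e y j • e j)) :=
    massForm_congr h (Set.eqOn_refl _ _) h1
  rw [h2, map_sum, map_sum, Finset.mul_sum]
  refine Finset.sum_congr rfl fun j _ => ?_
  rw [map_smul, map_smul, smul_eq_mul, mul_left_comm, ← localCoeff, sq]

/-- Only one argument is expanded; the eigenvalue equation then turns each energy into `l j` times a
coefficient of the other argument. -/
lemma energyForm_local_expansion (hn : 0 < N * r) (he : IsLocalBasis h e)
    {l : Fin (localDim N r i) → ℝ}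
    (hl : ∀ j y, h.energyForm (femLip N r (e j)) (femLip N r y) =
      l j * ((coarseSize N ^ 2)⁻¹ * h.massForm (femLip N r (e j)) (femLip N r y)))
    (y : Node N r → ℝ) :
    h.energyForm (femLip N r y) (femLip N r y) = ∑ j, l j * localCoeff h e y j ^ 2 := by
  have h1 := eqOn_local_expansion hn he y
  have h2 : h.energyForm (femLip N r y) (femLip N r y) =
      h.energyForm (femLip N r (∑ j, localCoeff h e y j • e j)) (femLip N r y) :=
    energyForm_congr h h1 (Set.eqOn_refl _ _)
  rw [h2, map_sum, map_sum, LinearMap.sum_apply]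
  refine Finset.sum_congr rfl fun j _ => ?_
  rw [map_smul, map_smul, LinearMap.smul_apply, smul_eq_mul, hl, h.massForm_comm, ← localCoeff]
  ring

end LocalExpansion

/-! ### Existence of a positive eigenvalue of the local Laplace problem -/

section LaplaceExistence

variable {N r : ℕ} {i : Elem N} {κ : ℝ × ℝ → ℝ} {β : ℝ}

/-- Some finite element function has positive energy on the element if the local space is not
trivial. -/
lemma exists_energyForm_pos (hr : 0 < r) (h : IsWeight (fun _ => 1) 1 (cell N i))
    (hne : ∃ x : Node N r → ℝ, restrictTo (cell N i) (femFunction x) ≠ 0) :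
    ∃ x : Node N r → ℝ, 0 < h.energyForm (femLip N r x) (femLip N r x) := by
  have hN : 0 < N := i.1.pos
  have hn : 0 < N * r := Nat.mul_pos hN hr
  by_cases hi : IsBoundaryElem i
  · obtain ⟨x, hx⟩ := hne
    refine ⟨x, ?_⟩
    have h1 := massForm_pos h hx
    have h2 := poincare_boundary h hi (v := femLip N r x)
      fun y hy => femFunction_eq_zero_of_notMem x hy
    refine lt_of_le_of_ne (h.energyForm_nonneg _) fun h0 => ?_
    rw [← h0, mul_zero] at h2
    linarith
  simp only [IsBoundaryElem, not_or] at hi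
  have hi1 := i.1.2
  have hi2 := i.2.2
  have hlt : ∀ c : Fin N, 0 < (c : ℕ) → (c : ℕ) * r - 1 < N * r - 1 := by
    intro c hc
    have h1 : (c : ℕ) * r < N * r := Nat.mul_lt_mul_of_pos_right c.2 hr
    have h2 : 0 < (c : ℕ) * r := Nat.mul_pos hc hr
    omega
  -- The lower left corner of the element, an interior vertex because the element does not touch the
  -- boundary. Nodes are counted from zero, hence the `- 1`.
  set p : Node N r := (⟨i.1 * r - 1, hlt _ (by omega)⟩, ⟨i.2 * r - 1, hlt _ (by omega)⟩) with hp
  refine ⟨Pi.single p 1, lt_of_le_of_ne (h.energyForm_nonneg _) fun h0 => ?_⟩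
  have hNr : (0 : ℝ) < N := by exact_mod_cast hN
  have hr' : (1 : ℝ) ≤ r := by exact_mod_cast hr
  set v := femLip N r (Pi.single p 1) with hv
  have hvh : (v : ℝ × ℝ → ℝ) = hat p := by
    rw [hv, coe_femLip, femFunction]
    simp [Pi.single_apply, ite_smul]
  set m : ℝ := coarseSize N ^ 2 with hm
  have hvol : ∫ x in cell N i, (1 : ℝ) = coarseSize N ^ 2 := by
    rw [setIntegral_const, smul_eq_mul, mul_one, cell, Measure.volume_eq_prod,
      Measure.real, Measure.prod_prod, ENNReal.toReal_mul, Real.volume_Icc, Real.volume_Icc,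
      cell_side, cell_side, ENNReal.toReal_ofReal (coarseSize_pos hN).le, sq]
  set I := ∫ x in cell N i, (v : ℝ × ℝ → ℝ) x with hI
  have hmass : h.massForm v oneLip = I := by simp [IsWeight.massForm_apply, oneLip, hI]
  have hone : h.massForm oneLip oneLip = coarseSize N ^ 2 := by
    rw [← hvol]; simp [IsWeight.massForm_apply, oneLip]
  have hHpos := coarseSize_pos hN
  -- If the hat function had energy zero, then so would its difference from its mean value, which
  -- vanishes by the Poincaré inequality. The hat function would be constant on the element, but it
  -- is one at one corner and zero at the next.
  set w : lipSpace := v - (I / coarseSize N ^ 2) • oneLip with hw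
  have hw0 : ∫ x in cell N i, (w : ℝ × ℝ → ℝ) x = 0 := by
    have h1 : h.massForm w oneLip = 0 := by
      rw [hw, map_sub, LinearMap.sub_apply, map_smul, LinearMap.smul_apply, hmass, hone,
        smul_eq_mul]
      field_simp
      ring
    simpa [IsWeight.massForm_apply, oneLip] using h1
  have hwE : h.energyForm w w = 0 := by
    have h1 : ∀ u : lipSpace, h.energyForm oneLip u = 0 := fun u => by
      rw [h.energyForm_comm, energyForm_oneLip]
    rw [hw]
    simp only [map_sub, map_smul, LinearMap.sub_apply, LinearMap.smul_apply, h1,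
      energyForm_oneLip, ← h0]
    simp
  have h3 := poincare_interior h hw0
  rw [hwE, mul_zero] at h3
  have h4 := h.eqOn_zero_of_massForm_eq_zero (le_antisymm h3 (h.massForm_nonneg _))
  have hval : ∀ x ∈ cell N i, hat p x = I / coarseSize N ^ 2 := by
    intro x hx
    have h5 := h4 hx
    rw [hw, Submodule.coe_sub, Pi.sub_apply, hvh] at h5
    simp only [Submodule.coe_smul, Pi.smul_apply, oneLip, smul_eq_mul, mul_one, Pi.zero_apply] at h5
    linarith
  have hle : ∀ c : ℕ, (c : ℝ) / N ≤ ((c : ℝ) + 1) / N := fun c =>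
    div_le_div_of_nonneg_right (by linarith) hNr.le
  have h5 := hval ((i.1 : ℝ) / N, (i.2 : ℝ) / N) ⟨⟨le_rfl, hle _⟩, ⟨le_rfl, hle _⟩⟩
  have h6 := hval (((i.1 : ℝ) + 1) / N, (i.2 : ℝ) / N) ⟨⟨hle _, le_rfl⟩, ⟨le_rfl, hle _⟩⟩
  have hcast : ∀ c : Fin N, 0 < (c : ℕ) → (((c : ℕ) * r - 1 : ℕ) : ℝ) + 1 = c * r := by
    intro c hc
    have h2 : 1 ≤ (c : ℕ) * r := Nat.mul_pos hc hr
    rw [Nat.cast_sub h2]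
    push_cast
    ring
  have hfac : ∀ c : Fin N, 0 < (c : ℕ) →
      hatFactor (N * r) ((((c : ℕ) * r - 1 : ℕ) : ℝ) + 1) ((c : ℝ) / N) = 1 := by
    intro c hc
    rw [hcast c hc, hatFactor]
    have : ((N * r : ℕ) : ℝ) * ((c : ℝ) / N) - c * r = 0 := by
      push_cast
      field_simp
      ring
    rw [this]
    simp
  have hfac' : hatFactor (N * r) ((((i.1 : ℕ) * r - 1 : ℕ) : ℝ) + 1) (((i.1 : ℝ) + 1) / N) = 0 := by
    rw [hcast i.1 (by omega)]
    refine hatFactor_eq_zero ?_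
    have : ((N * r : ℕ) : ℝ) * (((i.1 : ℝ) + 1) / N) - i.1 * r = r := by
      push_cast
      field_simp
      ring
    rw [this]
    exact hr'.trans (le_abs_self _)
  rw [hat_apply] at h5 h6
  simp only [hp] at h5 h6
  rw [hfac _ (by omega), hfac _ (by omega)] at h5
  rw [hfac', zero_mul] at h6
  linarith

/-- The first nonzero eigenvalue of the local Laplace problem is at least `π² / 4`. -/
lemma pi_sq_div_four_le_laplaceEigenvalue (hr : 0 < r) (hw : IsWeight κ β (cell N i))
    {e : Fin (localDim N r i) → Node N r → ℝ} (he : IsLocalBasis hw e)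
    (hdim : 0 < localDim N r i) : Real.pi ^ 2 / 4 ≤ laplaceEigenvalue N r i := by
  have hN : 0 < N := i.1.pos
  have hn : 0 < N * r := Nat.mul_pos hN hr
  have hH := coarseSize_pos hN
  -- A lower bound for all members is not enough: the infimum of the empty set is `0` by convention,
  -- so a positive eigenvalue has to be exhibited.
  refine le_csInf ?_ fun μ hμ => ?_
  swap
  · obtain ⟨hμ0, ψ, hψ, hψ0, heq⟩ := hμ
    exact pi_sq_div_four_le hr hμ0 hψ hψ0 heq
  have h : IsWeight (fun _ => 1) 1 (cell N i) :=
    (isWeight_square measurable_const (by simp)).cell i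
  -- The Laplace forms in the given local basis. It is orthonormal for the weighted form, not for
  -- the one with coefficient one, so a generalized eigenvalue problem arises.
  set A : Matrix (Fin (localDim N r i)) (Fin (localDim N r i)) ℝ :=
    Matrix.of fun j k => h.energyForm (femLip N r (e j)) (femLip N r (e k)) with hA
  set B : Matrix (Fin (localDim N r i)) (Fin (localDim N r i)) ℝ :=
    Matrix.of fun j k => (coarseSize N ^ 2)⁻¹ *
      h.massForm (femLip N r (e j)) (femLip N r (e k)) with hB
  have hquad : ∀ (F : LinearMap.BilinForm ℝ lipSpace) (x y : Fin (localDim N r i) → ℝ),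
      F (femLip N r (∑ j, x j • e j)) (femLip N r (∑ j, y j • e j)) =
        x ⬝ᵥ (Matrix.of fun j k => F (femLip N r (e j)) (femLip N r (e k))) *ᵥ y := by
    intro F x y
    simp only [map_sum, map_smul, LinearMap.sum_apply, LinearMap.smul_apply, smul_eq_mul,
      dotProduct, Matrix.mulVec, Matrix.of_apply, Finset.mul_sum]
    rw [Finset.sum_comm]
    refine Finset.sum_congr rfl fun j _ => Finset.sum_congr rfl fun k _ => ?_
    ring
  have hAq : ∀ x y : Fin (localDim N r i) → ℝ, h.energyForm (femLip N r (∑ j, x j • e j))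
      (femLip N r (∑ j, y j • e j)) = x ⬝ᵥ A *ᵥ y := hquad h.energyForm
  have hBq : ∀ x y : Fin (localDim N r i) → ℝ, (coarseSize N ^ 2)⁻¹ *
      h.massForm (femLip N r (∑ j, x j • e j)) (femLip N r (∑ j, y j • e j)) = x ⬝ᵥ B *ᵥ y := by
    intro x y
    have := hquad ((coarseSize N ^ 2)⁻¹ • h.massForm) x y
    simpa only [LinearMap.smul_apply, smul_eq_mul] using this
  have hrep : ∀ y : Node N r → ℝ, ∃ c : Fin (localDim N r i) → ℝ,
      Set.EqOn (femFunction y) (femFunction (∑ j, c j • e j)) (cell N i) := fun y =>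
    ⟨_, eqOn_local_expansion hn he y⟩
  have hnz : ∀ x : Fin (localDim N r i) → ℝ, x ≠ 0 →
      restrictTo (cell N i) (femFunction (∑ j, x j • e j)) ≠ 0 := by
    intro x hx h0
    refine hx (funext fun k => ?_)
    have h1 : Set.EqOn (femFunction (∑ j, x j • e j)) (femFunction (0 : Node N r → ℝ))
        (cell N i) := by
      intro z hz
      rw [← restrictTo_eqOn _ (femFunction (∑ j, x j • e j)) hz, h0]
      simp [femFunction]
    rw [← localCoeff_sum he x k, localCoeff_congr h1, localCoeff, map_zero]
    simp
  have hBpd : B.PosDef := by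
    refine Matrix.PosDef.of_dotProduct_mulVec_pos ?_ fun x hx => ?_
    · ext j k
      simp only [hB, Matrix.conjTranspose_apply, Matrix.of_apply, star_trivial]
      rw [h.massForm_comm]
    · rw [star_trivial, ← hBq]
      have := massForm_pos h (hnz x hx)
      positivity
  have hAh : A.IsHermitian := by
    ext j k
    simp only [hA, Matrix.conjTranspose_apply, Matrix.of_apply, star_trivial]
    exact h.energyForm_comm _ _
  have hex : ∃ x : Fin (localDim N r i) → ℝ, 0 < x ⬝ᵥ A *ᵥ x := by
    have hne : ∃ x : Node N r → ℝ, restrictTo (cell N i) (femFunction x) ≠ 0 :=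
      ⟨_, hnz (Pi.single ⟨0, hdim⟩ 1) (by simp)⟩
    obtain ⟨y, hy⟩ := exists_energyForm_pos hr h hne
    obtain ⟨c, hc⟩ := hrep y
    refine ⟨c, ?_⟩
    rwa [← hAq, ← energyForm_congr h (v := femLip N r y) (w := femLip N r y)
      (v' := femLip N r (∑ j, c j • e j)) (w' := femLip N r (∑ j, c j • e j)) hc hc]
  obtain ⟨μ, hμ, x, hx0, hx⟩ := exists_pos_generalized_eigenvalue hAh hBpd hex
  refine ⟨μ, hμ, _, restrictTo_femFunction_mem (∑ j, x j • e j), hnz x hx0, fun w hw' => ?_⟩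
  obtain ⟨y, rfl⟩ := exists_femLip_of_mem_VhLocal hn hw'
  obtain ⟨c, hc⟩ := hrep y
  rw [localEnergy_congr ((restrictTo_eqOn _ _)) ((restrictTo_eqOn _ _).trans hc),
    localMass_congr ((restrictTo_eqOn _ _)) ((restrictTo_eqOn _ _).trans hc)]
  have h1 := hAq x c
  have h2 := hBq x c
  rw [dotProduct_mulVec_symm hAh, hx, dotProduct_smul, smul_eq_mul,
    dotProduct_mulVec_symm hBpd.isHermitian, ← h2] at h1
  exact h1

end LaplaceExistence

/-! ### The auxiliary functionals and the approximation property -/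

namespace MSData

variable {N r : ℕ} {D : MSData N r} {κ : ℝ × ℝ → ℝ} {β : ℝ}

/-- The eigenfunctions are represented by vectors that form a local orthonormal basis. -/
lemma IsAdmissible.exists_eigenvectors (hD : D.IsAdmissible κ) (hr : 0 < r)
    (h : IsWeight κ β (Set.Icc 0 1)) (i : Elem N) :
    ∃ e : Fin (localDim N r i) → Node N r → ℝ,
      (∀ j, restrictTo (cell N i) (femFunction (e j)) = D.eigenfun i j) ∧
      IsLocalBasis (h.cell i) e ∧
      ∀ j y, (h.cell i).energyForm (femLip N r (e j)) (femLip N r y) = D.eigenvalue i j *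
        ((coarseSize N ^ 2)⁻¹ * (h.cell i).massForm (femLip N r (e j)) (femLip N r y)) := by
  have hn : 0 < N * r := Nat.mul_pos i.1.pos hr
  choose e he using fun j => exists_femLip_of_mem_VhLocal hn (hD.eigenfun_mem i j)
  refine ⟨e, he, fun j k => ?_, fun j y => ?_⟩
  · have := hD.orthonormal i j k
    rw [← he, ← he, localMass_congr (restrictTo_eqOn _ _) (restrictTo_eqOn _ _)] at this
    exact this
  · have := hD.eigen_equation i j _ (restrictTo_femFunction_mem y)
    rw [← he, localEnergy_congr (restrictTo_eqOn _ _) (restrictTo_eqOn _ _),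
      localMass_congr (restrictTo_eqOn _ _) (restrictTo_eqOn _ _)] at this
    exact this

lemma localMass_auxFun_eq {h : IsWeight κ β (Set.Icc 0 1)} {i : Elem N}
    {e : Fin (localDim N r i) → Node N r → ℝ}
    (he : ∀ j, restrictTo (cell N i) (femFunction (e j)) = D.eigenfun i j)
    (y : Node N r → ℝ) (j : Fin (D.numAux i)) :
    localMass κ i (femFunction y) (D.auxFun i j) =
      localCoeff (h.cell i) e y (Fin.castLE (D.numAux_le i) j) := by
  rw [auxFun, ← he, localMass_congr (Set.eqOn_refl _ _) (restrictTo_eqOn _ _)]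
  rfl

lemma IsAdmissible.isLinearMap_localMass (hD : D.IsAdmissible κ) (hr : 0 < r)
    (h : IsWeight κ β (Set.Icc 0 1)) (i : Elem N) (j : Fin (D.numAux i)) :
    IsLinearMap ℝ fun y : Node N r → ℝ => localMass κ i (femFunction y) (D.auxFun i j) := by
  obtain ⟨e, he, -, -⟩ := hD.exists_eigenvectors hr h i
  constructor
  · intro x y
    simp only [localMass_auxFun_eq (h := h) he, localCoeff, map_add, LinearMap.add_apply, mul_add]
  · intro c x
    simp only [localMass_auxFun_eq (h := h) he, localCoeff, map_smul, LinearMap.smul_apply,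
      smul_eq_mul]
    ring

/-- The functionals `v ↦ s_i(v, ψ_j)` on vectors. -/
def IsAdmissible.auxCoeff (hD : D.IsAdmissible κ) (hr : 0 < r)
    (h : IsWeight κ β (Set.Icc 0 1)) (i : Elem N) (j : Fin (D.numAux i)) :
    (Node N r → ℝ) →ₗ[ℝ] ℝ :=
  IsLinearMap.mk' _ (hD.isLinearMap_localMass hr h i j)

lemma IsAdmissible.auxCoeff_apply (hD : D.IsAdmissible κ) (hr : 0 < r)
    (h : IsWeight κ β (Set.Icc 0 1)) (i : Elem N) (j : Fin (D.numAux i)) (y : Node N r → ℝ) :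
    hD.auxCoeff hr h i j y = localMass κ i (femFunction y) (D.auxFun i j) := rfl

/-- The Bessel inequality for the auxiliary functionals. -/
lemma IsAdmissible.sum_auxCoeff_sq_le (hD : D.IsAdmissible κ) (hr : 0 < r)
    (h : IsWeight κ β (Set.Icc 0 1)) (hN : 0 < N) (y : Node N r → ℝ) :
    ∑ i, ∑ j, hD.auxCoeff hr h i j y ^ 2 ≤
      (coarseSize N ^ 2)⁻¹ * (β * h.omega.one.massForm (femLip N r y) (femLip N r y)) := by
  have hH := coarseSize_pos hN
  have h1 : ∀ i, ∑ j, hD.auxCoeff hr h i j y ^ 2 ≤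
      (coarseSize N ^ 2)⁻¹ * (h.cell i).massForm (femLip N r y) (femLip N r y) := by
    intro i
    obtain ⟨e, he, hb, -⟩ := hD.exists_eigenvectors hr h i
    rw [massForm_local_expansion (Nat.mul_pos hN hr) hb]
    simp only [auxCoeff_apply, localMass_auxFun_eq (h := h) he]
    rw [← Finset.sum_image (s := Finset.univ) (g := Fin.castLE (D.numAux_le i))
      (f := fun j => localCoeff (h.cell i) e y j ^ 2)
      (fun a _ b _ hab => Fin.castLE_injective _ hab)]
    exact Finset.sum_le_sum_of_subset_of_nonneg (Finset.subset_univ _) fun _ _ _ => sq_nonneg _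
  refine (Finset.sum_le_sum fun i _ => h1 i).trans ?_
  rw [← Finset.mul_sum, ← massForm_omega_eq_sum h hN]
  exact mul_le_mul_of_nonneg_left (h.omega.massForm_le_mul _) (by positivity)

/-- The approximation property: functions without auxiliary part are small in `L²`. -/
lemma IsAdmissible.massForm_le_of_auxCoeff_eq_zero (hD : D.IsAdmissible κ) (hr : 0 < r)
    (h : IsWeight κ β (Set.Icc 0 1)) (hN : 0 < N) {y : Node N r → ℝ}
    (hy : ∀ i j, hD.auxCoeff hr h i j y = 0) :
    h.omega.one.massForm (femLip N r y) (femLip N r y) ≤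
      (Cstar * coarseSize N) ^ 2 * h.omega.energyForm (femLip N r y) (femLip N r y) := by
  have hH := coarseSize_pos hN
  have hpi := Real.pi_pos
  have hC : Cstar ^ 2 = 8 / Real.pi ^ 2 := by
    rw [Cstar, div_pow, mul_pow, Real.sq_sqrt (by norm_num)]
    norm_num
  refine (h.omega.massForm_one_le _).trans ?_
  rw [massForm_omega_eq_sum h hN, energyForm_omega_eq_sum h hN, Finset.mul_sum]
  refine Finset.sum_le_sum fun i _ => ?_
  obtain ⟨e, he, hb, hl⟩ := hD.exists_eigenvectors hr h i
  have hn := Nat.mul_pos hN hr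
  have h1 := massForm_local_expansion hn hb y
  have h2 := energyForm_local_expansion hn hb hl y
  -- Coefficients with `j < L_i` vanish by hypothesis. For the others the eigenvalue exceeds `μ_i /
  -- 2 ≥ π² / 8`; the index `j` itself shows that the local dimension is positive, as the bound for
  -- `μ_i` requires.
  have h3 : ∑ j, localCoeff (h.cell i) e y j ^ 2 ≤
      8 / Real.pi ^ 2 * ∑ j, D.eigenvalue i j * localCoeff (h.cell i) e y j ^ 2 := by
    rw [Finset.mul_sum]
    refine Finset.sum_le_sum fun j _ => ?_
    by_cases hj : (j : ℕ) < D.numAux i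
    · have h4 := hy i ⟨j, hj⟩
      rw [auxCoeff_apply, localMass_auxFun_eq (h := h) he] at h4
      have h5 : Fin.castLE (D.numAux_le i) ⟨j, hj⟩ = j := rfl
      rw [h5] at h4
      rw [h4]
      simp
    · have h4 := hD.eigenvalue_gt i j (not_lt.1 hj)
      have h5 := pi_sq_div_four_le_laplaceEigenvalue hr (h.cell i) hb j.pos
      have h6 : 1 ≤ 8 / Real.pi ^ 2 * D.eigenvalue i j := by
        rw [div_mul_eq_mul_div, one_le_div (by positivity)]
        linarith
      rw [← mul_assoc]
      exact le_mul_of_one_le_left (sq_nonneg _) h6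
  rw [← h1, ← h2, inv_mul_le_iff₀ (by positivity)] at h3
  rw [mul_pow, hC]
  linarith

end MSData

/-! ### Supports of hat functions -/

section Supports

variable {N r : ℕ}

lemma hat_nonneg (p : Node N r) (x : ℝ × ℝ) : 0 ≤ hat p x :=
  mul_nonneg (hatFactor_nonneg _ _ _) (hatFactor_nonneg _ _ _)

/-- Hat functions are nonnegative, so a zero is a minimum of both slices and their `deriv` is zero
there, even at kinks, where this is the default value. -/
lemma gradDot_hat_eq_zero {p : Node N r} {x : ℝ × ℝ} (hx : hat p x = 0) (w : ℝ × ℝ → ℝ) :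
    gradDot (hat p) w x = 0 := by
  have h1 : deriv₁ (hat p) x = 0 := IsLocalMin.deriv_eq_zero
    (Filter.Eventually.of_forall fun t => (hx.le.trans (hat_nonneg p (t, x.2)) : hat p x ≤ _))
  have h2 : deriv₂ (hat p) x = 0 := IsLocalMin.deriv_eq_zero
    (Filter.Eventually.of_forall fun t => (hx.le.trans (hat_nonneg p (x.1, t)) : hat p x ≤ _))
  rw [gradDot_eq, h1, h2, zero_mul, zero_mul, add_zero]

lemma abs_lt_one_of_hat_ne_zero {p : Node N r} {x : ℝ × ℝ} (hx : hat p x ≠ 0) :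
    |((N * r : ℕ) : ℝ) * x.1 - (p.1 + 1)| < 1 ∧ |((N * r : ℕ) : ℝ) * x.2 - (p.2 + 1)| < 1 := by
  rw [hat_apply] at hx
  exact ⟨abs_lt_one_of_hatFactor_ne_zero (left_ne_zero_of_mul hx),
    abs_lt_one_of_hatFactor_ne_zero (right_ne_zero_of_mul hx)⟩

lemma mem_mesh_interval_of_abs_lt {n : ℕ} {p : Fin (n - 1)} {q : ℕ} {t : ℝ}
    (hp : |(n : ℝ) * t - (p + 1)| < 1) (hq : |(n : ℝ) * t - (q + 1)| < 1) :
    (p : ℕ) ≤ q + 1 ∧ q ≤ p + 1 := by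
  rw [abs_lt] at hp hq
  have h1 : ((p : ℕ) : ℝ) < q + 2 := by linarith
  have h2 : (q : ℝ) < (p : ℕ) + 2 := by linarith
  have h1' : (p : ℕ) < q + 2 := by exact_mod_cast h1
  have h2' : q < (p : ℕ) + 2 := by exact_mod_cast h2
  omega

lemma exists_common_interval {n : ℕ} (p q : Fin (n - 1)) (h : (p : ℕ) ≤ q + 1 ∧ (q : ℕ) ≤ p + 1) :
    ∃ c : Fin n, ((p : ℝ) + 1) / n ∈ Set.Icc ((c : ℝ) / n) (((c : ℝ) + 1) / n) ∧
      ((q : ℝ) + 1) / n ∈ Set.Icc ((c : ℝ) / n) (((c : ℝ) + 1) / n) := by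
  have hp := p.2
  have hq := q.2
  have hn : (0 : ℝ) ≤ n := Nat.cast_nonneg n
  have key : ∀ a b : ℕ, a ≤ b → ((a : ℕ) : ℝ) / n ≤ (b : ℝ) / n := fun a b hab =>
    div_le_div_of_nonneg_right (Nat.cast_le.2 hab) hn
  obtain ⟨c, hc⟩ : ∃ c : Fin n, (c : ℕ) = min (p : ℕ) q + 1 := ⟨⟨_, by omega⟩, rfl⟩
  refine ⟨c, ⟨?_, ?_⟩, ⟨?_, ?_⟩⟩ <;> exact_mod_cast key _ _ (by omega)

/-- If the hat functions of two vertices have overlapping supports, then some element of the fine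
mesh has both vertices. -/
lemma exists_common_cell {p q : Node N r} {x : ℝ × ℝ} (hp : hat p x ≠ 0) (hq : hat q x ≠ 0) :
    ∃ c, nodePoint p ∈ cell (N * r) c ∧ nodePoint q ∈ cell (N * r) c := by
  obtain ⟨hp1, hp2⟩ := abs_lt_one_of_hat_ne_zero hp
  obtain ⟨hq1, hq2⟩ := abs_lt_one_of_hat_ne_zero hq
  obtain ⟨c₁, h1, h1'⟩ := exists_common_interval p.1 q.1 (mem_mesh_interval_of_abs_lt hp1 hq1)
  obtain ⟨c₂, h2, h2'⟩ := exists_common_interval p.2 q.2 (mem_mesh_interval_of_abs_lt hp2 hq2)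
  exact ⟨(c₁, c₂), ⟨h1, h2⟩, ⟨h1', h2'⟩⟩

/-- By integrality, a fine vertex strictly inside a coarse interval is at least one fine mesh width
away from its end points, which is the half-width of the support of the hat function. -/
lemma mem_Ioo_of_node_mem_Ioo {c : Fin N} {p : ℕ} (hr : 0 < r) {t : ℝ}
    (hp : ((p : ℝ) + 1) / (N * r : ℕ) ∈ Set.Ioo ((c : ℝ) / N) (((c : ℝ) + 1) / N))
    (ht : |((N * r : ℕ) : ℝ) * t - (p + 1)| < 1) :
    t ∈ Set.Ioo ((c : ℝ) / N) (((c : ℝ) + 1) / N) := by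
  have hN : (0 : ℝ) < N := by exact_mod_cast c.pos
  have hr' : (0 : ℝ) < r := by exact_mod_cast hr
  obtain ⟨h1, h2⟩ := hp
  push_cast at h1 h2 ht
  rw [div_lt_div_iff₀ hN (by positivity)] at h1
  rw [div_lt_div_iff₀ (by positivity) hN] at h2
  have h3 : ((c : ℕ) : ℝ) * r < p + 1 := by nlinarith
  have h4 : (p : ℝ) + 1 < ((c : ℕ) + 1) * r := by nlinarith
  have h3' : (c : ℕ) * r < p + 1 := by exact_mod_cast h3
  have h4' : p + 1 < ((c : ℕ) + 1) * r := by exact_mod_cast h4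
  have h5 : ((c : ℕ) : ℝ) * r ≤ p := by exact_mod_cast Nat.lt_succ_iff.1 h3'
  have h6 : (p : ℝ) + 1 + 1 ≤ ((c : ℕ) + 1) * r := by exact_mod_cast h4'
  rw [abs_lt] at ht
  have h7 : ((c : ℕ) : ℝ) * r < N * t * r := by linarith
  have h8 : N * t * r < (((c : ℕ) : ℝ) + 1) * r := by linarith
  have h9 := lt_of_mul_lt_mul_right h7 hr'.le
  have h10 := lt_of_mul_lt_mul_right h8 hr'.le
  constructor
  · rw [div_lt_iff₀ hN]; linarith
  · rw [lt_div_iff₀ hN]; linarith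

/-- This keeps the hat function of a dual node away from all other coarse elements, so the auxiliary
conditions of different elements decouple. -/
lemma hat_eq_zero_of_notMem_interior (hr : 0 < r) {p : Node N r} {i : Elem N}
    (hp : nodePoint p ∈ interior (cell N i)) {x : ℝ × ℝ} (hx : x ∉ interior (cell N i)) :
    hat p x = 0 := by
  by_contra h0
  obtain ⟨h1, h2⟩ := abs_lt_one_of_hat_ne_zero h0
  rw [interior_cell] at hp hx
  exact hx ⟨mem_Ioo_of_node_mem_Ioo hr hp.1 h1, mem_Ioo_of_node_mem_Ioo hr hp.2 h2⟩

end Supports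

/-! ### Normalized hat functions -/

section Normalized

variable {N r : ℕ} {κ : ℝ × ℝ → ℝ} {β : ℝ}

lemma femFunction_single (p : Node N r) : femFunction (Pi.single p 1) = hat p := by
  rw [femFunction]
  simp [Pi.single_apply, ite_smul]

lemma energyNorm_hat_pos (h : IsWeight κ β (Set.Icc 0 1)) (p : Node N r) :
    0 < energyNorm κ (hat p) := by
  rw [energyNorm, ← femFunction_single, energy_femFunction h]
  exact Real.sqrt_pos.2 (posDef_pos (posDef_stiffness h) (by simp))

/-- The vector that represents a normalized hat function. -/
def hatVector (κ : ℝ × ℝ → ℝ) (p : Node N r) : Node N r → ℝ :=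
  (energyNorm κ (hat p))⁻¹ • Pi.single p 1

lemma femFunction_hatVector (p : Node N r) : femFunction (hatVector κ p) = normalizedHat κ p := by
  rw [hatVector, ← coe_femLip, map_smul, Submodule.coe_smul, coe_femLip, femFunction_single,
    normalizedHat]

lemma hatVector_apply_of_ne {p q : Node N r} (h : q ≠ p) : hatVector κ p q = 0 := by
  simp [hatVector, h]

lemma hatVector_apply_self_ne (h : IsWeight κ β (Set.Icc 0 1)) (p : Node N r) :
    hatVector κ p p ≠ 0 := by
  simpa [hatVector] using (energyNorm_hat_pos h p).ne'

lemma eq_sum_hatVector (h : IsWeight κ β (Set.Icc 0 1)) (y : Node N r → ℝ) :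
    y = ∑ p, (y p * energyNorm κ (hat p)) • hatVector κ p := by
  have h1 : ∀ p : Node N r, (y p * energyNorm κ (hat p)) • hatVector κ p =
      Pi.single p (y p) := by
    intro p
    have := (energyNorm_hat_pos h p).ne'
    rw [hatVector, smul_smul, mul_assoc, mul_inv_cancel₀ this, mul_one, ← Pi.single_smul]
    simp
  simp only [h1]
  exact (Finset.univ_sum_single y).symm

lemma energy_normalizedHat_self (h : IsWeight κ β (Set.Icc 0 1)) (p : Node N r) :
    hatVector κ p ⬝ᵥ stiffness N r κ *ᵥ hatVector κ p = 1 := by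
  have hpos := energyNorm_hat_pos h p
  have h1 : energyNorm κ (hat p) ^ 2 =
      (Pi.single p 1 : Node N r → ℝ) ⬝ᵥ stiffness N r κ *ᵥ Pi.single p 1 := by
    rw [energyNorm, ← energy_femFunction h, femFunction_single, Real.sq_sqrt]
    rw [← femFunction_single, energy_femFunction h]
    exact posDef_nonneg (posDef_stiffness h) _
  rw [hatVector, Matrix.mulVec_smul, smul_dotProduct, dotProduct_smul, ← h1, smul_eq_mul,
    smul_eq_mul]
  field_simp

lemma energy_hatVector_of_disjoint (h : IsWeight κ β (Set.Icc 0 1)) {p q : Node N r}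
    (hpq : ∀ c, nodePoint p ∈ cell (N * r) c → nodePoint q ∉ cell (N * r) c) :
    hatVector κ p ⬝ᵥ stiffness N r κ *ᵥ hatVector κ q = 0 := by
  have h1 : energy κ (hat p) (hat q) = 0 := by
    rw [energy, energyOn]
    refine integral_eq_zero_of_ae (Filter.Eventually.of_forall fun x => ?_)
    by_cases hp : hat p x = 0
    · simp [gradDot_hat_eq_zero hp]
    · have hq : hat q x = 0 := by
        by_contra hq
        obtain ⟨c, hc, hc'⟩ := exists_common_cell hp hq
        exact hpq c hc hc'
      simp [gradDot_comm (hat p), gradDot_hat_eq_zero hq]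
  rw [← femFunction_single, ← femFunction_single, energy_femFunction h] at h1
  rw [hatVector, hatVector, Matrix.mulVec_smul, smul_dotProduct, dotProduct_smul, h1]
  simp

end Normalized

/-! ### Dual functions and the projection onto the kernel space -/

namespace MSData

variable {N r : ℕ} {D : MSData N r} {κ : ℝ × ℝ → ℝ} {β : ℝ}

variable (D κ) in
/-- The vectors that represent the normalized hat functions of the dual nodes. -/
def dualHatVector (i : Elem N) (j : Fin (D.numAux i)) : Node N r → ℝ :=
  hatVector κ (D.dualNode i j)

variable (D κ) in
/-- The vectors that represent the dual functions. -/
def dualVector (i : Elem N) (j : Fin (D.numAux i)) : Node N r → ℝ :=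
  ∑ l, (D.dualMatrix κ i)⁻¹ j l • D.dualHatVector κ i l

lemma femFunction_dualHatVector (i : Elem N) (j : Fin (D.numAux i)) :
    femFunction (D.dualHatVector κ i j) = D.dualHat κ i j := femFunction_hatVector _

lemma femFunction_dualVector (i : Elem N) (j : Fin (D.numAux i)) :
    femFunction (D.dualVector κ i j) = D.dualFun κ i j := by
  rw [dualVector, dualFun, ← coe_femLip]
  simp only [map_sum, map_smul, Submodule.coe_sum, Submodule.coe_smul, coe_femLip,
    femFunction_dualHatVector]

lemma IsAdmissible.dualHatVector_orthonormal (hD : D.IsAdmissible κ)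
    (h : IsWeight κ β (Set.Icc 0 1)) (z z' : Σ i : Elem N, Fin (D.numAux i)) :
    D.dualHatVector κ z.1 z.2 ⬝ᵥ stiffness N r κ *ᵥ D.dualHatVector κ z'.1 z'.2 =
      if z = z' then 1 else 0 := by
  split_ifs with hz
  · rw [hz]
    exact energy_normalizedHat_self h _
  · exact energy_hatVector_of_disjoint h fun c hc hc' => hz (hD.separated c z z' hc hc')

lemma IsAdmissible.auxCoeff_dualHatVector (hD : D.IsAdmissible κ) (hr : 0 < r)
    (h : IsWeight κ β (Set.Icc 0 1)) (i : Elem N) (j k : Fin (D.numAux i)) :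
    hD.auxCoeff hr h i k (D.dualHatVector κ i j) = D.dualMatrix κ i j k := by
  rw [auxCoeff_apply, femFunction_dualHatVector]
  rfl

lemma IsAdmissible.auxCoeff_dualHatVector_of_ne (hD : D.IsAdmissible κ) (hr : 0 < r)
    (h : IsWeight κ β (Set.Icc 0 1)) {i i' : Elem N} (hi : i ≠ i') (j : Fin (D.numAux i))
    (k : Fin (D.numAux i')) : hD.auxCoeff hr h i' k (D.dualHatVector κ i j) = 0 := by
  rw [auxCoeff_apply, femFunction_dualHatVector, localMass, mul_eq_zero]
  refine Or.inr (setIntegral_eq_zero_of_forall_eq_zero fun x hx => ?_)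
  have h0 : hat (D.dualNode i j) x = 0 :=
    hat_eq_zero_of_notMem_interior hr (hD.dualNode_interior i j)
      fun hx' => hi (eq_of_mem_interior_cell hx' hx)
  simp [dualHat, normalizedHat, h0]

/-- This is `S_i⁻¹ S_i = 1`, read off entrywise. -/
lemma IsAdmissible.auxCoeff_dualVector (hD : D.IsAdmissible κ) (hr : 0 < r)
    (h : IsWeight κ β (Set.Icc 0 1)) (i : Elem N) (j k : Fin (D.numAux i)) :
    hD.auxCoeff hr h i k (D.dualVector κ i j) = if j = k then 1 else 0 := by
  rw [dualVector, map_sum]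
  simp only [map_smul, smul_eq_mul, hD.auxCoeff_dualHatVector]
  have h1 := Matrix.nonsing_inv_mul _ (hD.dualMatrix_nonsingular i)
  have h2 := congrFun (congrFun h1 j) k
  rw [Matrix.mul_apply, Matrix.one_apply] at h2
  exact h2

lemma IsAdmissible.auxCoeff_dualVector_of_ne (hD : D.IsAdmissible κ) (hr : 0 < r)
    (h : IsWeight κ β (Set.Icc 0 1)) {i i' : Elem N} (hi : i ≠ i') (j : Fin (D.numAux i))
    (k : Fin (D.numAux i')) : hD.auxCoeff hr h i' k (D.dualVector κ i j) = 0 := by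
  rw [dualVector, map_sum]
  simp [hD.auxCoeff_dualHatVector_of_ne hr h hi]

/-- The projection onto the functions without auxiliary part. -/
def IsAdmissible.auxProj (hD : D.IsAdmissible κ) (hr : 0 < r)
    (h : IsWeight κ β (Set.Icc 0 1)) : (Node N r → ℝ) →ₗ[ℝ] (Node N r → ℝ) :=
  LinearMap.id - ∑ i, ∑ j, (hD.auxCoeff hr h i j).smulRight (D.dualVector κ i j)

lemma IsAdmissible.auxProj_apply (hD : D.IsAdmissible κ) (hr : 0 < r)
    (h : IsWeight κ β (Set.Icc 0 1)) (y : Node N r → ℝ) :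
    hD.auxProj hr h y = y - ∑ i, ∑ j, hD.auxCoeff hr h i j y • D.dualVector κ i j := by
  simp [auxProj, LinearMap.sum_apply]

/-- The space of vectors without auxiliary part. -/
def IsAdmissible.kernelSpace (hD : D.IsAdmissible κ) (hr : 0 < r)
    (h : IsWeight κ β (Set.Icc 0 1)) : Submodule ℝ (Node N r → ℝ) :=
  ⨅ i, ⨅ j, LinearMap.ker (hD.auxCoeff hr h i j)

lemma IsAdmissible.mem_kernelSpace (hD : D.IsAdmissible κ) (hr : 0 < r)
    (h : IsWeight κ β (Set.Icc 0 1)) {y : Node N r → ℝ} :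
    y ∈ hD.kernelSpace hr h ↔ ∀ i j, hD.auxCoeff hr h i j y = 0 := by
  simp [kernelSpace, Submodule.mem_iInf]

lemma IsAdmissible.auxProj_mem (hD : D.IsAdmissible κ) (hr : 0 < r)
    (h : IsWeight κ β (Set.Icc 0 1)) (y : Node N r → ℝ) :
    hD.auxProj hr h y ∈ hD.kernelSpace hr h := by
  rw [hD.mem_kernelSpace]
  intro i k
  rw [hD.auxProj_apply, map_sub, map_sum, Finset.sum_eq_single i]
  · rw [map_sum]
    simp [hD.auxCoeff_dualVector]
  · intro i' _ hi'
    rw [map_sum]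
    simp [hD.auxCoeff_dualVector_of_ne hr h hi']
  · simp

lemma IsAdmissible.auxProj_of_mem (hD : D.IsAdmissible κ) (hr : 0 < r)
    (h : IsWeight κ β (Set.Icc 0 1)) {y : Node N r → ℝ} (hy : y ∈ hD.kernelSpace hr h) :
    hD.auxProj hr h y = y := by
  rw [hD.mem_kernelSpace] at hy
  simp [hD.auxProj_apply, hy]

/-- This is `S_i S_i⁻¹ = 1`: a dual hat function equals its own expansion in the dual functions. It
is the reason why dual nodes contribute nothing to the special basis. -/
lemma IsAdmissible.auxProj_dualHatVector (hD : D.IsAdmissible κ) (hr : 0 < r)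
    (h : IsWeight κ β (Set.Icc 0 1)) (i : Elem N) (j : Fin (D.numAux i)) :
    hD.auxProj hr h (D.dualHatVector κ i j) = 0 := by
  rw [hD.auxProj_apply, Finset.sum_eq_single i]
  · simp only [hD.auxCoeff_dualHatVector, dualVector, Finset.smul_sum, smul_smul]
    rw [Finset.sum_comm]
    simp only [← Finset.sum_smul]
    have h1 := Matrix.mul_nonsing_inv _ (hD.dualMatrix_nonsingular i)
    have h2 : ∀ l, ∑ k, D.dualMatrix κ i j k * (D.dualMatrix κ i)⁻¹ k l =
        if j = l then 1 else 0 := by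
      intro l
      have := congrFun (congrFun h1 j) l
      rwa [Matrix.mul_apply, Matrix.one_apply] at this
    simp [h2]
  · intro i' _ hi'
    simp [hD.auxCoeff_dualHatVector_of_ne hr h hi'.symm]
  · simp

lemma IsAdmissible.kernelVector_eq (hD : D.IsAdmissible κ) (hr : 0 < r)
    (h : IsWeight κ β (Set.Icc 0 1)) (p : Node N r) :
    D.kernelVector κ p = hD.auxProj hr h (hatVector κ p) := by
  have h1 : normalizedHat κ p -
      ∑ i, ∑ j, localMass κ i (normalizedHat κ p) (D.auxFun i j) • D.dualFun κ i j =
      femFunction (hD.auxProj hr h (hatVector κ p)) := by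
    rw [hD.auxProj_apply, ← coe_femLip]
    simp only [map_sub, map_sum, map_smul, Submodule.coe_sub, Submodule.coe_sum,
      Submodule.coe_smul, coe_femLip, femFunction_hatVector, femFunction_dualVector,
      hD.auxCoeff_apply]
  rw [kernelVector, h1, nodalVector_femFunction]

/-- The kernel vectors span the space of vectors without auxiliary part. -/
lemma IsAdmissible.span_kernelVector (hD : D.IsAdmissible κ) (hr : 0 < r)
    (h : IsWeight κ β (Set.Icc 0 1)) :
    Submodule.span ℝ (D.kernelVector κ '' {p | ¬ D.IsDual p}) = hD.kernelSpace hr h := by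
  refine le_antisymm (Submodule.span_le.2 ?_) fun y hy => ?_
  · rintro _ ⟨p, -, rfl⟩
    rw [hD.kernelVector_eq hr h]
    exact hD.auxProj_mem hr h _
  -- The projection fixes `y`; applied to the expansion of `y` in hat vectors it annihilates those
  -- of the dual nodes and turns the others into kernel vectors.
  · rw [← hD.auxProj_of_mem hr h hy, eq_sum_hatVector h y, map_sum]
    refine Submodule.sum_mem _ fun p _ => ?_
    rw [map_smul]
    refine Submodule.smul_mem _ _ ?_
    by_cases hp : D.IsDual p
    · obtain ⟨i, j, rfl⟩ := hp
      have : hD.auxProj hr h (hatVector κ (D.dualNode i j)) = 0 :=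
        hD.auxProj_dualHatVector hr h i j
      rw [this]
      exact Submodule.zero_mem _
    · rw [← hD.kernelVector_eq hr h]
      exact Submodule.subset_span ⟨p, hp, rfl⟩

lemma dualVector_apply_of_not_isDual {q : Node N r} (hq : ¬ D.IsDual q) (i : Elem N)
    (j : Fin (D.numAux i)) : D.dualVector κ i j q = 0 := by
  rw [dualVector, Finset.sum_apply]
  refine Finset.sum_eq_zero fun l _ => ?_
  rw [Pi.smul_apply, dualHatVector, hatVector_apply_of_ne (fun hql => hq ⟨i, l, hql.symm⟩),
    smul_zero]

/-- The dual functions vanish at all non-dual vertices. So there a kernel vector agrees with its hat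
vector, and these entries form an invertible diagonal block, which makes the kernel vectors
independent. -/
lemma IsAdmissible.card_le_finrank_kernelSpace (hD : D.IsAdmissible κ) (hr : 0 < r)
    (h : IsWeight κ β (Set.Icc 0 1)) [Fintype {p // ¬ D.IsDual p}] :
    Fintype.card {p // ¬ D.IsDual p} ≤ Module.finrank ℝ (hD.kernelSpace hr h) := by
  have happ : ∀ p q, ¬ D.IsDual q → D.kernelVector κ p q = hatVector κ p q := by
    intro p q hq
    rw [hD.kernelVector_eq hr h, hD.auxProj_apply, Pi.sub_apply]
    simp [Finset.sum_apply, dualVector_apply_of_not_isDual hq]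
  have hli : LinearIndependent ℝ fun p : {p // ¬ D.IsDual p} => D.kernelVector κ p := by
    rw [Fintype.linearIndependent_iff]
    intro c hc q
    have h1 := congrFun hc q
    rw [Finset.sum_apply, Finset.sum_eq_single q] at h1
    · rw [Pi.smul_apply, happ _ _ q.2, smul_eq_mul, Pi.zero_apply, mul_eq_zero] at h1
      exact h1.resolve_right (hatVector_apply_self_ne h _)
    · intro p _ hp
      rw [Pi.smul_apply, happ _ _ q.2, hatVector_apply_of_ne (fun hqp => hp (Subtype.ext hqp.symm)),
        smul_zero]
    · simp
  rw [← finrank_span_eq_card hli, ← hD.span_kernelVector hr h]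
  refine Submodule.finrank_mono (Submodule.span_mono ?_)
  rintro _ ⟨p, rfl⟩
  exact ⟨p, p.2, rfl⟩

end MSData

/-! ### The coarse elements around a vertex -/

section Hosts

variable {N r : ℕ}

/-- The intervals of the coarse mesh of the unit interval that contain a given fine vertex. -/
def hostIntervals (N r m : ℕ) : Finset (Fin N) :=
  Finset.univ.filter fun c => (c : ℕ) * r ≤ m ∧ m ≤ (c + 1) * r

/-- A fine vertex is either interior to a coarse interval or, when `r` divides `m`, the common end
point of two. The bounds on `m` exclude the end points of the unit interval, which have only one
neighbour. -/
lemma card_hostIntervals {m : ℕ} (hm : 0 < m) (hmN : m < N * r) :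
    (hostIntervals N r m).card = 1 ∨ (hostIntervals N r m).card = 2 := by
  have hr : 0 < r := Nat.pos_of_mul_pos_left (hm.trans hmN)
  have hc : m / r < N := by rwa [Nat.div_lt_iff_lt_mul hr]
  have hdiv := Nat.div_add_mod m r
  have hmod := Nat.mod_lt m hr
  set a := m / r with ha
  by_cases h0 : m % r = 0
  · right
    have hma : m = a * r := by rw [← hdiv, h0, Nat.add_zero, Nat.mul_comm]
    have ha0 : 0 < a := by
      rcases Nat.eq_zero_or_pos a with h | h
      · rw [h] at hma; omega
      · exact h
    have : hostIntervals N r m = {⟨a - 1, by omega⟩, ⟨a, hc⟩} := by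
      ext c
      simp only [hostIntervals, Finset.mem_filter, Finset.mem_univ, true_and, Finset.mem_insert,
        Finset.mem_singleton, Fin.ext_iff]
      rw [hma, Nat.mul_le_mul_right_iff hr, Nat.mul_le_mul_right_iff hr]
      omega
    rw [this, Finset.card_pair]
    simp only [ne_eq, Fin.ext_iff]
    omega
  · left
    have : hostIntervals N r m = {⟨a, hc⟩} := by
      ext c
      simp only [hostIntervals, Finset.mem_filter, Finset.mem_univ, true_and,
        Finset.mem_singleton, Fin.ext_iff]
      constructor
      · rintro ⟨h1, h2⟩
        have h1' : (c : ℕ) ≤ a := (Nat.le_div_iff_mul_le hr).2 h1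
        have h2' : a < (c : ℕ) + 1 := by
          rw [ha, Nat.div_lt_iff_lt_mul hr]
          refine lt_of_le_of_ne h2 fun h => h0 ?_
          rw [h]
          exact Nat.mul_mod_left _ _
        omega
      · intro h
        rw [h, Nat.add_mul, Nat.mul_comm a r]
        omega
    rw [this, Finset.card_singleton]

lemma mem_coarse_interval_iff (hN : 0 < N) (hr : 0 < r) (c p : ℕ) :
    ((p : ℝ) + 1) / (N * r : ℕ) ∈ Set.Icc ((c : ℝ) / N) (((c : ℝ) + 1) / N) ↔
      c * r ≤ p + 1 ∧ p + 1 ≤ (c + 1) * r := by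
  have hN' : (0 : ℝ) < N := by exact_mod_cast hN
  have hr' : (0 : ℝ) < r := by exact_mod_cast hr
  have e : ∀ t : ℝ, t / N = t * r / (N * r : ℕ) := by
    intro t
    push_cast
    field_simp
  have hNr : (0 : ℝ) < (N * r : ℕ) := by exact_mod_cast Nat.mul_pos hN hr
  rw [Set.mem_Icc, e, e, div_le_div_iff_of_pos_right hNr, div_le_div_iff_of_pos_right hNr]
  norm_cast

lemma hosts_eq_product (p : Node N r) :
    hosts p = hostIntervals N r (p.1 + 1) ×ˢ hostIntervals N r (p.2 + 1) := by
  have h1 := p.1.2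
  have hNr : 0 < N * r := by omega
  have hN : 0 < N := Nat.pos_of_mul_pos_right hNr
  have hr : 0 < r := Nat.pos_of_mul_pos_left hNr
  ext i
  simp only [hosts, Finset.mem_filter, Finset.mem_univ, true_and, Finset.mem_product,
    hostIntervals]
  rw [nodePoint, cell, Set.mem_prod, mem_coarse_interval_iff hN hr, mem_coarse_interval_iff hN hr]

lemma card_hosts (p : Node N r) :
    (hosts p).card = 1 ∨ (hosts p).card = 2 ∨ (hosts p).card = 4 := by
  have h1 := p.1.2
  have h2 := p.2.2
  rw [hosts_eq_product, Finset.card_product]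
  rcases card_hostIntervals (N := N) (r := r) (m := p.1 + 1) (by omega) (by omega) with h | h <;>
  rcases card_hostIntervals (N := N) (r := r) (m := p.2 + 1) (by omega) (by omega) with h' | h' <;>
  simp [h, h']

lemma hosts_eq_singleton {p : Node N r} {i : Elem N} (hp : nodePoint p ∈ interior (cell N i)) :
    hosts p = {i} := by
  ext i'
  simp only [hosts, Finset.mem_filter, Finset.mem_univ, true_and, Finset.mem_singleton]
  constructor
  · exact fun h => (eq_of_mem_interior_cell hp h).symm
  · rintro rfl
    exact interior_subset hp

end Hosts

/-! ### The special basis -/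

namespace MSData

variable {N r : ℕ} {D : MSData N r} {κ : ℝ × ℝ → ℝ} {β : ℝ}

lemma IsAdmissible.not_isDual_of_card_hosts (hD : D.IsAdmissible κ) {p : Node N r}
    (hp : (hosts p).card ≠ 1) : ¬ D.IsDual p := by
  rintro ⟨i, j, rfl⟩
  rw [hosts_eq_singleton (hD.dualNode_interior i j)] at hp
  exact hp (Finset.card_singleton i)

lemma mem_nodesOn {S : Finset (Elem N)} {p : Node N r} :
    p ∈ D.nodesOn S ↔ p ∈ D.nodeOrder ∧ ¬ D.IsDual p ∧ hosts p = S := by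
  simp [nodesOn]

lemma setOf_mem_map {α γ : Type*} (l : List α) (f : α → γ) :
    {v | v ∈ l.map f} = f '' {a | a ∈ l} := by
  ext v
  simp

lemma span_elementVectors (h : IsWeight κ β (Set.Icc 0 1)) (i : Elem N) :
    Submodule.span ℝ {v | v ∈ D.elementVectors κ i} =
      Submodule.span ℝ (D.kernelVector κ '' {p | p ∈ D.nodesOn {i}}) := by
  rw [elementVectors, span_modifiedGramSchmidt (posDef_stiffness h), setOf_mem_map]

lemma span_setOf_mem_flatMap {α E : Type*} [AddCommGroup E] [Module ℝ E] (l : List α)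
    (f : α → List E) {S : Submodule ℝ E}
    (hS : ∀ a ∈ l, Submodule.span ℝ {v | v ∈ f a} ≤ S) :
    Submodule.span ℝ {v | v ∈ l.flatMap f} ≤ S := by
  refine Submodule.span_le.2 fun v hv => ?_
  obtain ⟨a, ha, hva⟩ := List.mem_flatMap.1 hv
  exact hS a ha (Submodule.subset_span hva)

/-- Modulo a space that contains all element vectors, the edge vectors may be replaced by the
original kernel vectors. The space is left free because both the kernel space and the span of the
special basis are inserted. -/
lemma sup_span_edgeVectors (h : IsWeight κ β (Set.Icc 0 1)) (E : Finset (Elem N))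
    {S : Submodule ℝ (Node N r → ℝ)}
    (hS : ∀ i, Submodule.span ℝ {v | v ∈ D.elementVectors κ i} ≤ S) :
    S ⊔ Submodule.span ℝ {v | v ∈ D.edgeVectors κ E} =
      S ⊔ Submodule.span ℝ (D.kernelVector κ '' {p | p ∈ D.nodesOn E}) := by
  rw [edgeVectors, span_modifiedGramSchmidt (posDef_stiffness h), setOf_mem_map]
  have h1 := sup_span_image_eq (S := S)
    (f := orthogonalize (stiffness N r κ) (E.toList.flatMap (D.elementVectors κ)))
    (s := D.kernelVector κ '' {p | p ∈ D.nodesOn E})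
    fun u _ => span_setOf_mem_flatMap _ _ (fun i _ => hS i) (orthogonalize_sub_mem _ _ u)
  rw [Set.image_image] at h1
  exact h1

lemma sup_span_vertexVector (h : IsWeight κ β (Set.Icc 0 1)) (p : Node N r)
    {S : Submodule ℝ (Node N r → ℝ)}
    (hS : ∀ i, Submodule.span ℝ {v | v ∈ D.elementVectors κ i} ≤ S)
    (hS' : ∀ E : Finset (Elem N), E.card = 2 →
      Submodule.span ℝ {v | v ∈ D.edgeVectors κ E} ≤ S) :
    S ⊔ Submodule.span ℝ {D.vertexVector κ p} = S ⊔ Submodule.span ℝ {D.kernelVector κ p} := by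
  rw [vertexVector, span_singleton_normalize (posDef_stiffness h)]
  have h1 := sup_span_image_eq (S := S)
    (f := orthogonalize (stiffness N r κ) ((hosts p).toList.flatMap (D.elementVectors κ) ++
      ((hosts p).powersetCard 2).toList.flatMap (D.edgeVectors κ)))
    (s := {D.kernelVector κ p}) fun u _ => by
      have hm := orthogonalize_sub_mem (stiffness N r κ)
        ((hosts p).toList.flatMap (D.elementVectors κ) ++
          ((hosts p).powersetCard 2).toList.flatMap (D.edgeVectors κ)) u
      refine Submodule.span_le.2 (fun v hv => ?_) hm
      rcases List.mem_append.1 hv with hv | hv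
      · exact span_setOf_mem_flatMap _ _ (fun i _ => hS i) (Submodule.subset_span hv)
      · refine span_setOf_mem_flatMap _ _ (fun E hE => hS' E ?_) (Submodule.subset_span hv)
        rw [Finset.mem_toList, Finset.mem_powersetCard] at hE
        exact hE.2
  rw [Set.image_singleton] at h1
  exact h1

lemma mem_specialBasis {v : Node N r → ℝ} :
    v ∈ D.specialBasis κ ↔ (∃ i, v ∈ D.elementVectors κ i) ∨
      (∃ E : Finset (Elem N), E.card = 2 ∧ v ∈ D.edgeVectors κ E) ∨
      ∃ p, (p ∈ D.nodeOrder ∧ (hosts p).card = 4) ∧ D.vertexVector κ p = v := by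
  simp [specialBasis, List.mem_append, List.mem_flatMap, Finset.mem_powersetCard]

/-- The special basis spans the space of vectors without auxiliary part. -/
lemma IsAdmissible.span_specialBasis (hD : D.IsAdmissible κ) (hr : 0 < r)
    (h : IsWeight κ β (Set.Icc 0 1)) :
    Submodule.span ℝ {v | v ∈ D.specialBasis κ} = hD.kernelSpace hr h := by
  have hk : ∀ p, ¬ D.IsDual p → D.kernelVector κ p ∈ hD.kernelSpace hr h := fun p hp => by
    rw [← hD.span_kernelVector hr h]
    exact Submodule.subset_span ⟨p, hp, rfl⟩
  have hk' : ∀ S : Finset (Elem N), Submodule.span ℝ (D.kernelVector κ '' {p | p ∈ D.nodesOn S}) ≤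
      hD.kernelSpace hr h := by
    refine fun S => Submodule.span_le.2 ?_
    rintro _ ⟨p, hp, rfl⟩
    exact hk p (mem_nodesOn.1 hp).2.1
  have hel : ∀ i, Submodule.span ℝ {v | v ∈ D.elementVectors κ i} ≤ hD.kernelSpace hr h :=
    fun i => (span_elementVectors h i).le.trans (hk' _)
  have hed : ∀ E : Finset (Elem N), Submodule.span ℝ {v | v ∈ D.edgeVectors κ E} ≤
      hD.kernelSpace hr h := fun E =>
    le_sup_right.trans ((sup_span_edgeVectors h E hel).le.trans (sup_le le_rfl (hk' _)))
  -- Both inclusions use the identities modulo `S`: for the first, `S` is the kernel space, for the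
  -- second, `S` is the span of the special basis.
  refine le_antisymm (Submodule.span_le.2 fun v hv => ?_) ?_
  · rcases mem_specialBasis.1 hv with ⟨i, hv⟩ | ⟨E, -, hv⟩ | ⟨p, ⟨-, hp⟩, rfl⟩
    · exact hel i (Submodule.subset_span hv)
    · exact hed E (Submodule.subset_span hv)
    · have h1 := sup_span_vertexVector h p hel fun E _ => hed E
      have h2 : Submodule.span ℝ {D.kernelVector κ p} ≤ hD.kernelSpace hr h := by
        rw [Submodule.span_singleton_le_iff_mem]
        exact hk p (hD.not_isDual_of_card_hosts (by omega))
      have h3 := le_sup_right.trans (h1.le.trans (sup_le le_rfl h2))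
      exact h3 (Submodule.mem_span_singleton_self _)
  · rw [← hD.span_kernelVector hr h]
    refine Submodule.span_le.2 ?_
    rintro _ ⟨p, hp, rfl⟩
    have hel' : ∀ i, Submodule.span ℝ {v | v ∈ D.elementVectors κ i} ≤
        Submodule.span ℝ {v | v ∈ D.specialBasis κ} := fun i =>
      Submodule.span_mono fun v hv => mem_specialBasis.2 (Or.inl ⟨i, hv⟩)
    have hed' : ∀ E : Finset (Elem N), E.card = 2 →
        Submodule.span ℝ {v | v ∈ D.edgeVectors κ E} ≤
        Submodule.span ℝ {v | v ∈ D.specialBasis κ} := fun E hE =>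
      Submodule.span_mono fun v hv => mem_specialBasis.2 (Or.inr (Or.inl ⟨E, hE, hv⟩))
    have hmem : p ∈ D.nodesOn (hosts p) :=
      mem_nodesOn.2 ⟨hD.nodeOrder_complete p, hp, rfl⟩
    -- One, two or four host elements: the vertex belongs to an element, an edge or a coarse vertex,
    -- so no kernel vector is missed.
    rcases card_hosts p with hc | hc | hc
    · obtain ⟨i, hi⟩ := Finset.card_eq_one.1 hc
      refine hel' i ?_
      rw [span_elementVectors h]
      exact Submodule.subset_span ⟨p, hi ▸ hmem, rfl⟩
    · have h1 := sup_span_edgeVectors h (hosts p) hel'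
      rw [sup_eq_left.2 (hed' _ hc)] at h1
      exact (le_sup_right.trans h1.ge) (Submodule.subset_span ⟨p, hmem, rfl⟩)
    · have h1 := sup_span_vertexVector h p hel' hed'
      have h2 : Submodule.span ℝ {D.vertexVector κ p} ≤
          Submodule.span ℝ {v | v ∈ D.specialBasis κ} := by
        rw [Submodule.span_singleton_le_iff_mem]
        exact Submodule.subset_span (mem_specialBasis.2
          (Or.inr (Or.inr ⟨p, ⟨hD.nodeOrder_complete p, hc⟩, rfl⟩)))
      rw [sup_eq_left.2 h2] at h1
      exact (le_sup_right.trans h1.ge) (Submodule.mem_span_singleton_self _)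

lemma length_elementVectors (i : Elem N) :
    (D.elementVectors κ i).length = (D.nodesOn {i}).length := by
  rw [elementVectors, length_modifiedGramSchmidt, List.length_map]

lemma length_edgeVectors (E : Finset (Elem N)) :
    (D.edgeVectors κ E).length = (D.nodesOn E).length := by
  rw [edgeVectors, length_modifiedGramSchmidt, List.length_map]

/-- The lists of vertices behind the basis vectors are pairwise disjoint, since a vertex determines
its host set and thereby its list. Vertices with four hosts cannot be dual. For a count from above,
pairs of elements without a common edge need not be singled out. -/
lemma IsAdmissible.length_specialBasis_le (hD : D.IsAdmissible κ)
    [Fintype {p // ¬ D.IsDual p}] :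
    (D.specialBasis κ).length ≤ Fintype.card {p // ¬ D.IsDual p} := by
  classical
  have hnd : ∀ S, (D.nodesOn S).Nodup := fun S => hD.nodeOrder_nodup.filter _
  have hdisj : ∀ l : List (Finset (Elem N)), l.Nodup → (l.flatMap D.nodesOn).Nodup := by
    intro l hl
    refine List.nodup_flatMap.2 ⟨fun S _ => hnd S, hl.imp fun {S T} hST => ?_⟩
    intro p hp hp'
    exact hST ((mem_nodesOn.1 hp).2.2.symm.trans (mem_nodesOn.1 hp').2.2)
  have e1 : (((Finset.univ : Finset (Elem N)).toList.map fun i => ({i} : Finset (Elem N)))).Nodup :=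
    (Finset.nodup_toList _).map Finset.singleton_injective
  have e2 := hdisj (((Finset.univ : Finset (Elem N)).toList.map fun i => ({i} : Finset (Elem N))) ++
      ((Finset.univ : Finset (Elem N)).powersetCard 2).toList) (by
    refine List.nodup_append'.2 ⟨e1, Finset.nodup_toList _, ?_⟩
    intro S hS hS'
    obtain ⟨i, -, rfl⟩ := List.mem_map.1 hS
    rw [Finset.mem_toList, Finset.mem_powersetCard, Finset.card_singleton] at hS'
    omega)
  have e3 : ((((Finset.univ : Finset (Elem N)).toList.map fun i => ({i} : Finset (Elem N))) ++
      ((Finset.univ : Finset (Elem N)).powersetCard 2).toList).flatMap D.nodesOn ++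
      D.nodeOrder.filter fun p => (hosts p).card = 4).Nodup := by
    refine List.nodup_append'.2 ⟨e2, hD.nodeOrder_nodup.filter _, ?_⟩
    intro p hp hp'
    obtain ⟨S, hS, hpS⟩ := List.mem_flatMap.1 hp
    have h4 : (hosts p).card = 4 := by simpa using (List.mem_filter.1 hp').2
    rw [(mem_nodesOn.1 hpS).2.2] at h4
    rcases List.mem_append.1 hS with hS | hS
    · obtain ⟨i, -, rfl⟩ := List.mem_map.1 hS
      rw [Finset.card_singleton] at h4
      omega
    · rw [Finset.mem_toList, Finset.mem_powersetCard] at hS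
      omega
  have hlen : (D.specialBasis κ).length = ((((Finset.univ : Finset (Elem N)).toList.map
      fun i => ({i} : Finset (Elem N))) ++
      ((Finset.univ : Finset (Elem N)).powersetCard 2).toList).flatMap D.nodesOn ++
      D.nodeOrder.filter fun p => (hosts p).card = 4).length := by
    rw [specialBasis]
    simp only [List.length_append, List.length_flatMap, List.flatMap_append, List.length_map,
      length_elementVectors, length_edgeVectors, List.map_map, Function.comp_def]
  rw [hlen, ← List.toFinset_card_of_nodup e3, Fintype.card_subtype]
  refine Finset.card_le_card fun p hp => ?_
  rw [List.mem_toFinset, List.mem_append] at hp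
  simp only [Finset.mem_filter, Finset.mem_univ, true_and]
  rcases hp with hp | hp
  · obtain ⟨S, -, hpS⟩ := List.mem_flatMap.1 hp
    exact (mem_nodesOn.1 hpS).2.1
  · have h4 : (hosts p).card = 4 := by simpa using (List.mem_filter.1 hp).2
    exact hD.not_isDual_of_card_hosts (by omega)

/-- The columns span the kernel space, and their number is at most that of the non-dual vertices,
which is at most the dimension of this space. -/
lemma IsAdmissible.posDef_correctorMatrix (hD : D.IsAdmissible κ) (hr : 0 < r)
    (h : IsWeight κ β (Set.Icc 0 1)) : (D.correctorMatrix κ).PosDef := by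
  classical
  refine posDef_conj_columnMatrix (posDef_stiffness h) ?_
  rw [hD.span_specialBasis hr h]
  exact hD.length_specialBasis_le.trans (hD.card_le_finrank_kernelSpace hr h)

/-- Without columns the spectrum would be empty, the condition number `0 / 0 = 0` and `q = -1`; a
non-dual vertex rules this out. -/
lemma IsAdmissible.nonempty_columns (hD : D.IsAdmissible κ) (hr : 0 < r)
    (h : IsWeight κ β (Set.Icc 0 1)) (hker : ∃ p, ¬ D.IsDual p) :
    Nonempty (Fin (D.specialBasis κ).length) := by
  classical
  obtain ⟨p, hp⟩ := hker
  have h1 := hD.card_le_finrank_kernelSpace hr h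
  have h2 : 0 < Fintype.card {p // ¬ D.IsDual p} := Fintype.card_pos_iff.2 ⟨⟨p, hp⟩⟩
  rw [← Fin.pos_iff_nonempty, Nat.pos_iff_ne_zero]
  intro h0
  rw [List.length_eq_zero_iff] at h0
  rw [← hD.span_specialBasis hr h, h0] at h1
  have h3 : {v : Node N r → ℝ | v ∈ ([] : List (Node N r → ℝ))} = ∅ := by simp
  rw [h3, Submodule.span_empty, finrank_bot] at h1
  omega

lemma IsAdmissible.range_basisMatrix (hD : D.IsAdmissible κ) (hr : 0 < r)
    (h : IsWeight κ β (Set.Icc 0 1)) :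
    LinearMap.range (D.basisMatrix κ).mulVecLin = hD.kernelSpace hr h := by
  rw [basisMatrix, range_columnMatrix, hD.span_specialBasis hr h]

end MSData

/-! ### Inexact projections by the conjugate gradient algorithm -/

section Projection

variable {ι τ : Type*} [Fintype ι] [Fintype τ]

lemma dotProduct_conj_mulVec (A : Matrix ι ι ℝ) (K : Matrix ι τ ℝ) (y y' : τ → ℝ) :
    y ⬝ᵥ (Kᵀ * A * K) *ᵥ y' = (K *ᵥ y) ⬝ᵥ A *ᵥ (K *ᵥ y') := by
  rw [← Matrix.mulVec_mulVec, ← Matrix.mulVec_mulVec, Matrix.dotProduct_mulVec,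
    Matrix.vecMul_transpose]

/-- Conjugate gradient iterations for the Galerkin equations in the range of `K` approximate the
orthogonal projection of a unit vector onto this range. -/
lemma exists_projection_cgIterate_error_le [DecidableEq ι] [DecidableEq τ] [Nonempty τ]
    {A : Matrix ι ι ℝ} (hA : A.PosDef) {K : Matrix ι τ ℝ} (hG : (Kᵀ * A * K).PosDef) {g : ι → ℝ} (hg : g ⬝ᵥ A *ᵥ g = 1) (k : ℕ)
    {q : ℝ} (hq : q = (√(conditionNumber (Kᵀ * A * K)) - 1) /
      (√(conditionNumber (Kᵀ * A * K)) + 1)) :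
    ∃ P ∈ LinearMap.range K.mulVecLin,
      (∀ w ∈ LinearMap.range K.mulVecLin, (g - P) ⬝ᵥ A *ᵥ w = 0) ∧
      √((P - K *ᵥ cgIterate (Kᵀ * A * K) (Kᵀ *ᵥ (A *ᵥ g)) k) ⬝ᵥ
        A *ᵥ (P - K *ᵥ cgIterate (Kᵀ * A * K) (Kᵀ *ᵥ (A *ᵥ g)) k)) ≤
        2 * q ^ k / (1 + q ^ (2 * k)) := by
  set G := Kᵀ * A * K with hGdef
  set b := Kᵀ *ᵥ (A *ᵥ g) with hb
  set x := G⁻¹ *ᵥ b with hx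
  have hGx : G *ᵥ x = b := by
    rw [hx, Matrix.mulVec_mulVec, Matrix.mul_nonsing_inv _ ((Matrix.isUnit_iff_isUnit_det _).1
      hG.isUnit), Matrix.one_mulVec]
  have horth : ∀ w ∈ LinearMap.range K.mulVecLin, (g - K *ᵥ x) ⬝ᵥ A *ᵥ w = 0 := by
    rintro _ ⟨y, rfl⟩
    rw [Matrix.mulVecLin_apply, dotProduct_mulVec_symm hA.isHermitian, sub_eq_add_neg,
      Matrix.mulVec_add, dotProduct_add, Matrix.mulVec_neg, dotProduct_neg,
      ← dotProduct_conj_mulVec, ← hGdef, hGx, hb, Matrix.dotProduct_mulVec y,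
      Matrix.vecMul_transpose, add_neg_cancel]
  refine ⟨K *ᵥ x, ⟨x, rfl⟩, horth, ?_⟩
  -- The initial error is the projection of the unit vector `g` itself, which has energy norm at
  -- most one by Pythagoras.
  have hle : x ⬝ᵥ G *ᵥ x ≤ 1 := by
    have h1 := horth _ ⟨x, rfl⟩
    have h2 := posDef_nonneg hA (g - K *ᵥ x)
    have h3 := dotProduct_mulVec_symm hA.isHermitian g (K *ᵥ x)
    rw [Matrix.mulVecLin_apply] at h1
    rw [dotProduct_conj_mulVec]
    simp only [Matrix.mulVec_sub, sub_dotProduct, dotProduct_sub] at h1 h2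
    linarith
  have h4 := cgIterate_error_le hG hGx k hq
  rw [dotProduct_conj_mulVec, Matrix.mulVec_sub] at h4
  refine h4.trans ?_
  have hq01 := rate_mem_Ico hG
  rw [← hq] at hq01
  have hq0 := hq01.1
  refine mul_le_of_le_one_right (by positivity) ?_
  exact Real.sqrt_le_one.2 hle

end Projection

/-! ### Estimates for the load -/

section Load

variable {N r : ℕ} {κ : ℝ × ℝ → ℝ} {β : ℝ}

lemma setIntegral_mul_le_l2Norm_mul (h : IsWeight κ β (Set.Icc 0 1)) {f : ℝ × ℝ → ℝ}
    (hf : MemLp f 2 (volume.restrict Omega)) (v : lipSpace) :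
    ∫ x in Omega, f x * (v : ℝ × ℝ → ℝ) x ≤ l2Norm f * √(h.omega.one.massForm v v) := by
  have hv : MemLp (v : ℝ × ℝ → ℝ) 2 (volume.restrict Omega) := by
    rw [memLp_two_iff_integrable_sq (continuous_of_mem_lipSpace v.2).aestronglyMeasurable]
    simpa [sq] using h.omega.one.integrable_coe_mul v v
  have h1 : inner ℝ (hf.toLp f) (hv.toLp _) = ∫ x in Omega, f x * (v : ℝ × ℝ → ℝ) x := by
    rw [L2.inner_def]
    refine integral_congr_ae ?_
    filter_upwards [hf.coeFn_toLp, hv.coeFn_toLp] with x hx hx'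
    rw [hx, hx']
    simp [mul_comm]
  have h2 : ‖hv.toLp _‖ ^ 2 = h.omega.one.massForm v v := by
    rw [← real_inner_self_eq_norm_sq, L2.inner_def, IsWeight.massForm_apply]
    refine integral_congr_ae ?_
    filter_upwards [hv.coeFn_toLp] with x hx'
    rw [hx']
    simp [sq]
  rw [← h1, ← h2, Real.sqrt_sq (norm_nonneg _), l2Norm, ← Lp.norm_toLp f hf]
  exact real_inner_le_norm _ _

/-- The stiffness matrix as a bilinear form. -/
def stiffnessForm (N r : ℕ) (κ : ℝ × ℝ → ℝ) : LinearMap.BilinForm ℝ (Node N r → ℝ) :=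
  Matrix.toBilin' (stiffness N r κ)

lemma stiffnessForm_apply (x y : Node N r → ℝ) :
    stiffnessForm N r κ x y = x ⬝ᵥ stiffness N r κ *ᵥ y := Matrix.toBilin'_apply' _ _ _

lemma stiffnessForm_eq_energy (h : IsWeight κ β (Set.Icc 0 1)) (x y : Node N r → ℝ) :
    stiffnessForm N r κ x y = energy κ (femFunction x) (femFunction y) := by
  rw [stiffnessForm_apply, energy_femFunction h]

lemma stiffnessForm_comm (h : IsWeight κ β (Set.Icc 0 1)) (x y : Node N r → ℝ) :
    stiffnessForm N r κ x y = stiffnessForm N r κ y x := by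
  rw [stiffnessForm_eq_energy h, stiffnessForm_eq_energy h, energy, energyOn_comm, energy]

lemma stiffnessForm_nonneg (h : IsWeight κ β (Set.Icc 0 1)) (x : Node N r → ℝ) :
    0 ≤ stiffnessForm N r κ x x := by
  rw [stiffnessForm_apply]
  exact posDef_nonneg (posDef_stiffness h) x

lemma energyNorm_femFunction_sub (h : IsWeight κ β (Set.Icc 0 1)) (x y : Node N r → ℝ) :
    energyNorm κ (femFunction x - femFunction y) = formNorm (stiffnessForm N r κ) (x - y) := by
  have h1 : femFunction x - femFunction y = femFunction (x - y) := by
    rw [← coe_femLip, ← coe_femLip, ← coe_femLip, map_sub, Submodule.coe_sub]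
  rw [energyNorm, formNorm, stiffnessForm_eq_energy h, h1]

/-- The square of the `L²` norm of a finite element function. -/
def femMass (h : IsWeight κ β (Set.Icc 0 1)) (y : Node N r → ℝ) : ℝ :=
  h.omega.one.massForm (femLip N r y) (femLip N r y)

lemma femMass_nonneg (h : IsWeight κ β (Set.Icc 0 1)) (y : Node N r → ℝ) : 0 ≤ femMass h y :=
  h.omega.one.massForm_nonneg _

/-- Stability: `‖u‖² ≤ a(u, u) = ∫ f u ≤ ‖f‖ ‖u‖` with the norms in `L²`, where the constant is one
thanks to the Friedrichs inequality. -/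
lemma sqrt_femMass_le (h : IsWeight κ β (Set.Icc 0 1)) {f : ℝ × ℝ → ℝ}
    (hf : MemLp f 2 (volume.restrict Omega)) {u : Node N r → ℝ}
    (hu : ∀ y, stiffnessForm N r κ u y = ∫ x in Omega, f x * femFunction y x) :
    √(femMass h u) ≤ l2Norm f := by
  have h1 : femMass h u ≤ stiffnessForm N r κ u u := by
    rw [stiffnessForm_eq_energy h]
    exact massForm_one_le_energyForm h fun x hx => femFunction_eq_zero_of_notMem u hx
  have h2 := setIntegral_mul_le_l2Norm_mul h hf (femLip N r u)
  rw [coe_femLip, ← hu] at h2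
  have h3 := Real.mul_self_sqrt (femMass_nonneg h u)
  by_contra hlt
  rw [not_le] at hlt
  have h0 : 0 ≤ l2Norm f := ENNReal.toReal_nonneg
  have h4 : l2Norm f * √(femMass h u) < √(femMass h u) * √(femMass h u) :=
    mul_lt_mul_of_pos_right hlt (h0.trans_lt hlt)
  have h5 : stiffnessForm N r κ u u ≤ l2Norm f * √(femMass h u) := h2
  linarith

/-- From `‖w‖_a² = ∫ f w ≤ ‖f‖ ‖w‖ ≤ ‖f‖ c ‖w‖_a` one factor cancels. It is applied to the
projection of the discrete solution, for which `c = C_* H`. -/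
lemma formNorm_le_of_femMass_le (h : IsWeight κ β (Set.Icc 0 1)) {f : ℝ × ℝ → ℝ}
    (hf : MemLp f 2 (volume.restrict Omega)) {w : Node N r → ℝ} {c : ℝ} (hc : 0 ≤ c)
    (hw : stiffnessForm N r κ w w = ∫ x in Omega, f x * femFunction w x)
    (hm : femMass h w ≤ c ^ 2 * stiffnessForm N r κ w w) :
    formNorm (stiffnessForm N r κ) w ≤ c * l2Norm f := by
  have h0 : 0 ≤ l2Norm f := ENNReal.toReal_nonneg
  have h2 := setIntegral_mul_le_l2Norm_mul h hf (femLip N r w)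
  rw [coe_femLip, ← hw] at h2
  have h3 : √(femMass h w) ≤ c * formNorm (stiffnessForm N r κ) w := by
    refine (Real.sqrt_le_sqrt hm).trans ?_
    rw [Real.sqrt_mul (sq_nonneg c), Real.sqrt_sq hc, formNorm]
  have h4 : stiffnessForm N r κ w w ≤ l2Norm f * (c * formNorm (stiffnessForm N r κ) w) :=
    h2.trans (mul_le_mul_of_nonneg_left h3 h0)
  rw [← formNorm_sq (stiffnessForm_nonneg h)] at h4
  by_contra hlt
  rw [not_le] at hlt
  have h5 := mul_lt_mul_of_pos_right hlt ((mul_nonneg hc h0).trans_lt hlt)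
  nlinarith

end Load

/-! ### Error of the multiscale method -/

namespace MSData

variable {N r : ℕ} {D : MSData N r} {κ : ℝ × ℝ → ℝ} {β : ℝ}

lemma localM_le_constM (i : Elem N) : D.localM κ i ≤ D.constM κ :=
  le_ciSup (Set.finite_range _).bddAbove i

lemma constM_nonneg : 0 ≤ D.constM κ := Real.iSup_nonneg fun _ => norm_nonneg _

lemma sum_dualVector_eq (c : (i : Elem N) → Fin (D.numAux i) → ℝ) :
    ∑ i, ∑ j, c i j • D.dualVector κ i j = ∑ z : Σ i : Elem N, Fin (D.numAux i),
      (∑ j, c z.1 j * (D.dualMatrix κ z.1)⁻¹ j z.2) • D.dualHatVector κ z.1 z.2 := by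
  rw [Fintype.sum_sigma]
  refine Finset.sum_congr rfl fun i _ => ?_
  simp only [dualVector, Finset.smul_sum, smul_smul, Finset.sum_smul]
  exact Finset.sum_comm

/-- Since the dual hat functions are orthonormal, on each element the sum of squares is the energy
of the combination of dual functions with coefficients `c i`. This is a quadratic form whose matrix
has norm `M_i`. -/
lemma IsAdmissible.sum_sq_dual_le (hD : D.IsAdmissible κ) (h : IsWeight κ β (Set.Icc 0 1))
    (c : (i : Elem N) → Fin (D.numAux i) → ℝ) :
    ∑ z : Σ i : Elem N, Fin (D.numAux i),
      (∑ j, c z.1 j * (D.dualMatrix κ z.1)⁻¹ j z.2) ^ 2 ≤ D.constM κ * ∑ i, ∑ j, c i j ^ 2 := by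
  rw [Fintype.sum_sigma, Finset.mul_sum]
  refine Finset.sum_le_sum fun i _ => ?_
  have horth : ∀ l l', stiffnessForm N r κ (D.dualHatVector κ i l) (D.dualHatVector κ i l') =
      if l = l' then 1 else 0 := by
    intro l l'
    rw [stiffnessForm_apply, hD.dualHatVector_orthonormal h ⟨i, l⟩ ⟨i, l'⟩]
    simp
  rw [← apply_sum_smul_of_orthonormal horth]
  have h1 : ∑ l, (∑ j, c i j * (D.dualMatrix κ i)⁻¹ j l) • D.dualHatVector κ i l =
      ∑ j, c i j • D.dualVector κ i j := by
    simp only [dualVector, Finset.smul_sum, smul_smul, Finset.sum_smul]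
    exact Finset.sum_comm
  have h2 : stiffnessForm N r κ (∑ j, c i j • D.dualVector κ i j)
      (∑ j, c i j • D.dualVector κ i j) = c i ⬝ᵥ (Matrix.of fun j l =>
        energy κ (D.dualFun κ i j) (D.dualFun κ i l)) *ᵥ c i := by
    simp only [map_sum, LinearMap.sum_apply, map_smul, LinearMap.smul_apply, smul_eq_mul,
      dotProduct, Matrix.mulVec, Matrix.of_apply, stiffnessForm_eq_energy h,
      femFunction_dualVector, Finset.mul_sum]
    rw [Finset.sum_comm]
    exact Finset.sum_congr rfl fun j _ => Finset.sum_congr rfl fun l _ => by ring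
  rw [h1, h2]
  refine (dotProduct_mulVec_le_opNorm _ _).trans ?_
  exact mul_le_mul_of_nonneg_right (localM_le_constM i) (by positivity)

variable (D κ) in
/-- The vector obtained from a dual node by conjugate gradient iterations. -/
def correctorVector (k : ℕ) (z : Σ i : Elem N, Fin (D.numAux i)) : Node N r → ℝ :=
  D.basisMatrix κ *ᵥ cgIterate (D.correctorMatrix κ)
    ((D.basisMatrix κ)ᵀ *ᵥ (stiffness N r κ *ᵥ D.dualHatVector κ z.1 z.2)) k

variable (D κ) in
/-- The vectors that represent the basis of the multiscale space. -/
def multiscaleVector (k : ℕ) (z : Σ i : Elem N, Fin (D.numAux i)) : Node N r → ℝ :=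
  D.dualHatVector κ z.1 z.2 - D.correctorVector κ k z

lemma multiscaleSpace_eq_map (k : ℕ) :
    D.multiscaleSpace κ k = (Submodule.span ℝ (Set.range (D.multiscaleVector κ k))).map
      (lipSpace.subtype ∘ₗ femLip N r) := by
  rw [multiscaleSpace, Submodule.map_span, ← Set.range_comp]
  congr 2
  funext z
  rw [Function.comp_apply, LinearMap.comp_apply, multiscaleVector, correctorVector, map_sub, map_sub,
    Submodule.subtype_apply, Submodule.subtype_apply, coe_femLip, coe_femLip,
    femFunction_dualHatVector, corrector, ← femFunction_dualHatVector, nodalVector_femFunction]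

lemma IsAdmissible.exists_correction (hD : D.IsAdmissible κ) (hr : 0 < r)
    (h : IsWeight κ β (Set.Icc 0 1)) (hker : ∃ p, ¬ D.IsDual p) (k : ℕ)
    (z : Σ i : Elem N, Fin (D.numAux i)) :
    ∃ P ∈ hD.kernelSpace hr h,
      (∀ w ∈ hD.kernelSpace hr h,
        stiffnessForm N r κ (D.dualHatVector κ z.1 z.2 - P) w = 0) ∧
      formNorm (stiffnessForm N r κ) (P - D.correctorVector κ k z) ≤
        2 * D.rate κ ^ k / (1 + D.rate κ ^ (2 * k)) := by
  have := hD.nonempty_columns hr h hker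
  obtain ⟨P, hP, hPo, hPε⟩ := exists_projection_cgIterate_error_le (posDef_stiffness h)
    (K := D.basisMatrix κ) (hD.posDef_correctorMatrix hr h) (g := D.dualHatVector κ z.1 z.2)
    ((hD.dualHatVector_orthonormal h z z).trans (if_pos rfl)) k (q := D.rate κ) rfl
  rw [hD.range_basisMatrix hr h] at hP hPo
  refine ⟨P, hP, fun w hw => (stiffnessForm_apply _ _).trans (hPo w hw), ?_⟩
  rw [formNorm, stiffnessForm_apply]
  exact hPε

lemma IsAdmissible.rate_mem (hD : D.IsAdmissible κ) (hr : 0 < r)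
    (h : IsWeight κ β (Set.Icc 0 1)) (hker : ∃ p, ¬ D.IsDual p) : D.rate κ ∈ Set.Ico 0 1 := by
  have := hD.nonempty_columns hr h hker
  exact rate_mem_Ico (hD.posDef_correctorMatrix hr h)

lemma multiscaleVector_mem (k : ℕ) (z : Σ i : Elem N, Fin (D.numAux i)) :
    D.dualHatVector κ z.1 z.2 - D.correctorVector κ k z ∈
      Submodule.span ℝ (Set.range (D.multiscaleVector κ k)) :=
  Submodule.subset_span ⟨z, rfl⟩

/-- The error is compared with that of the combination of multiscale vectors that has the dual hat
coefficients `d` of the auxiliary part of `u`. The projection of `u` onto the kernel space gives the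
term with `Cstar`, the inexact correctors give the other one. -/
lemma IsAdmissible.formNorm_sub_le (hD : D.IsAdmissible κ) (hN : 0 < N) (hr : 0 < r)
    (h : IsWeight κ β (Set.Icc 0 1)) (hβ : 0 ≤ β) (hker : ∃ p, ¬ D.IsDual p) {f : ℝ × ℝ → ℝ}
    (hf : MemLp f 2 (volume.restrict Omega)) {u w : Node N r → ℝ} {k : ℕ}
    (hu : ∀ y, stiffnessForm N r κ u y = ∫ x in Omega, f x * femFunction y x)
    (hw : w ∈ Submodule.span ℝ (Set.range (D.multiscaleVector κ k)))
    (hwo : ∀ y ∈ Submodule.span ℝ (Set.range (D.multiscaleVector κ k)),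
      stiffnessForm N r κ (u - w) y = 0) :
    formNorm (stiffnessForm N r κ) (u - w) ≤
      (Cstar * coarseSize N +
        2 * D.rate κ ^ k / (1 + D.rate κ ^ (2 * k)) * √(D.totalAux : ℝ) * √(D.constM κ) *
          (coarseSize N)⁻¹ * √β) * l2Norm f := by
  have hs := stiffnessForm_comm (N := N) (r := r) h
  have hB := stiffnessForm_nonneg (N := N) (r := r) h
  have hH := coarseSize_pos hN
  have hq0 := (hD.rate_mem hr h hker).1
  choose P hP hPo hPε using hD.exists_correction hr h hker k
  obtain ⟨c, hc⟩ : ∃ c : (i : Elem N) → Fin (D.numAux i) → ℝ,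
      ∀ i j, c i j = hD.auxCoeff hr h i j u :=
    ⟨fun i j => hD.auxCoeff hr h i j u, fun _ _ => rfl⟩
  obtain ⟨d, hd⟩ : ∃ d : (Σ i : Elem N, Fin (D.numAux i)) → ℝ,
      ∀ z, d z = ∑ j, c z.1 j * (D.dualMatrix κ z.1)⁻¹ j z.2 :=
    ⟨fun z => ∑ j, c z.1 j * (D.dualMatrix κ z.1)⁻¹ j z.2, fun _ => rfl⟩
  have hmem : u - ∑ z, d z • D.dualHatVector κ z.1 z.2 ∈
      hD.kernelSpace hr h := by
    simp only [hd]
    rw [← sum_dualVector_eq c]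
    simp only [hc]
    rw [← hD.auxProj_apply]
    exact hD.auxProj_mem hr h u
  obtain ⟨w₀, hw₀, hw₀o, hle⟩ := exists_projection_formNorm_le (B := stiffnessForm N r κ) (u := u)
    hs hB (W := hD.kernelSpace hr h) (g := fun z => D.dualHatVector κ z.1 z.2) (P := P)
    (C := D.correctorVector κ k) (d := d) (ε := 2 * D.rate κ ^ k / (1 + D.rate κ ^ (2 * k)))
    hP (fun z w hw => hPo z w hw) hPε hmem
  have hmem' : ∑ z, d z • (D.dualHatVector κ z.1 z.2 - D.correctorVector κ k z) ∈
      Submodule.span ℝ (Set.range (D.multiscaleVector κ k)) :=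
    Submodule.sum_mem _ fun z _ => Submodule.smul_mem _ (d z) (multiscaleVector_mem k z)
  refine (formNorm_le_of_orthogonal hs hB hw hmem' hwo).trans (hle.trans ?_)
  have hC : 0 ≤ Cstar * coarseSize N := by
    have := Real.pi_pos
    rw [Cstar]
    positivity
  -- Orthogonality gives `a(w₀, w₀) = a(u, w₀) = ∫ f w₀`, and `w₀` has no auxiliary part, so the
  -- approximation property applies.
  have hw₀le : formNorm (stiffnessForm N r κ) w₀ ≤ Cstar * coarseSize N * l2Norm f := by
    refine formNorm_le_of_femMass_le h hf hC ?_ ?_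
    · have := hw₀o w₀ hw₀
      rw [map_sub, LinearMap.sub_apply, sub_eq_zero] at this
      rw [← this, hu]
    · rw [hD.mem_kernelSpace] at hw₀
      rw [stiffnessForm_eq_energy h]
      exact hD.massForm_le_of_auxCoeff_eq_zero hr h hN hw₀
  have hm := sqrt_femMass_le h hf hu
  -- The factors come from the dual functions (`M`), from the Bessel inequality with the weight `κ ≤
  -- β` and the scaling `H⁻²`, and from the stability of `u`.
  have hdle : √(∑ z, d z ^ 2) ≤ √(D.constM κ) * (coarseSize N)⁻¹ * √β * l2Norm f := by
    have h1 := hD.sum_sq_dual_le h c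
    simp only [← hd] at h1
    have h2 : ∑ i, ∑ j, c i j ^ 2 ≤ (coarseSize N ^ 2)⁻¹ * (β * femMass h u) := by
      simp only [hc]
      exact hD.sum_auxCoeff_sq_le hr h hN u
    have h3 := h1.trans (mul_le_mul_of_nonneg_left h2 constM_nonneg)
    refine (Real.sqrt_le_sqrt h3).trans ?_
    rw [Real.sqrt_mul constM_nonneg, Real.sqrt_mul (by positivity), Real.sqrt_mul hβ,
      Real.sqrt_inv, Real.sqrt_sq hH.le, mul_assoc, mul_assoc]
    gcongr
  have hcard : (Fintype.card (Σ i : Elem N, Fin (D.numAux i)) : ℝ) = D.totalAux := by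
    rw [Fintype.card_sigma, totalAux]
    simp
  rw [hcard]
  have hε : 0 ≤ 2 * D.rate κ ^ k / (1 + D.rate κ ^ (2 * k)) * √(D.totalAux : ℝ) := by positivity
  calc _ ≤ Cstar * coarseSize N * l2Norm f +
        2 * D.rate κ ^ k / (1 + D.rate κ ^ (2 * k)) * √(D.totalAux : ℝ) *
          (√(D.constM κ) * (coarseSize N)⁻¹ * √β * l2Norm f) :=
        add_le_add hw₀le (mul_le_mul_of_nonneg_left hdle hε)
    _ = _ := by ring

lemma IsAdmissible.energyNorm_sub_le (hD : D.IsAdmissible κ) (hN : 0 < N) (hr : 0 < r)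
    (h : IsWeight κ β (Set.Icc 0 1)) (hβ : 0 ≤ β) (hker : ∃ p, ¬ D.IsDual p)
    {f uh uk : ℝ × ℝ → ℝ} {k : ℕ} (hf : MemLp f 2 (volume.restrict Omega))
    (huh : IsGalerkinSolution κ f (Vh N r) uh)
    (huk : IsGalerkinSolution κ f (D.multiscaleSpace κ k) uk) :
    energyNorm κ (uh - uk) ≤
      (Cstar * coarseSize N +
        2 * D.rate κ ^ k / (1 + D.rate κ ^ (2 * k)) * √(D.totalAux : ℝ) * √(D.constM κ) *
          (coarseSize N)⁻¹ * √β) * l2Norm f := by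
  obtain ⟨huh, huh'⟩ := huh
  obtain ⟨huk, huk'⟩ := huk
  rw [multiscaleSpace_eq_map] at huk huk'
  obtain ⟨w, hw, rfl⟩ := huk
  have hu := femFunction_nodalVector (Nat.mul_pos hN hr) huh
  have hu' : ∀ y : Node N r → ℝ, stiffnessForm N r κ (nodalVector uh) y =
      ∫ x in Omega, f x * femFunction y x := by
    intro y
    rw [stiffnessForm_eq_energy h, hu]
    exact huh' _ (femFunction_mem_Vh y)
  have hE : energyNorm κ (uh - (lipSpace.subtype ∘ₗ femLip N r) w) =
      formNorm (stiffnessForm N r κ) (nodalVector uh - w) := by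
    rw [← energyNorm_femFunction_sub h, hu]
    rfl
  rw [hE]
  refine hD.formNorm_sub_le hN hr h hβ hker hf hu' hw fun y hy => ?_
  rw [map_sub, LinearMap.sub_apply, hu' y, stiffnessForm_eq_energy h, sub_eq_zero]
  exact (huk' _ ⟨y, hy, rfl⟩).symm

end MSData

end MSFEM

end

/-! ### The error estimates and the condition on the number of iterations -/

theorem mainTheorem2 (N r : ℕ) (hN : 0 < N) (hr : 0 < r)
    (κ : ℝ × ℝ → ℝ) (β : ℝ) (hκ : Measurable κ) (hκβ : ∀ x ∈ MSFEM.Omega, 1 ≤ κ x ∧ κ x ≤ β)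
    (D : MSFEM.MSData N r) (hD : D.IsAdmissible κ)
    (hker : ∃ p : MSFEM.Node N r, ¬ D.IsDual p) :
    (∀ f : ℝ × ℝ → ℝ, MemLp f 2 (volume.restrict MSFEM.Omega) →
      ∀ uh : ℝ × ℝ → ℝ, MSFEM.IsGalerkinSolution κ f (MSFEM.Vh N r) uh →
      ∀ (k : ℕ) (uk : ℝ × ℝ → ℝ), MSFEM.IsGalerkinSolution κ f (D.multiscaleSpace κ k) uk →
        MSFEM.energyNorm κ (uh - uk) ≤
          (MSFEM.Cstar * MSFEM.coarseSize N +
            2 * D.rate κ ^ k / (1 + D.rate κ ^ (2 * k)) * √(D.totalAux : ℝ) * √(D.constM κ) *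
              (MSFEM.coarseSize N)⁻¹ * √β) * MSFEM.l2Norm f ∧
        (2 * D.rate κ ^ k * √(D.totalAux : ℝ) * √(D.constM κ) * √β ≤ MSFEM.coarseSize N ^ 2 →
          MSFEM.energyNorm κ (uh - uk) ≤
            (MSFEM.Cstar + 1) * MSFEM.coarseSize N * MSFEM.l2Norm f)) ∧
    ∃ k₀ : ℕ, ∀ k ≥ k₀,
      2 * D.rate κ ^ k * √(D.totalAux : ℝ) * √(D.constM κ) * √β ≤ MSFEM.coarseSize N ^ 2 := by
  have h := MSFEM.isWeight_square hκ hκβ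
  have hβ : 0 ≤ β := by
    have h1 := hκβ (1 / 2, 1 / 2) (by constructor <;> constructor <;> norm_num)
    linarith [h1.1, h1.2]
  have hH := MSFEM.coarseSize_pos hN
  obtain ⟨hq0, hq1⟩ := hD.rate_mem hr h hker
  refine ⟨fun f hf uh huh k uk huk => ?_, ?_⟩
  · have hmain := hD.energyNorm_sub_le hN hr h hβ hker hf huh huk
    refine ⟨hmain, fun hk => hmain.trans (mul_le_mul_of_nonneg_right ?_ ENNReal.toReal_nonneg)⟩
    -- The denominator is at least one. After it is dropped, the condition on `k` bounds the
    -- corrector term by `H² H⁻¹ = H`.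
    have h1 : 2 * D.rate κ ^ k / (1 + D.rate κ ^ (2 * k)) ≤ 2 * D.rate κ ^ k :=
      div_le_self (by positivity) (le_add_of_nonneg_right (by positivity))
    have h2 : 2 * D.rate κ ^ k / (1 + D.rate κ ^ (2 * k)) * √(D.totalAux : ℝ) * √(D.constM κ) *
        (MSFEM.coarseSize N)⁻¹ * √β ≤ MSFEM.coarseSize N :=
      calc _ ≤ 2 * D.rate κ ^ k * √(D.totalAux : ℝ) * √(D.constM κ) *
            (MSFEM.coarseSize N)⁻¹ * √β := by gcongr
        _ = 2 * D.rate κ ^ k * √(D.totalAux : ℝ) * √(D.constM κ) * √β *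
            (MSFEM.coarseSize N)⁻¹ := by ring
        _ ≤ MSFEM.coarseSize N ^ 2 * (MSFEM.coarseSize N)⁻¹ :=
            mul_le_mul_of_nonneg_right hk (inv_nonneg.2 hH.le)
        _ = MSFEM.coarseSize N := by field_simp
    linarith
  · have hlim : Filter.Tendsto
        (fun k : ℕ => 2 * D.rate κ ^ k * √(D.totalAux : ℝ) * √(D.constM κ) * √β)
        Filter.atTop (nhds (2 * 0 * √(D.totalAux : ℝ) * √(D.constM κ) * √β)) :=
      ((((tendsto_pow_atTop_nhds_zero_of_lt_one hq0 hq1).const_mul 2).mul_const _).mul_const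
        _).mul_const _
    refine Filter.eventually_atTop.1 (hlim.eventually_le_const ?_)
    simpa using pow_pos hH 2
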